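/- Let $d\ge 1$, let $\Omega\subset\mathbb R^d$ be a bounded smooth domain, $\delta(x)=\operatorname{dist}(x,\partial\Omega)$, and $s,\gamma\in(0,1]$. Let $\mathbb G$ be a measurable kernel, $\mathcal G[g](x)=\int_\Omega\mathbb G(x,y)g(y)\,dy$ the Green operator, and assume ($\asymp$ means two-sided bounds with positive constants): * (G1) $\mathbb G(x,y)=\mathbb G(y,x)$ and $\mathbb G(x,y)\asymp |x-y|^{-(d-2s)}\big(1\wedge\frac{\delta(x)}{|x-y|}\big)^\gamma\big(1\wedge\frac{\delta(y)}{|x-y|}\big)^\gamma$ for $x\ne y$ in $\Omega$; * (G2) for $x\in\Omega$, $\zeta\in\partial\Omega$ the limit $D_\gamma\mathbb G(x,\zeta)=\lim_{\Omega\ni y\to\zeta}\mathbb G(x,y)/\delta(y)^\gamma$ exists and $D_\gamma\mathbb G(x,\zeta)\asymp\delta(x)^\gamma/|x-\zeta|^{d-2s+2\gamma}$; * (G3) $\mathcal G$ maps $\delta^\gamma L^\infty(\Omega)$ into $\delta^\gamma C(\overline\Omega)$; * (S1) $-\mathrm L$, where $\mathrm L=\mathcal G^{-1}$ on $L^2(\Omega)$,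 generates a strongly continuous semigroup $\mathcal S(t)$ on $L^2(\Omega)$ which is submarkovian: $0\le v\le1$ implies $0\le\mathcal S(t)v\le 1$ for all $t\ge 0$. Let $\alpha\in(0,1)$ and $T>0$. Then $L^2(\Omega)$ has an orthonormal basis $(\varphi_j)_{j\ge1}$ of eigenfunctions of $\mathrm L$. For every such basis, with $\mathrm L\varphi_j=\lambda_j\varphi_j$, the following holds. Let $\mathrm H(\Omega)=\{v\in L^2(\Omega):\|\mathrm Lv\|^2=\sum_j\lambda_j^2\langle v,\varphi_j\rangle^2<\infty\}$, with norm $\|\mathrm L v\|$, and set $$E_{\alpha,\beta}(z)=\sum_{k\ge0}\frac{z^k}{\Gamma(\alpha k+\beta)},\quad \Phi_\alpha(\tau)=\sum_{k\ge0}\frac{(-\tau)^k}{k!\,\Gamma(1-\alpha(k+1))},\quad P_\alpha(t;\lambda)=t^{\alpha-1}E_{\alpha,\alpha}(-\lambda t^\alpha),$$ $$\mathbb S(t,x,y)=\sum_je^{-\lambda_jt}\varphi_j(x)\varphi_j(y),\quad \mathbb S_\alpha(t,x,y)=\int_0^\infty\Phi_\alpha(\tau)\,\mathbb S(\tau t^\alpha,x,y)\,d\tau,\quad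 \mathbb P_\alpha(t,x,y)=\alpha t^{\alpha-1}\int_0^\infty\tau\Phi_\alpha(\tau)\,\mathbb S(\tau t^\alpha,x,y)\,d\tau,$$ and let $\mathcal S_\alpha(t)$, $\mathcal P_\alpha(t)$ be the integral operators on $\Omega$ with kernels $\mathbb S_\alpha(t,\cdot,\cdot)$, $\mathbb P_\alpha(t,\cdot,\cdot)$. Let $u_0\in\mathrm H(\Omega)$ and $f\in C^1([0,T];L^2(\Omega))$, and write $u_j(t)=\langle u(t),\varphi_j\rangle$, $f_j(t)=\langle f(t),\varphi_j\rangle$, $u_{0,j}=\langle u_0,\varphi_j\rangle$. * Caputo case. There is a unique $u\in C([0,T];L^2(\Omega))\cap C((0,T];\mathrm H(\Omega))\cap C^1((0,T];L^2(\Omega))$ with $u(0)=u_0$ such that, for all $j$ and $t\in(0,T)$, the integral below converges absolutely and $$\frac1{\Gamma(1-\alpha)}\int_0^t\frac{u_j'(\tau)}{(t-\tau)^{\alpha}}\,d\tau+\lambda_ju_j(t)=f_j(t).$$ * Riemann–Liouville case. There is a unique $u:(0,T]\to L^2(\Omega)$ such that $t^{1-\alpha}u$ (extended suitably to $t=0$)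 lies in $C([0,T];L^2(\Omega))\cap C((0,T];\mathrm H(\Omega))\cap C^1((0,T];L^2(\Omega))$, such that, for all $j$ and $t\in(0,T)$, the derivative below exists and $$\frac{1}{\Gamma(1-\alpha)}\frac{d}{dt}\int_0^t\frac{u_j(\tau)}{(t-\tau)^{\alpha}}\,d\tau+\lambda_ju_j(t)=f_j(t),$$ and such that $\lim_{h\to0^+}\frac1{\Gamma(1-\alpha)}\int_0^h(h-\xi)^{-\alpha}u(\xi)\,d\xi=u_0$ in $L^2(\Omega)$. In each case the solution is given by $u=\mathcal H_\bullet[u_0,f,0]$, where for $t\in(0,T]$ and a.e. $x\in\Omega$ (the integrals over $\Omega$ against $u_0$ and over $(0,t)$ being absolutely convergent) $$\mathcal H_C[u_0,f,0](t)=\mathcal S_\alpha(t)[u_0]+\int_0^t\mathcal P_\alpha(t-\tau)[f(\tau)]\,d\tau,\qquad \mathcal H_R[u_0,f,0](t)=\mathcal P_\alpha(t)[u_0]+\int_0^t\mathcal P_\alpha(t-\tau)[f(\tau)]\,d\tau;$$ equivalently, with convergence in $L^2(\Omega)$, $$\mathcal H_C[u_0,f,0](t)=\sum_j\Big(E_{\alpha,1}(-\lambda_jt^\alpha)u_{0,j}+\int_0^tP_\alpha(t-\tau;\lambda_j)f_j(\tau)\,d\tau\Big)\varphi_j\quad(0\le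 t\le T),$$ $$\mathcal H_R[u_0,f,0](t)=\sum_j\Big(P_\alpha(t;\lambda_j)u_{0,j}+\int_0^tP_\alpha(t-\tau;\lambda_j)f_j(\tau)\,d\tau\Big)\varphi_j\quad(0<t\le T).$$ -/

import Mathlib

open MeasureTheory Set Filter Topology

namespace FracDiff

noncomputable section

/-! ### Fractional calculus in time -/

/-- Riemann–Liouville integral of order `β > 0` started at time `0`, for functions with values in a
normed space: `(1/Γ(β)) ∫₀ᵗ (t - ξ)^(β-1) w(ξ) dξ`. -/
def rlIntegral {E : Type*} [NormedAddCommGroup E] [NormedSpace ℝ E]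
    (β : ℝ) (w : ℝ → E) (t : ℝ) : E :=
  (Real.Gamma β)⁻¹ • ∫ ξ in (0 : ℝ)..t, (t - ξ) ^ (β - 1) • w ξ

/-- Caputo derivative of order `α ∈ (0,1)`: `(1/Γ(1-α)) ∫₀ᵗ (t - τ)^(-α) w'(τ) dτ`. -/
def caputoDeriv (α : ℝ) (w : ℝ → ℝ) (t : ℝ) : ℝ :=
  rlIntegral (1 - α) (deriv w) t

/-- The integral defining the Caputo derivative at time `t` converges. -/
def CaputoDifferentiableAt (α : ℝ) (w : ℝ → ℝ) (t : ℝ) : Prop :=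
  IntervalIntegrable (fun τ => (t - τ) ^ ((1 - α) - 1) • deriv w τ) volume 0 t

/-- Riemann–Liouville derivative of order `α ∈ (0,1)`. -/
def rlDeriv (α : ℝ) (w : ℝ → ℝ) (t : ℝ) : ℝ :=
  deriv (rlIntegral (1 - α) w) t

/-- The Riemann–Liouville derivative exists at time `t`. -/
def RLDifferentiableAt (α : ℝ) (w : ℝ → ℝ) (t : ℝ) : Prop :=
  DifferentiableAt ℝ (rlIntegral (1 - α) w) t

/-- Two-parameter Mittag-Leffler function. -/
def mittagLeffler (α β z : ℝ) : ℝ :=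
  ∑' k : ℕ, z ^ k / Real.Gamma (α * k + β)

/-- Mainardi function. The convention `1/Γ(-n) = 0` at the poles of `Γ` agrees with Mathlib's values
`Real.Gamma (-n) = 0` and `x / 0 = 0`. -/
def mainardi (α t : ℝ) : ℝ :=
  ∑' k : ℕ, (-t) ^ k / ((k.factorial : ℝ) * Real.Gamma (1 - α * (k + 1)))

/-! ### The space domain -/

/-- `Ω` is a bounded domain (nonempty, open, connected) of `ℝ^d` with smooth boundary: near each
boundary point it is a strict sublevel set of a smooth function with nonvanishing gradient there. -/
structure IsBoundedSmoothDomain {d : ℕ} (Ω : Set (EuclideanSpace ℝ (Fin d))) : Prop where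
  isOpen : IsOpen Ω
  connected : IsConnected Ω
  bounded : Bornology.IsBounded Ω
  smooth_boundary : ∀ ζ ∈ frontier Ω, ∃ ρ : EuclideanSpace ℝ (Fin d) → ℝ,
    ContDiff ℝ ((⊤ : ℕ∞) : WithTop ℕ∞) ρ ∧ fderiv ℝ ρ ζ ≠ 0 ∧ ∀ᶠ x in 𝓝 ζ, x ∈ Ω ↔ ρ x < 0

/-- Distance to the boundary. -/
def bdist {d : ℕ} (Ω : Set (EuclideanSpace ℝ (Fin d))) (x : EuclideanSpace ℝ (Fin d)) : ℝ :=
  Metric.infDist x (frontier Ω)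

/-- The real Hilbert space `L²(Ω)`. -/
abbrev L2 {d : ℕ} (Ω : Set (EuclideanSpace ℝ (Fin d))) : Type :=
  Lp ℝ 2 ((volume : Measure (EuclideanSpace ℝ (Fin d))).restrict Ω)

/-! ### The Green kernel and the operator -/

section Kernel

variable {d : ℕ} (Ω : Set (EuclideanSpace ℝ (Fin d)))
  (G : EuclideanSpace ℝ (Fin d) → EuclideanSpace ℝ (Fin d) → ℝ)

/-- The Green operator applied to a function on `Ω`. -/
def greenOp (g : EuclideanSpace ℝ (Fin d) → ℝ) (x : EuclideanSpace ℝ (Fin d)) : ℝ :=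
  ∫ y in Ω, G x y * g y

/-- The model size of the Green kernel. -/
def greenProfile (s γ : ℝ) (x y : EuclideanSpace ℝ (Fin d)) : ℝ :=
  1 / ‖x - y‖ ^ ((d : ℝ) - 2 * s) *
    (min 1 (bdist Ω x / ‖x - y‖)) ^ γ * (min 1 (bdist Ω y / ‖x - y‖)) ^ γ

/-- (G1): symmetric kernel with two-sided estimates. -/
structure HypG1 (s γ : ℝ) : Prop where
  symm : ∀ x ∈ Ω, ∀ y ∈ Ω, G x y = G y x
  estimate : ∃ c C : ℝ, 0 < c ∧ 0 < C ∧ ∀ x ∈ Ω, ∀ y ∈ Ω, x ≠ y →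
    c * greenProfile Ω s γ x y ≤ G x y ∧ G x y ≤ C * greenProfile Ω s γ x y

/-- (G2): the `γ`-normal derivative of the Green kernel exists at every boundary point, with
two-sided estimates. -/
def HypG2 (s γ : ℝ) : Prop :=
  ∃ c C : ℝ, 0 < c ∧ 0 < C ∧ ∀ x ∈ Ω, ∀ ζ ∈ frontier Ω, ∃ D : ℝ,
    Tendsto (fun y => G x y / bdist Ω y ^ γ) (𝓝[Ω] ζ) (𝓝 D) ∧
    c * (bdist Ω x ^ γ / ‖x - ζ‖ ^ ((d : ℝ) - 2 * s + 2 * γ)) ≤ D ∧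
    D ≤ C * (bdist Ω x ^ γ / ‖x - ζ‖ ^ ((d : ℝ) - 2 * s + 2 * γ))

/-- (G3): the Green operator maps `δ^γ L^∞(Ω)` into `δ^γ C(closure Ω)`. -/
def HypG3 (γ : ℝ) : Prop :=
  ∀ g : EuclideanSpace ℝ (Fin d) → ℝ, Measurable g → (∃ M : ℝ, ∀ x, |g x| ≤ M) →
    ∃ k : EuclideanSpace ℝ (Fin d) → ℝ, ContinuousOn k (closure Ω) ∧
      ∀ᵐ x ∂(volume.restrict Ω),
        greenOp Ω G (fun y => bdist Ω y ^ γ * g y) x = bdist Ω x ^ γ * k x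

/-- `v` belongs to the domain of the operator `L`, the inverse of the Green operator on `L²(Ω)`, and
`L v = g`; that is, `v` is the image of `g` under the Green operator. -/
def IsOpValue (v g : L2 Ω) : Prop :=
  (v : EuclideanSpace ℝ (Fin d) → ℝ) =ᵐ[volume.restrict Ω] greenOp Ω G g

/-- `S` is the heat semigroup of `L`: a strongly continuous semigroup on `L²(Ω)` whose infinitesimal
generator is `-L`. As generators are single valued, this contains the injectivity of the Green
operator, hence that `L` is an operator. -/
structure IsHeatSemigroup (S : ℝ → L2 Ω →L[ℝ] L2 Ω) : Prop where
  zero : S 0 = ContinuousLinearMap.id ℝ (L2 Ω)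
  add : ∀ t r : ℝ, 0 ≤ t → 0 ≤ r → S (t + r) = (S t).comp (S r)
  continuous : ∀ v : L2 Ω, ContinuousOn (fun t => S t v) (Ici 0)
  generator : ∀ v w : L2 Ω,
    HasDerivWithinAt (fun t => S t v) (-w) (Ici 0) 0 ↔ IsOpValue Ω G v w

/-- (S1): `-L` generates a semigroup which is submarkovian. -/
def HypS1 : Prop :=
  ∃ S : ℝ → L2 Ω →L[ℝ] L2 Ω, IsHeatSemigroup Ω G S ∧
    ∀ t : ℝ, 0 ≤ t → ∀ v : L2 Ω, (∀ᵐ x ∂(volume.restrict Ω), 0 ≤ v x ∧ v x ≤ 1) →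
      ∀ᵐ x ∂(volume.restrict Ω), 0 ≤ (S t v) x ∧ (S t v) x ≤ 1

/-- `φ` is an orthonormal basis of `L²(Ω)` of eigenfunctions, `L φ_j = λ_j φ_j`. -/
def IsEigenbasis (φ : HilbertBasis ℕ ℝ (L2 Ω)) (lam : ℕ → ℝ) : Prop :=
  ∀ j, IsOpValue Ω G (φ j) (lam j • φ j)

end Kernel

/-! ### Energy space, kernels and solutions, in terms of an eigenbasis -/

section Spectral

variable {d : ℕ} {Ω : Set (EuclideanSpace ℝ (Fin d))}
  (φ : HilbertBasis ℕ ℝ (L2 Ω)) (lam : ℕ → ℝ)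

/-- Membership in the energy space `H(Ω)`. -/
def MemEnergy (v : L2 Ω) : Prop :=
  Summable fun j => lam j ^ 2 * (inner ℝ v (φ j)) ^ 2

/-- The squared energy norm `‖L v‖²`. -/
def energyNormSq (v : L2 Ω) : ℝ :=
  ∑' j, lam j ^ 2 * (inner ℝ v (φ j)) ^ 2

/-- `u ∈ C(I; H(Ω))`. -/
def ContinuousOnEnergy (u : ℝ → L2 Ω) (I : Set ℝ) : Prop :=
  (∀ t ∈ I, MemEnergy φ lam (u t)) ∧
    ∀ t₀ ∈ I, Tendsto (fun t => energyNormSq φ lam (u t - u t₀)) (𝓝[I] t₀) (𝓝 0)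

/-- The class `C([0,T]; L²(Ω)) ∩ C((0,T]; H(Ω)) ∩ C¹((0,T]; L²(Ω))`. -/
structure MemSolutionClass (T : ℝ) (u : ℝ → L2 Ω) : Prop where
  continuous_L2 : ContinuousOn u (Icc 0 T)
  continuous_energy : ContinuousOnEnergy φ lam u (Ioc 0 T)
  contDiff_L2 : ContDiffOn ℝ 1 u (Ioc 0 T)

/-- Spectral solution of the problem with Caputo derivative, with `u(0) = u₀`. -/
structure IsCaputoSolution (α T : ℝ) (u₀ : L2 Ω) (f : ℝ → L2 Ω) (u : ℝ → L2 Ω) : Prop where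
  mem_class : MemSolutionClass φ lam T u
  equation : ∀ j, ∀ t ∈ Ioo 0 T,
    CaputoDifferentiableAt α (fun r => inner ℝ (u r) (φ j)) t ∧
    caputoDeriv α (fun r => inner ℝ (u r) (φ j)) t + lam j * inner ℝ (u t) (φ j)
      = inner ℝ (f t) (φ j)
  initial : u 0 = u₀

/-- Spectral solution of the problem with Riemann–Liouville derivative. The function `t^(1-α) u` is
defined on `(0,T]`, and belongs to a class of functions on `[0,T]` through its extension `w` to
`t = 0` (it has in general a nonzero limit there); the value `u 0` is irrelevant. The initial
condition holds in `L²(Ω)`. -/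
structure IsRLSolution (α T : ℝ) (u₀ : L2 Ω) (f : ℝ → L2 Ω) (u : ℝ → L2 Ω) : Prop where
  mem_class : ∃ w : ℝ → L2 Ω, MemSolutionClass φ lam T w ∧
    ∀ t ∈ Ioc 0 T, w t = t ^ (1 - α) • u t
  equation : ∀ j, ∀ t ∈ Ioo 0 T,
    RLDifferentiableAt α (fun r => inner ℝ (u r) (φ j)) t ∧
    rlDeriv α (fun r => inner ℝ (u r) (φ j)) t + lam j * inner ℝ (u t) (φ j)
      = inner ℝ (f t) (φ j)
  initial : Tendsto (rlIntegral (1 - α) u) (𝓝[>] 0) (𝓝 u₀)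

/-- The heat kernel `∑_j e^(-λ_j t) φ_j(x) φ_j(y)`. -/
def heatKernel (t : ℝ) (x y : EuclideanSpace ℝ (Fin d)) : ℝ :=
  ∑' j, Real.exp (-(lam j * t)) * (φ j x * φ j y)

/-- The kernel `S_α(t,x,y)`. -/
def kernelS (α t : ℝ) (x y : EuclideanSpace ℝ (Fin d)) : ℝ :=
  ∫ τ in Ioi (0 : ℝ), mainardi α τ * heatKernel φ lam (τ * t ^ α) x y

/-- The kernel `P_α(t,x,y)`. -/
def kernelP (α t : ℝ) (x y : EuclideanSpace ℝ (Fin d)) : ℝ :=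
  α * t ^ (α - 1) *
    ∫ τ in Ioi (0 : ℝ), τ * mainardi α τ * heatKernel φ lam (τ * t ^ α) x y

/-- The integral operator with kernel `S_α(t)`. -/
def opS (α t : ℝ) (v : L2 Ω) (x : EuclideanSpace ℝ (Fin d)) : ℝ :=
  ∫ y in Ω, kernelS φ lam α t x y * v y

/-- The integral operator with kernel `P_α(t)`. -/
def opP (α t : ℝ) (v : L2 Ω) (x : EuclideanSpace ℝ (Fin d)) : ℝ :=
  ∫ y in Ω, kernelP φ lam α t x y * v y

/-- `H_C[u₀, f, 0](t, x)`. -/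
def solC (α : ℝ) (u₀ : L2 Ω) (f : ℝ → L2 Ω) (t : ℝ) (x : EuclideanSpace ℝ (Fin d)) : ℝ :=
  opS φ lam α t u₀ x + ∫ τ in (0 : ℝ)..t, opP φ lam α (t - τ) (f τ) x

/-- `H_R[u₀, f, 0](t, x)`. -/
def solR (α : ℝ) (u₀ : L2 Ω) (f : ℝ → L2 Ω) (t : ℝ) (x : EuclideanSpace ℝ (Fin d)) : ℝ :=
  opP φ lam α t u₀ x + ∫ τ in (0 : ℝ)..t, opP φ lam α (t - τ) (f τ) x

/-- The scalar function `P_α(t; λ) = t^(α-1) E_{α,α}(-λ t^α)`. -/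
def scalarP (α l t : ℝ) : ℝ :=
  t ^ (α - 1) * mittagLeffler α α (-(l * t ^ α))

/-- Coefficients of the Mittag-Leffler form of `H_C[u₀, f, 0](t)` in the eigenbasis. -/
def coeffC (α : ℝ) (u₀ : L2 Ω) (f : ℝ → L2 Ω) (t : ℝ) (j : ℕ) : ℝ :=
  mittagLeffler α 1 (-(lam j * t ^ α)) * inner ℝ u₀ (φ j) +
    ∫ τ in (0 : ℝ)..t, scalarP α (lam j) (t - τ) * inner ℝ (f τ) (φ j)

/-- Coefficients of the Mittag-Leffler form of `H_R[u₀, f, 0](t)` in the eigenbasis. -/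
def coeffR (α : ℝ) (u₀ : L2 Ω) (f : ℝ → L2 Ω) (t : ℝ) (j : ℕ) : ℝ :=
  scalarP α (lam j) t * inner ℝ u₀ (φ j) +
    ∫ τ in (0 : ℝ)..t, scalarP α (lam j) (t - τ) * inner ℝ (f τ) (φ j)

end Spectral

end

end FracDiff

open FracDiff

/-! By (G1) the Green kernel is nonnegative off the diagonal and dominated by a multiple of
`|x-y|^(2s-d)`. Young's inequality makes the Green operator bounded on `L²`, Fubini makes it
symmetric, and `exists_kernelIter_le` shows that one of its powers maps `L²` into `L^∞`. On a
bounded domain that power is Hilbert–Schmidt, so the operator itself is compact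
(`isCompactOperator_of_symmetric_pow`) and the spectral theorem gives the basis; zero is not an
eigenvalue because a generator is single valued. Submarkovianity keeps `S(t) 1_A` bounded for all
time, which forces `λ_j > 0`. The same power of the Green operator gives a pointwise Bessel bound
for `∑ λ_j^(-2N) φ_j(x)²`, hence convergence of the heat kernel series almost everywhere.

In the eigenbasis both problems decouple. Let `k(r) = r^(-α)/Γ(1-α)`, let `P = P_α(·;λ)`, let `E(t)
= E_{α,1}(-λ t^α)`, and let `*` be convolution on the half-line. The scalar theory rests on `P * k =
E` (`rlIntegral_scalarP`) and `λ (P * 1) = 1 - E`. Uniqueness: if `k * g = -λ (1 * g)`, convolving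
with `P` gives `E * g = -(1 - E) * g`, so `1 * g = 0` (`integral_eq_zero_of_rlIntegral_eq`).
Regularity: `λ (P * h) = h - h(0) E - E * h'` (`mul_conv_scalarP_eq`) trades the unbounded factor
`λ` for a time derivative, which is why `f ∈ C¹` with values in `L²` is enough for `u(t) ∈ H`.

The passage from scalars to operators is subordination. A Hankel contour integral for `Φ_α`
(`hasSum_mainardi`) yields decay faster than every exponential (`exists_abs_mainardi_le`) and the
Mellin transform (`mellin_mainardi`), so that `E_{α,1}(-x)` and `E_{α,α}(-x)` are `∫ Φ_α(τ) e^(-xτ)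
dτ` and `α ∫ τ Φ_α(τ) e^(-xτ) dτ`. The solution operators are therefore integrals of the contraction
semigroup against `σ^k Φ_α(σ)`. Strong continuity follows by dominated convergence, derivatives are
identified coefficientwise, and only the integrability of `|Φ_α|` matters, not its sign.

For the kernel formulas, positivity of the semigroup makes the heat kernel nonnegative. Absolute
convergence of the double integrals for `v` then reduces to the vector-valued integral for `|v|`,
which converges in `L²` (`integrableOn_kernel_mul`), and Fubini applies. -/

open scoped ENNReal NNReal

namespace FracDiff

/-! ### Young's inequality for integral operators with nonnegative kernels -/

section Young

variable {X : Type*} [MeasurableSpace X] {μ : Measure X} [SFinite μ]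
  {K : X → X → ℝ≥0∞}

-- Hölder for the three functions `K^r F^p`, `K^r`, `F^p` with exponents `1/q`, `1/r - 1/q`, `1/p -
-- 1/q`; the Young relation says exactly that these add up to `1`.
omit [SFinite μ] in
theorem lintegral_mul_rpow_le_of_young (hK : Measurable (Function.uncurry K)) {p q r : ℝ}
    (hp : 0 < p) (hr : 0 < r) (hpq : p ≤ q) (hrq : r ≤ q) (hpqr : 1 / q + 1 = 1 / p + 1 / r)
    {F : X → ℝ≥0∞} (hF : Measurable F) (x : X) :
    (∫⁻ y, K x y * F y ∂μ) ^ q ≤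
      (∫⁻ y, K x y ^ r * F y ^ p ∂μ) * (∫⁻ y, K x y ^ r ∂μ) ^ (q / r - 1) *
        (∫⁻ y, F y ^ p ∂μ) ^ (q / p - 1) := by
  have hq : 0 < q := hp.trans_le hpq
  have hKx : Measurable (K x) := hK.of_uncurry_left
  have h1 : 0 ≤ 1 / r - 1 / q := sub_nonneg.2 (one_div_le_one_div_of_le hr hrq)
  have h2 : 0 ≤ 1 / p - 1 / q := sub_nonneg.2 (one_div_le_one_div_of_le hp hpq)
  have key := ENNReal.lintegral_prod_norm_pow_le (μ := μ) (Finset.univ : Finset (Fin 3))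
    (f := ![fun y => K x y ^ r * F y ^ p, fun y => K x y ^ r, fun y => F y ^ p])
    (p := ![1 / q, 1 / r - 1 / q, 1 / p - 1 / q])
    (by
      intro i _
      fin_cases i
      · exact ((hKx.pow_const r).mul (hF.pow_const p)).aemeasurable
      · exact (hKx.pow_const r).aemeasurable
      · exact (hF.pow_const p).aemeasurable)
    (by simp only [Fin.sum_univ_three, Matrix.cons_val_zero, Matrix.cons_val_one,
          Matrix.cons_val_two, Matrix.head_cons, Matrix.tail_cons]; linarith)
    (by
      intro i _
      fin_cases i
      · exact (one_div_pos.2 hq).le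
      · exact h1
      · exact h2)
  simp only [Fin.prod_univ_three, Matrix.cons_val_zero, Matrix.cons_val_one,
          Matrix.cons_val] at key
  have hpt : ∀ y, (K x y ^ r * F y ^ p) ^ (1 / q) * (K x y ^ r) ^ (1 / r - 1 / q) *
      (F y ^ p) ^ (1 / p - 1 / q) = K x y * F y := by
    intro y
    rw [ENNReal.mul_rpow_of_nonneg _ _ (one_div_pos.2 hq).le, ← ENNReal.rpow_mul,
      ← ENNReal.rpow_mul, ← ENNReal.rpow_mul, ← ENNReal.rpow_mul]
    calc _ = (K x y ^ (r * (1 / q)) * K x y ^ (r * (1 / r - 1 / q))) *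
          (F y ^ (p * (1 / q)) * F y ^ (p * (1 / p - 1 / q))) := by ring
      _ = _ := by
        rw [← ENNReal.rpow_add_of_nonneg _ _ (by positivity) (by positivity),
          ← ENNReal.rpow_add_of_nonneg _ _ (by positivity) (by positivity)]
        have e1 : r * (1 / q) + r * (1 / r - 1 / q) = 1 := by field_simp; ring
        have e2 : p * (1 / q) + p * (1 / p - 1 / q) = 1 := by field_simp; ring
        rw [e1, e2, ENNReal.rpow_one, ENNReal.rpow_one]
  simp only [hpt] at key
  calc (∫⁻ y, K x y * F y ∂μ) ^ q ≤ _ := ENNReal.rpow_le_rpow key hq.le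
    _ = _ := by
      rw [ENNReal.mul_rpow_of_nonneg _ _ hq.le, ENNReal.mul_rpow_of_nonneg _ _ hq.le,
        ← ENNReal.rpow_mul, ← ENNReal.rpow_mul, ← ENNReal.rpow_mul]
      have e1 : 1 / q * q = 1 := by field_simp
      have e2 : (1 / r - 1 / q) * q = q / r - 1 := by field_simp
      have e3 : (1 / p - 1 / q) * q = q / p - 1 := by field_simp
      rw [e1, e2, e3, ENNReal.rpow_one]

/-- The row bound controls the second factor of the pointwise inequality; after Tonelli the column
bound controls the first. -/
theorem lintegral_rpow_le_of_young (hK : Measurable (Function.uncurry K)) {p q r : ℝ}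
    (hp : 0 < p) (hr : 0 < r) (hpq : p ≤ q) (hrq : r ≤ q) (hpqr : 1 / q + 1 = 1 / p + 1 / r)
    {A : ℝ≥0∞}
    (hA₁ : ∀ᵐ x ∂μ, ∫⁻ y, K x y ^ r ∂μ ≤ A) (hA₂ : ∀ᵐ y ∂μ, ∫⁻ x, K x y ^ r ∂μ ≤ A)
    {F : X → ℝ≥0∞} (hF : Measurable F) :
    ∫⁻ x, (∫⁻ y, K x y * F y ∂μ) ^ q ∂μ ≤
      (A * ∫⁻ y, F y ^ p ∂μ) * A ^ (q / r - 1) * (∫⁻ y, F y ^ p ∂μ) ^ (q / p - 1) := by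
  have hq : 0 < q := hp.trans_le hpq
  have h1 : 0 ≤ q / r - 1 := by rw [sub_nonneg, le_div_iff₀ hr]; linarith
  have hm : Measurable (Function.uncurry fun x y => K x y ^ r * F y ^ p) :=
    (hK.pow_const r).mul ((hF.comp measurable_snd).pow_const p)
  calc ∫⁻ x, (∫⁻ y, K x y * F y ∂μ) ^ q ∂μ
      ≤ ∫⁻ x, (∫⁻ y, K x y ^ r * F y ^ p ∂μ) * A ^ (q / r - 1) *
        (∫⁻ y, F y ^ p ∂μ) ^ (q / p - 1) ∂μ := by
        refine lintegral_mono_ae ?_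
        filter_upwards [hA₁] with x hx
        refine (lintegral_mul_rpow_le_of_young hK hp hr hpq hrq hpqr hF x).trans ?_
        gcongr
    _ = (∫⁻ x, ∫⁻ y, K x y ^ r * F y ^ p ∂μ ∂μ) * A ^ (q / r - 1) *
        (∫⁻ y, F y ^ p ∂μ) ^ (q / p - 1) := by
        rw [lintegral_mul_const, lintegral_mul_const]
        · exact hm.lintegral_prod_right'
        · exact hm.lintegral_prod_right'.mul_const _
    _ ≤ _ := by
        gcongr
        rw [lintegral_lintegral_swap hm.aemeasurable]
        calc ∫⁻ y, ∫⁻ x, K x y ^ r * F y ^ p ∂μ ∂μ = ∫⁻ y, (∫⁻ x, K x y ^ r ∂μ) * F y ^ p ∂μ := by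
              refine lintegral_congr fun y => ?_
              rw [lintegral_mul_const]
              exact (hK.of_uncurry_right).pow_const r
          _ ≤ ∫⁻ y, A * F y ^ p ∂μ := by
              refine lintegral_mono_ae ?_
              filter_upwards [hA₂] with y hy
              gcongr
          _ = A * ∫⁻ y, F y ^ p ∂μ := by
              rw [lintegral_const_mul]
              exact hF.pow_const p

/-- Iterates of a positive integral operator. -/
noncomputable def kernelIter (μ : Measure X) (K : X → X → ℝ≥0∞) (F : X → ℝ≥0∞) : ℕ → X → ℝ≥0∞
  | 0 => F
  | n + 1 => fun x => ∫⁻ y, K x y * kernelIter μ K F n y ∂μ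

theorem measurable_kernelIter (hK : Measurable (Function.uncurry K)) {F : X → ℝ≥0∞}
    (hF : Measurable F) (n : ℕ) : Measurable (kernelIter μ K F n) := by
  induction n with
  | zero => exact hF
  | succ n ih =>
    exact (hK.mul (ih.comp measurable_snd)).lintegral_prod_right'

/-- If the kernel has exponent `r` with conjugate exponent `2N`, then `N` iterations map `L²` to
`L^∞`. -/
theorem exists_kernelIter_le (hK : Measurable (Function.uncurry K)) {N : ℕ} (hN : 1 ≤ N)
    {r : ℝ} (hr : r = 2 * N / (2 * N - 1)) {A : ℝ≥0∞} (hA : A ≠ ⊤)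
    (hA₁ : ∀ᵐ x ∂μ, ∫⁻ y, K x y ^ r ∂μ ≤ A) (hA₂ : ∀ᵐ y ∂μ, ∫⁻ x, K x y ^ r ∂μ ≤ A) :
    ∃ B : ℝ≥0∞, B ≠ ⊤ ∧ ∀ F : X → ℝ≥0∞, Measurable F → ∫⁻ y, F y ^ (2 : ℝ) ∂μ ≤ 1 →
      ∀ᵐ x ∂μ, kernelIter μ K F N x ≤ B := by
  have hN' : (1 : ℝ) ≤ N := by exact_mod_cast hN
  have hr1 : 1 < r := by rw [hr, lt_div_iff₀ (by linarith)]; linarith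
  have hr0 : 0 < r := by linarith
  have hinv : 1 / r = 1 - 1 / (2 * N) := by rw [hr]; field_simp
  -- A Young step lowers `1/p` by `1 - 1/r = 1/(2N)`. Starting from `1/2`, after `k` steps `1/p =
  -- (N-k)/(2N)`, which is `1/(2N)` for `k = N - 1`.
  have step : ∀ k : ℕ, k + 1 ≤ N → ∃ B : ℝ≥0∞, B ≠ ⊤ ∧ ∀ F : X → ℝ≥0∞, Measurable F →
      ∫⁻ y, F y ^ (2 : ℝ) ∂μ ≤ 1 →
      ∫⁻ x, kernelIter μ K F k x ^ (2 * N / (N - k) : ℝ) ∂μ ≤ B := by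
    intro k
    induction k with
    | zero =>
      intro _
      refine ⟨1, ENNReal.one_ne_top, fun F hF h => ?_⟩
      have : (2 * N / (N - (0 : ℕ)) : ℝ) = 2 := by
        rw [Nat.cast_zero, sub_zero, mul_div_assoc, div_self (by positivity), mul_one]
      rw [this]; exact h
    | succ k ih =>
      intro hk
      obtain ⟨B, hB, h⟩ := ih (by omega)
      have hk' : (k : ℝ) + 1 + 1 ≤ N := by exact_mod_cast hk
      have hk0 : (0 : ℝ) ≤ k := k.cast_nonneg
      set p : ℝ := 2 * N / (N - k) with hp
      set q : ℝ := 2 * N / (N - (k + 1 : ℕ)) with hq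
      have hp0 : 0 < p := by rw [hp]; apply div_pos <;> linarith
      have hpq : p ≤ q := by
        rw [hp, hq]; push_cast
        apply div_le_div_of_nonneg_left <;> linarith
      have hpi : 1 / p = (N - k) / (2 * N) := by rw [hp, one_div_div]
      have hqi : 1 / q = (N - (k + 1)) / (2 * N) := by rw [hq, one_div_div]; push_cast; rfl
      have hpqr : 1 / q + 1 = 1 / p + 1 / r := by
        rw [hpi, hqi, hinv]; field_simp; ring
      have hrq : r ≤ q := by
        have : 1 / q ≤ 1 / r := by
          have : 1 / p ≤ 1 := by
            rw [hpi, div_le_one (by linarith)]; linarith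
          linarith
        exact (one_div_le_one_div (hp0.trans_le hpq) hr0).1 this
      have e1 : 0 ≤ q / r - 1 := by rw [sub_nonneg, le_div_iff₀ hr0]; linarith
      have e2 : 0 ≤ q / p - 1 := by rw [sub_nonneg, le_div_iff₀ hp0]; linarith
      refine ⟨(A * B) * A ^ (q / r - 1) * B ^ (q / p - 1), ?_, fun F hF hF1 => ?_⟩
      · exact ENNReal.mul_ne_top (ENNReal.mul_ne_top (ENNReal.mul_ne_top hA hB)
          (ENNReal.rpow_ne_top_of_nonneg e1 hA)) (ENNReal.rpow_ne_top_of_nonneg e2 hB)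
      · refine (lintegral_rpow_le_of_young hK hp0 hr0 hpq hrq hpqr hA₁ hA₂
          (measurable_kernelIter hK hF k)).trans ?_
        have := h F hF hF1
        gcongr
  obtain ⟨n, rfl⟩ : ∃ n, N = n + 1 := ⟨N - 1, by omega⟩
  obtain ⟨B, hB, h⟩ := step n le_rfl
  have e : (2 * (n + 1 : ℕ) / ((n + 1 : ℕ) - n) : ℝ) = 2 * (n + 1) := by
    push_cast; rw [add_sub_cancel_left, div_one]
  rw [e] at h
  have hn0 : (0 : ℝ) ≤ n := n.cast_nonneg
  refine ⟨A ^ (1 / r) * B ^ (1 / (2 * ((n : ℝ) + 1))), ?_, fun F hF hF1 => ?_⟩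
  · exact ENNReal.mul_ne_top (ENNReal.rpow_ne_top_of_nonneg (by positivity) hA)
      (ENNReal.rpow_ne_top_of_nonneg (by positivity) hB)
  · filter_upwards [hA₁] with x hx
    -- The last iteration starts from `L^(2N)`, whose exponent is conjugate to `r`, so plain Hölder
    -- reaches `L^∞`.
    have hc : r.HolderConjugate (2 * ((n : ℝ) + 1)) := by
      rw [Real.holderConjugate_iff]
      refine ⟨hr1, ?_⟩
      rw [← one_div, ← one_div, hinv]; push_cast; ring
    refine (ENNReal.lintegral_mul_le_Lp_mul_Lq μ hc (hK.of_uncurry_left).aemeasurable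
      (measurable_kernelIter hK hF n).aemeasurable).trans ?_
    have := h F hF hF1
    gcongr

end Young

/-! ### Integral operators on `L²` with kernels satisfying the Schur test. -/

section KernelOperator

variable {X : Type*} [MeasurableSpace X] {μ : Measure X} [SFinite μ]
  {G : X → X → ℝ}

omit [SFinite μ] in
theorem lintegral_enorm_sq_eq (v : Lp ℝ 2 μ) :
    ∫⁻ x, ‖v x‖ₑ ^ (2 : ℝ) ∂μ = ENNReal.ofReal (‖v‖ ^ 2) := by
  have h := eLpNorm_eq_lintegral_rpow_enorm_toReal (μ := μ) (f := v) (p := 2) (by simp) (by simp)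
  simp only [ENNReal.toReal_ofNat] at h
  rw [Lp.norm_def, ← ENNReal.toReal_pow, ENNReal.ofReal_toReal
    (ENNReal.pow_ne_top (Lp.eLpNorm_ne_top v)), h, ← ENNReal.rpow_natCast, ← ENNReal.rpow_mul]
  norm_num

/-- The Schur test, as the case `p = q = 2`, `r = 1` of Young's inequality. -/
theorem lintegral_sq_lintegral_mul_le {A : ℝ≥0∞}
    (hG : Measurable (Function.uncurry G))
    (hA₁ : ∀ᵐ x ∂μ, ∫⁻ y, ‖G x y‖ₑ ∂μ ≤ A) (hA₂ : ∀ᵐ y ∂μ, ∫⁻ x, ‖G x y‖ₑ ∂μ ≤ A)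
    (v : Lp ℝ 2 μ) :
    ∫⁻ x, (∫⁻ y, ‖G x y‖ₑ * ‖v y‖ₑ ∂μ) ^ (2 : ℝ) ∂μ ≤ A ^ 2 * ENNReal.ofReal (‖v‖ ^ 2) := by
  have h := lintegral_rpow_le_of_young (μ := μ) (K := fun x y => ‖G x y‖ₑ) hG.enorm
    (p := 2) (q := 2) (r := 1) (by norm_num) (by norm_num) (by norm_num) (by norm_num)
    (by norm_num) (A := A) (by simpa using hA₁) (by simpa using hA₂)
    (F := fun y => ‖v y‖ₑ) (Lp.stronglyMeasurable v).measurable.enorm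
  refine h.trans (le_of_eq ?_)
  have e1 : (2 : ℝ) / 1 - 1 = 1 := by norm_num
  have e2 : (2 : ℝ) / 2 - 1 = 0 := by norm_num
  rw [e1, e2, ENNReal.rpow_zero, ENNReal.rpow_one, lintegral_enorm_sq_eq]
  ring

/-- The hypotheses under which a real kernel defines a bounded operator on `L²`. -/
structure IsSchurKernel (μ : Measure X) (G : X → X → ℝ) (A : ℝ≥0∞) : Prop where
  measurable : Measurable (Function.uncurry G)
  ne_top : A ≠ ⊤
  left : ∀ᵐ x ∂μ, ∫⁻ y, ‖G x y‖ₑ ∂μ ≤ A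
  right : ∀ᵐ y ∂μ, ∫⁻ x, ‖G x y‖ₑ ∂μ ≤ A

variable {A : ℝ≥0∞}

theorem IsSchurKernel.ae_integrable (h : IsSchurKernel μ G A) (v : Lp ℝ 2 μ) :
    ∀ᵐ x ∂μ, Integrable (fun y => G x y * v y) μ := by
  have h1 := lintegral_sq_lintegral_mul_le h.measurable h.left h.right v
  have hv := (Lp.stronglyMeasurable v).measurable
  have hm : Measurable fun x => (∫⁻ y, ‖G x y‖ₑ * ‖v y‖ₑ ∂μ) ^ (2 : ℝ) :=
    ((h.measurable.enorm.mul (hv.comp measurable_snd).enorm).lintegral_prod_right').pow_const _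
  have h2 := ae_lt_top hm (ne_top_of_le_ne_top
    (ENNReal.mul_ne_top (ENNReal.pow_ne_top h.ne_top) ENNReal.ofReal_ne_top) h1)
  filter_upwards [h2] with x hx
  refine ⟨(h.measurable.of_uncurry_left.mul hv).aestronglyMeasurable, ?_⟩
  rw [hasFiniteIntegral_iff_enorm]
  simp only [enorm_mul]
  exact (ENNReal.rpow_lt_top_iff_of_pos (by norm_num)).1 hx

theorem IsSchurKernel.eLpNorm_le (h : IsSchurKernel μ G A) (v : Lp ℝ 2 μ) :
    eLpNorm (fun x => ∫ y, G x y * v y ∂μ) 2 μ ≤ A * ENNReal.ofReal ‖v‖ := by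
  have h1 := lintegral_sq_lintegral_mul_le h.measurable h.left h.right v
  rw [eLpNorm_eq_lintegral_rpow_enorm_toReal (by simp) (by simp)]
  simp only [ENNReal.toReal_ofNat]
  calc (∫⁻ x, ‖∫ y, G x y * v y ∂μ‖ₑ ^ (2 : ℝ) ∂μ) ^ (1 / (2 : ℝ))
      ≤ (A ^ 2 * ENNReal.ofReal (‖v‖ ^ 2)) ^ (1 / (2 : ℝ)) := by
        gcongr
        refine le_trans (lintegral_mono fun x => ?_) h1
        gcongr
        refine (enorm_integral_le_lintegral_enorm _).trans (le_of_eq ?_)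
        simp only [enorm_mul]
    _ = A * ENNReal.ofReal ‖v‖ := by
        rw [ENNReal.ofReal_pow (norm_nonneg _), ← mul_pow, ← ENNReal.rpow_natCast,
          ← ENNReal.rpow_mul]
        norm_num

theorem IsSchurKernel.memLp (h : IsSchurKernel μ G A) (v : Lp ℝ 2 μ) :
    MemLp (fun x => ∫ y, G x y * v y ∂μ) 2 μ := by
  refine ⟨?_, (h.eLpNorm_le v).trans_lt
    (ENNReal.mul_lt_top h.ne_top.lt_top ENNReal.ofReal_lt_top)⟩
  have hm : StronglyMeasurable (Function.uncurry fun x y => G x y * v y) :=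
    (h.measurable.mul ((Lp.stronglyMeasurable v).measurable.comp measurable_snd)).stronglyMeasurable
  exact hm.integral_prod_right.aestronglyMeasurable

/-- The integral operator on `L²` given by a Schur kernel. -/
noncomputable def IsSchurKernel.op (h : IsSchurKernel μ G A) : Lp ℝ 2 μ →L[ℝ] Lp ℝ 2 μ :=
  LinearMap.mkContinuous
    { toFun := fun v => (h.memLp v).toLp
      map_add' := by
        intro u v
        rw [← MemLp.toLp_add, MemLp.toLp_eq_toLp_iff]
        filter_upwards [h.ae_integrable u, h.ae_integrable v] with x hu hv
        rw [Pi.add_apply, ← integral_add hu hv]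
        refine integral_congr_ae ?_
        filter_upwards [Lp.coeFn_add u v] with y hy
        rw [hy, Pi.add_apply, mul_add]
      map_smul' := by
        intro c v
        rw [RingHom.id_apply, ← MemLp.toLp_const_smul, MemLp.toLp_eq_toLp_iff]
        refine Eventually.of_forall fun x => ?_
        rw [Pi.smul_apply, smul_eq_mul, ← integral_const_mul]
        refine integral_congr_ae ?_
        filter_upwards [Lp.coeFn_smul c v] with y hy
        rw [hy, Pi.smul_apply, smul_eq_mul]
        ring }
    A.toReal (fun v => by
      change ‖(h.memLp v).toLp‖ ≤ _
      rw [Lp.norm_toLp]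
      refine (ENNReal.toReal_mono (ENNReal.mul_ne_top h.ne_top ENNReal.ofReal_ne_top)
        (h.eLpNorm_le v)).trans (le_of_eq ?_)
      rw [ENNReal.toReal_mul, ENNReal.toReal_ofReal (norm_nonneg _)])

theorem IsSchurKernel.coeFn_op (h : IsSchurKernel μ G A) (v : Lp ℝ 2 μ) :
    h.op v =ᵐ[μ] fun x => ∫ y, G x y * v y ∂μ :=
  (h.memLp v).coeFn_toLp

/-- Fubini for `G x y * u y * v x`; its absolute integrability follows from Cauchy–Schwarz and the
Schur bound for `|G|` applied to `|u|`. -/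
theorem IsSchurKernel.isSymmetric_op (h : IsSchurKernel μ G A)
    (hsymm : ∀ᵐ x ∂μ, ∀ᵐ y ∂μ, G x y = G y x) :
    (h.op : Lp ℝ 2 μ →ₗ[ℝ] Lp ℝ 2 μ).IsSymmetric := by
  intro u v
  have hu := (Lp.stronglyMeasurable u).measurable
  have hv := (Lp.stronglyMeasurable v).measurable
  have hmeas : Measurable (Function.uncurry fun x y => G x y * u y * v x) :=
    (h.measurable.mul (hu.comp measurable_snd)).mul (hv.comp measurable_fst)
  have hint : Integrable (Function.uncurry fun x y => G x y * u y * v x) (μ.prod μ) := by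
    refine ⟨hmeas.aestronglyMeasurable, ?_⟩
    rw [hasFiniteIntegral_iff_enorm, lintegral_prod _ hmeas.enorm.aemeasurable]
    have hT : Measurable fun x => ∫⁻ y, ‖G x y‖ₑ * ‖u y‖ₑ ∂μ :=
      (h.measurable.enorm.mul (hu.comp measurable_snd).enorm).lintegral_prod_right'
    calc ∫⁻ x, ∫⁻ y, ‖G x y * u y * v x‖ₑ ∂μ ∂μ
        = ∫⁻ x, (∫⁻ y, ‖G x y‖ₑ * ‖u y‖ₑ ∂μ) * ‖v x‖ₑ ∂μ := by
          refine lintegral_congr fun x => ?_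
          have hm : Measurable fun y => ‖G x y‖ₑ * ‖u y‖ₑ :=
            h.measurable.of_uncurry_left.enorm.mul hu.enorm
          rw [← lintegral_mul_const _ hm]
          simp only [enorm_mul]
      _ ≤ (∫⁻ x, (∫⁻ y, ‖G x y‖ₑ * ‖u y‖ₑ ∂μ) ^ (2 : ℝ) ∂μ) ^ (1 / (2 : ℝ)) *
          (∫⁻ x, ‖v x‖ₑ ^ (2 : ℝ) ∂μ) ^ (1 / (2 : ℝ)) :=
          ENNReal.lintegral_mul_le_Lp_mul_Lq μ (Real.HolderConjugate.two_two)
            hT.aemeasurable hv.enorm.aemeasurable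
      _ < ⊤ := by
          refine ENNReal.mul_lt_top ?_ ?_
          · refine ENNReal.rpow_lt_top_of_nonneg (by norm_num) (ne_top_of_le_ne_top ?_
              (lintegral_sq_lintegral_mul_le h.measurable h.left h.right u))
            exact ENNReal.mul_ne_top (ENNReal.pow_ne_top h.ne_top) ENNReal.ofReal_ne_top
          · refine ENNReal.rpow_lt_top_of_nonneg (by norm_num) ?_
            rw [lintegral_enorm_sq_eq]
            exact ENNReal.ofReal_ne_top
  rw [L2.inner_def, L2.inner_def]
  calc ∫ x, inner ℝ (h.op u x) (v x) ∂μ = ∫ x, ∫ y, G x y * u y * v x ∂μ ∂μ := by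
        refine integral_congr_ae ?_
        filter_upwards [h.coeFn_op u] with x hx
        rw [hx, integral_mul_const]
        simp [mul_comm]
    _ = ∫ y, ∫ x, G x y * u y * v x ∂μ ∂μ := integral_integral_swap hint
    _ = ∫ y, inner ℝ (u y) (h.op v y) ∂μ := by
        refine integral_congr_ae ?_
        filter_upwards [h.coeFn_op v, hsymm] with y hy hs
        rw [hy]
        simp only [RCLike.inner_apply, conj_trivial]
        rw [mul_comm, ← integral_const_mul]
        refine integral_congr_ae ?_
        filter_upwards [hs] with x hx
        rw [hx]; ring

theorem IsSchurKernel.enorm_pow_op_le (h : IsSchurKernel μ G A) (v : Lp ℝ 2 μ) (n : ℕ) :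
    ∀ᵐ x ∂μ, ‖(h.op ^ n) v x‖ₑ ≤ kernelIter μ (fun x y => ‖G x y‖ₑ) (fun y => ‖v y‖ₑ) n x := by
  induction n with
  | zero => exact Eventually.of_forall fun x => le_rfl
  | succ n ih =>
    have e : (h.op ^ (n + 1)) v = h.op ((h.op ^ n) v) := by rw [pow_succ']; rfl
    rw [e]
    filter_upwards [h.coeFn_op ((h.op ^ n) v)] with x hx
    rw [hx]
    refine (enorm_integral_le_lintegral_enorm _).trans ?_
    refine lintegral_mono_ae ?_
    filter_upwards [ih] with y hy
    rw [enorm_mul]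
    gcongr

/-- An integral operator with a kernel in `L^r` for some `r > 1` has a power that maps `L²` to
`L^∞`. -/
theorem IsSchurKernel.exists_pow_op_bounded (h : IsSchurKernel μ G A) {N : ℕ} (hN : 1 ≤ N)
    {r : ℝ} (hr : r = 2 * N / (2 * N - 1)) {A' : ℝ≥0∞} (hA' : A' ≠ ⊤)
    (hA₁ : ∀ᵐ x ∂μ, ∫⁻ y, ‖G x y‖ₑ ^ r ∂μ ≤ A') (hA₂ : ∀ᵐ y ∂μ, ∫⁻ x, ‖G x y‖ₑ ^ r ∂μ ≤ A') :
    ∃ C : ℝ, 0 ≤ C ∧ ∀ v : Lp ℝ 2 μ, ∀ᵐ x ∂μ, |(h.op ^ N) v x| ≤ C * ‖v‖ := by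
  obtain ⟨B, hB, hBv⟩ := exists_kernelIter_le (μ := μ) (K := fun x y => ‖G x y‖ₑ)
    h.measurable.enorm hN hr hA' hA₁ hA₂
  have unit : ∀ v : Lp ℝ 2 μ, ‖v‖ = 1 → ∀ᵐ x ∂μ, |(h.op ^ N) v x| ≤ B.toReal := by
    intro v hv
    have h1 := hBv (fun y => ‖v y‖ₑ) (Lp.stronglyMeasurable v).measurable.enorm
      (by rw [lintegral_enorm_sq_eq, hv]; simp)
    filter_upwards [h1, h.enorm_pow_op_le v N] with x hx1 hx2
    have := ENNReal.toReal_mono hB (hx2.trans hx1)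
    rwa [toReal_enorm, Real.norm_eq_abs] at this
  refine ⟨B.toReal, ENNReal.toReal_nonneg, fun v => ?_⟩
  by_cases hv : v = 0
  · subst hv
    rw [map_zero, norm_zero, mul_zero]
    filter_upwards [Lp.coeFn_zero ℝ 2 μ] with x hx
    rw [hx]; simp
  · have hv' : ‖v‖ ≠ 0 := norm_ne_zero_iff.2 hv
    have e : v = ‖v‖ • (‖v‖⁻¹ • v) := by rw [smul_smul, mul_inv_cancel₀ hv', one_smul]
    have h1 := unit (‖v‖⁻¹ • v) (by rw [norm_smul, norm_inv, norm_norm, inv_mul_cancel₀ hv'])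
    have h2 : (h.op ^ N) v = ‖v‖ • (h.op ^ N) (‖v‖⁻¹ • v) := by rw [← map_smul, ← e]
    rw [h2]
    filter_upwards [h1, Lp.coeFn_smul ‖v‖ ((h.op ^ N) (‖v‖⁻¹ • v))] with x hx1 hx2
    rw [hx2, Pi.smul_apply, smul_eq_mul, abs_mul, abs_norm, mul_comm]
    gcongr

end KernelOperator

/-! ### The Green operator on `L²(Ω)`. -/

section Green

variable {d : ℕ} {Ω : Set (EuclideanSpace ℝ (Fin d))}
  {G : EuclideanSpace ℝ (Fin d) → EuclideanSpace ℝ (Fin d) → ℝ}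

/-- In polar coordinates this is the integrability of `t^(d-1-a)` near `0`. -/
theorem integrableOn_ball_norm_rpow (hd : 1 ≤ d) {a : ℝ} (ha : a < d) (R : ℝ) :
    IntegrableOn (fun z : EuclideanSpace ℝ (Fin d) => ‖z‖ ^ (-a)) (Metric.ball 0 R) := by
  have : Nonempty (Fin d) := ⟨⟨0, hd⟩⟩
  have : Nontrivial (EuclideanSpace ℝ (Fin d)) := inferInstance
  rw [integrableOn_fun_norm_addHaar (volume : Measure (EuclideanSpace ℝ (Fin d)))
    (f := fun t : ℝ => t ^ (-a))]
  rw [finrank_euclideanSpace, Fintype.card_fin]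
  have h1 : IntegrableOn (fun y : ℝ => y ^ ((d : ℝ) - 1 - a)) (Ioo 0 R) := by
    by_cases hR : 0 ≤ R
    · rw [← integrableOn_Ioc_iff_integrableOn_Ioo, ← intervalIntegrable_iff_integrableOn_Ioc_of_le hR]
      exact intervalIntegral.intervalIntegrable_rpow' (by linarith)
    · rw [Ioo_eq_empty (by linarith)]; exact integrableOn_empty
  refine h1.congr_fun (fun y hy => ?_) measurableSet_Ioo
  have hy0 : 0 < y := hy.1
  simp only [smul_eq_mul]
  rw [← Real.rpow_natCast, ← Real.rpow_add hy0, Nat.cast_sub hd]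
  congr 1; push_cast; ring

theorem bdist_nonneg (x : EuclideanSpace ℝ (Fin d)) : 0 ≤ bdist Ω x := Metric.infDist_nonneg

theorem greenProfile_nonneg (s γ : ℝ) (x y : EuclideanSpace ℝ (Fin d)) :
    0 ≤ greenProfile Ω s γ x y := by
  have := bdist_nonneg (Ω := Ω) x
  have := bdist_nonneg (Ω := Ω) y
  unfold greenProfile
  positivity

theorem greenProfile_le {s γ : ℝ} (hγ : 0 ≤ γ) (x y : EuclideanSpace ℝ (Fin d)) :
    greenProfile Ω s γ x y ≤ ‖x - y‖ ^ (-((d : ℝ) - 2 * s)) := by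
  have h : ∀ z : EuclideanSpace ℝ (Fin d), 0 ≤ min 1 (bdist Ω z / ‖x - y‖) := fun z =>
    le_min zero_le_one (div_nonneg (bdist_nonneg z) (norm_nonneg _))
  have h1 : ∀ z : EuclideanSpace ℝ (Fin d), (min 1 (bdist Ω z / ‖x - y‖)) ^ γ ≤ 1 := fun z =>
    Real.rpow_le_one (h z) (min_le_left _ _) hγ
  unfold greenProfile
  rw [Real.rpow_neg (norm_nonneg _), ← one_div, mul_assoc]
  refine mul_le_of_le_one_right (by positivity) (mul_le_one₀ (h1 x) (Real.rpow_nonneg (h y) _) (h1 y))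

theorem ae_ne_of_pos_dim (hd : 1 ≤ d) (x : EuclideanSpace ℝ (Fin d)) :
    ∀ᵐ y : EuclideanSpace ℝ (Fin d) ∂(volume.restrict Ω), y ≠ x := by
  have : Nonempty (Fin d) := ⟨⟨0, hd⟩⟩
  exact ae_restrict_of_ae (Measure.ae_ne volume x)

/-- The boundary factors are at most `1`, so `|G x y|` is dominated by a multiple of
`|x-y|^(-(d-2s))`. Enlarging `Ω` to the ball of radius `2R` about `x` and translating makes the
bound uniform in `x`. -/
theorem exists_lintegral_rpow_le (hd : 1 ≤ d) (hΩ : IsBoundedSmoothDomain Ω) {s γ : ℝ}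
    (hγ : 0 ≤ γ) (hG1 : HypG1 Ω G s γ) {r : ℝ} (hr : 0 < r) (hsr : ((d : ℝ) - 2 * s) * r < d) :
    ∃ A : ℝ≥0∞, A ≠ ⊤ ∧ ∀ x ∈ Ω, ∫⁻ y in Ω, ‖G x y‖ₑ ^ r ≤ A := by
  obtain ⟨c, C, hc, hC, hest⟩ := hG1.estimate
  obtain ⟨R, hR⟩ := hΩ.bounded.subset_ball_lt 0 0
  have hint := integrableOn_ball_norm_rpow hd hsr (2 * R)
  set I := ∫⁻ z in Metric.ball (0 : EuclideanSpace ℝ (Fin d)) (2 * R),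
    ‖‖z‖ ^ (-(((d : ℝ) - 2 * s) * r))‖ₑ with hI
  have hItop : I ≠ ⊤ := by
    have := hint.2
    rw [hasFiniteIntegral_iff_enorm] at this
    exact this.ne
  refine ⟨ENNReal.ofReal C ^ r * I, ENNReal.mul_ne_top
    (ENNReal.rpow_ne_top_of_nonneg hr.le ENNReal.ofReal_ne_top) hItop, fun x hx => ?_⟩
  have hbound : ∀ᵐ y ∂(volume.restrict Ω), ‖G x y‖ₑ ^ r ≤
      ENNReal.ofReal C ^ r * ‖‖y - x‖ ^ (-(((d : ℝ) - 2 * s) * r))‖ₑ := by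
    filter_upwards [ae_ne_of_pos_dim hd x, ae_restrict_mem hΩ.isOpen.measurableSet] with y hyx hy
    obtain ⟨h1, h2⟩ := hest x hx y hy (Ne.symm hyx)
    have h0 : 0 ≤ G x y := (mul_nonneg hc.le (greenProfile_nonneg s γ x y)).trans h1
    have h3 : G x y ≤ C * ‖x - y‖ ^ (-((d : ℝ) - 2 * s)) :=
      h2.trans (mul_le_mul_of_nonneg_left (greenProfile_le hγ x y) hC.le)
    have hpos : 0 ≤ ‖x - y‖ := norm_nonneg _
    rw [Real.enorm_eq_ofReal h0, Real.enorm_eq_ofReal (by positivity), norm_sub_rev y x,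
      ← neg_mul, Real.rpow_mul hpos, ENNReal.ofReal_rpow_of_nonneg h0 hr.le,
      ENNReal.ofReal_rpow_of_nonneg hC.le hr.le, ← ENNReal.ofReal_mul (by positivity),
      ← Real.mul_rpow hC.le (by positivity)]
    exact ENNReal.ofReal_le_ofReal (Real.rpow_le_rpow h0 h3 hr.le)
  calc ∫⁻ y in Ω, ‖G x y‖ₑ ^ r
      ≤ ∫⁻ y in Ω, ENNReal.ofReal C ^ r * ‖‖y - x‖ ^ (-(((d : ℝ) - 2 * s) * r))‖ₑ :=
        lintegral_mono_ae hbound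
    _ ≤ ∫⁻ y in Metric.ball x (2 * R),
          ENNReal.ofReal C ^ r * ‖‖y - x‖ ^ (-(((d : ℝ) - 2 * s) * r))‖ₑ := by
        refine lintegral_mono_set fun y hy => ?_
        have h1 := mem_ball_zero_iff.1 (hR.2 hx)
        have h2 := mem_ball_zero_iff.1 (hR.2 hy)
        rw [mem_ball_iff_norm]
        linarith [norm_sub_le y x]
    _ = ENNReal.ofReal C ^ r * I := by
        rw [lintegral_const_mul _ (by fun_prop), hI]
        congr 1
        rw [← lintegral_indicator measurableSet_ball, ← lintegral_indicator measurableSet_ball]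
        symm
        rw [← lintegral_sub_right_eq_self _ x]
        refine lintegral_congr fun y => ?_
        simp only [indicator, Metric.mem_ball, dist_eq_norm, sub_zero]

theorem isFiniteMeasure_restrict (hΩ : IsBoundedSmoothDomain Ω) :
    IsFiniteMeasure ((volume : Measure (EuclideanSpace ℝ (Fin d))).restrict Ω) :=
  ⟨by rw [Measure.restrict_apply_univ]; exact hΩ.bounded.measure_lt_top⟩

/-- The Green operator as a bounded symmetric operator on `L²(Ω)`, with a power that maps `L²(Ω)`
to `L^∞(Ω)`. -/
theorem exists_greenOperator (hd : 1 ≤ d) (hΩ : IsBoundedSmoothDomain Ω) {s γ : ℝ}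
    (hs : 0 < s) (hγ : 0 ≤ γ) (hGmeas : Measurable (Function.uncurry G)) (hG1 : HypG1 Ω G s γ) :
    ∃ T : L2 Ω →L[ℝ] L2 Ω, (∀ v g : L2 Ω, IsOpValue Ω G v g ↔ v = T g) ∧
      (T : L2 Ω →ₗ[ℝ] L2 Ω).IsSymmetric ∧
      ∃ N : ℕ, 1 ≤ N ∧ ∃ C : ℝ, 0 ≤ C ∧
        ∀ v : L2 Ω, ∀ᵐ x ∂(volume.restrict Ω), |(T ^ N) v x| ≤ C * ‖v‖ := by
  have := isFiniteMeasure_restrict hΩ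
  have hmem : ∀ᵐ x ∂(volume.restrict Ω), x ∈ Ω := ae_restrict_mem hΩ.isOpen.measurableSet
  have hd' : (1 : ℝ) ≤ d := by exact_mod_cast hd
  -- With `r` conjugate to `2N`, the integrability condition `(d - 2s) r < d` amounts to `d < 4 s
  -- N`; `N > d/s` is more than enough.
  obtain ⟨N, hN⟩ := exists_nat_gt (max 1 (d / s))
  have hN1 : (1 : ℝ) < N := (le_max_left _ _).trans_lt hN
  have hN2 : d / s < N := (le_max_right _ _).trans_lt hN
  rw [div_lt_iff₀ hs] at hN2
  set r : ℝ := 2 * N / (2 * N - 1) with hr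
  have hr0 : 0 < r := by rw [hr]; apply div_pos <;> linarith
  have hsr : ((d : ℝ) - 2 * s) * r < d := by
    rw [hr, ← mul_div_assoc, div_lt_iff₀ (by linarith)]
    nlinarith
  obtain ⟨A, hA, hA1⟩ := exists_lintegral_rpow_le hd hΩ hγ hG1 hr0 hsr
  obtain ⟨B, hB, hB1⟩ := exists_lintegral_rpow_le hd hΩ hγ hG1 one_pos
    (by linarith : ((d : ℝ) - 2 * s) * 1 < d)
  simp only [ENNReal.rpow_one] at hB1
  have swap : ∀ {p : ℝ} {D : ℝ≥0∞}, (∀ x ∈ Ω, ∫⁻ y in Ω, ‖G x y‖ₑ ^ p ≤ D) →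
      ∀ᵐ y ∂(volume.restrict Ω), ∫⁻ x in Ω, ‖G x y‖ₑ ^ p ≤ D := by
    intro p D h
    filter_upwards [hmem] with y hy
    refine le_trans (le_of_eq (lintegral_congr_ae ?_)) (h y hy)
    filter_upwards [hmem] with x hx
    rw [hG1.symm x hx y hy]
  have hK : IsSchurKernel (volume.restrict Ω) G B :=
    { measurable := hGmeas
      ne_top := hB
      left := by filter_upwards [hmem] with x hx using hB1 x hx
      right := by simpa using swap (p := 1) (D := B) (by simpa using hB1) }
  refine ⟨hK.op, fun v g => ?_, hK.isSymmetric_op ?_, N, by exact_mod_cast hN1.le, ?_⟩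
  · rw [Lp.ext_iff]
    exact ⟨fun h => h.trans (hK.coeFn_op g).symm, fun h => h.trans (hK.coeFn_op g)⟩
  · filter_upwards [hmem] with x hx
    filter_upwards [hmem] with y hy using hG1.symm x hx y hy
  · exact hK.exists_pow_op_bounded (by exact_mod_cast hN1.le) hr hA
      (by filter_upwards [hmem] with x hx using hA1 x hx) (swap hA1)

end Green

/-! ### Operators from `L²` to `L^∞` are Hilbert–Schmidt. -/

section HilbertSchmidt

variable {X : Type*} [MeasurableSpace X] {μ : Measure X}

theorem coeFn_finset_sum {ι : Type*} (s : Finset ι) (f : ι → Lp ℝ 2 μ) :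
    ∀ᵐ x ∂μ, (∑ i ∈ s, f i : Lp ℝ 2 μ) x = ∑ i ∈ s, f i x := by
  classical
  induction s using Finset.induction with
  | empty =>
    simp only [Finset.sum_empty]
    filter_upwards [Lp.coeFn_zero ℝ 2 μ] with x hx
    rw [hx]; rfl
  | insert i s hi ih =>
    rw [Finset.sum_insert hi]
    filter_upwards [ih, Lp.coeFn_add (f i) (∑ i ∈ s, f i)] with x hx hx'
    rw [hx', Pi.add_apply, hx, Finset.sum_insert hi]

/-- An operator on `L²` with values in `L^∞` satisfies a pointwise Bessel inequality. -/
theorem ae_sum_sq_le_of_bounded {B : Lp ℝ 2 μ →L[ℝ] Lp ℝ 2 μ} {C : ℝ}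
    (hB : ∀ v : Lp ℝ 2 μ, ∀ᵐ x ∂μ, |B v x| ≤ C * ‖v‖) {ι : Type*} {e : ι → Lp ℝ 2 μ}
    (he : Orthonormal ℝ e) (F : Finset ι) :
    ∀ᵐ x ∂μ, ∑ i ∈ F, (B (e i) x) ^ 2 ≤ C ^ 2 := by
  classical
  -- For each coefficient vector the bound holds off a null set that depends on the vector. A
  -- countable dense family leaves a single null set, and continuity recovers all vectors at once.
  let D := TopologicalSpace.denseSeq (EuclideanSpace ℝ F)
  have hnorm : ∀ a : EuclideanSpace ℝ F, ‖∑ i : F, a i • e i‖ = ‖a‖ := by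
    intro a
    have h := (he.comp (Subtype.val : F → ι) Subtype.val_injective).inner_sum a a Finset.univ
    rw [EuclideanSpace.norm_eq, ← Real.sqrt_sq (norm_nonneg (∑ i : F, a i • e i))]
    congr 1
    rw [← real_inner_self_eq_norm_sq]
    refine h.trans ?_
    refine Finset.sum_congr rfl fun i _ => ?_
    simp [sq]
  have h1 : ∀ a : EuclideanSpace ℝ F, ∀ᵐ x ∂μ, |∑ i : F, a i * B (e i) x| ≤ C * ‖a‖ := by
    intro a
    have h2 : ∀ᵐ x ∂μ, ∀ i : F, (a i • B (e i) : Lp ℝ 2 μ) x = a i * B (e i) x := by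
      rw [ae_all_iff]
      intro i
      filter_upwards [Lp.coeFn_smul (a i) (B (e i))] with x hx
      rw [hx]; rfl
    filter_upwards [hB (∑ i : F, a i • e i), h2,
      coeFn_finset_sum Finset.univ fun i : F => a i • B (e i)] with x hx hx2 hx3
    rw [hnorm, map_sum] at hx
    simp only [map_smul] at hx
    rwa [hx3, Finset.sum_congr rfl fun i _ => hx2 i] at hx
  have h2 : ∀ᵐ x ∂μ, ∀ n, |∑ i : F, D n i * B (e i) x| ≤ C * ‖D n‖ :=
    ae_all_iff.2 fun n => h1 (D n)
  filter_upwards [h2] with x hx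
  have h3 : ∀ a : EuclideanSpace ℝ F, |∑ i : F, a i * B (e i) x| ≤ C * ‖a‖ := by
    intro a
    have hcl : IsClosed {a : EuclideanSpace ℝ F | |∑ i : F, a i * B (e i) x| ≤ C * ‖a‖} :=
      isClosed_le (by fun_prop) (by fun_prop)
    have := hcl.closure_subset_iff.2 (range_subset_iff.2 hx)
    exact this (TopologicalSpace.denseRange_denseSeq (EuclideanSpace ℝ F) a)
  -- Duality: the vector of values at `x`, used as coefficients, gives `S ≤ C √S`.
  have h4 := h3 (WithLp.toLp 2 fun i : F => B (e i) x)
  rw [← Finset.sum_coe_sort]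
  set S := ∑ i : F, (B (e i) x) ^ 2 with hS
  have hS0 : 0 ≤ S := Finset.sum_nonneg fun i _ => sq_nonneg _
  have h5 : ‖(WithLp.toLp 2 fun i : F => B (e i) x : EuclideanSpace ℝ F)‖ = √S := by
    rw [EuclideanSpace.norm_eq]; simp [hS]
  have h6 : ∑ i : F, (WithLp.toLp 2 fun i : F => B (e i) x : EuclideanSpace ℝ F) i * B (e i) x
      = S := by simp [hS, sq]
  rw [h5, h6, abs_of_nonneg hS0] at h4
  by_cases h0 : S = 0
  · rw [h0]; positivity
  · have hs : 0 < √S := Real.sqrt_pos.2 (lt_of_le_of_ne hS0 (Ne.symm h0))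
    have h7 : √S ≤ C := by
      nlinarith [Real.mul_self_sqrt hS0]
    calc S = √S ^ 2 := (Real.sq_sqrt hS0).symm
      _ ≤ C ^ 2 := by gcongr

theorem sum_norm_sq_le_of_bounded [IsFiniteMeasure μ] {B : Lp ℝ 2 μ →L[ℝ] Lp ℝ 2 μ} {C : ℝ}
    (hB : ∀ v : Lp ℝ 2 μ, ∀ᵐ x ∂μ, |B v x| ≤ C * ‖v‖) {ι : Type*}
    {e : ι → Lp ℝ 2 μ} (he : Orthonormal ℝ e) (F : Finset ι) :
    ∑ i ∈ F, ‖B (e i)‖ ^ 2 ≤ C ^ 2 * μ.real univ := by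
  have hint : ∀ v : Lp ℝ 2 μ, Integrable (fun x => v x ^ 2) μ := fun v => by
    simpa using (Lp.memLp v).integrable_sq
  have h : ∀ v : Lp ℝ 2 μ, ‖v‖ ^ 2 = ∫ x, v x ^ 2 ∂μ := by
    intro v
    rw [← real_inner_self_eq_norm_sq, L2.inner_def]
    simp [sq]
  simp only [h]
  rw [← integral_finsetSum _ fun i _ => hint _]
  calc ∫ x, ∑ i ∈ F, B (e i) x ^ 2 ∂μ ≤ ∫ _, C ^ 2 ∂μ :=
        integral_mono_ae (integrable_finsetSum _ fun i _ => hint _) (integrable_const _)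
          (ae_sum_sq_le_of_bounded hB he F)
    _ = _ := by rw [integral_const, smul_eq_mul, mul_comm]

end HilbertSchmidt

/-! ### Compactness, and the spectral theorem with a basis indexed by `ℕ`. -/

section Compact

variable {H : Type*} [NormedAddCommGroup H] [InnerProductSpace ℝ H] [CompleteSpace H]

/-- Hilbert–Schmidt operators are compact. -/
theorem isCompactOperator_of_summable_sq {B : H →L[ℝ] H} {ι : Type*} (e : HilbertBasis ι ℝ H)
    (h : Summable fun i => ‖B (e i)‖ ^ 2) : IsCompactOperator B := by
  classical
  let P : Finset ι → H →L[ℝ] H := fun F => ∑ i ∈ F, (innerSL ℝ (e i)).smulRight (B (e i))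
  have hP : ∀ F x, P F x = ∑ i ∈ F, e.repr x i • B (e i) := by
    intro F x
    simp [P, e.repr_apply_apply]
  have hcomp : ∀ F, IsCompactOperator (P F) := by
    intro F
    refine Submodule.sum_mem (compactOperator (RingHom.id ℝ) H H) fun i _ => ?_
    change IsCompactOperator _
    have := (isCompactOperator_of_locallyCompactSpace_dom (innerSL ℝ (e i))).clm_comp
      (ContinuousLinearMap.toSpanSingleton ℝ (B (e i)))
    exact this
  refine isCompactOperator_of_tendsto (l := atTop) (F := P) ?_ (Eventually.of_forall hcomp)
  rw [Metric.tendsto_atTop]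
  intro ε hε
  -- Beyond `F` the square sums stay below `(ε/2)²`, so by Cauchy–Schwarz and Bessel the finite-rank
  -- truncations are within `ε/2` of `B` in operator norm.
  obtain ⟨F, hF⟩ := summable_iff_vanishing_norm.1 h ((ε / 2) ^ 2) (by positivity)
  refine ⟨F, fun F₁ hF₁ => ?_⟩
  rw [dist_eq_norm, norm_sub_rev]
  refine lt_of_le_of_lt (ContinuousLinearMap.opNorm_le_bound _ (by positivity) fun x => ?_)
    (half_lt_self hε)
  have hsum : HasSum (fun i => e.repr x i • B (e i)) (B x) := by
    simpa using (e.hasSum_repr x).mapL B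
  have hlim : Tendsto (fun F₂ => ‖∑ i ∈ F₂, e.repr x i • B (e i) - P F₁ x‖) atTop
      (𝓝 ‖B x - P F₁ x‖) := (Tendsto.sub_const hsum _).norm
  refine le_of_tendsto hlim ?_
  filter_upwards [eventually_ge_atTop F₁] with F₂ hF₂
  rw [hP, ← Finset.sum_sdiff hF₂, add_sub_cancel_right]
  have hdis : Disjoint (F₂ \ F₁) F := Finset.disjoint_of_subset_right hF₁ Finset.sdiff_disjoint
  have h1 := hF _ hdis
  have h2 : ∑ i ∈ F₂ \ F₁, ‖e.repr x i‖ ^ 2 ≤ ‖x‖ ^ 2 := by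
    simpa [e.repr_apply_apply] using e.orthonormal.sum_inner_products_le (s := F₂ \ F₁) x
  rw [Real.norm_of_nonneg (Finset.sum_nonneg fun i _ => sq_nonneg _)] at h1
  calc ‖∑ i ∈ F₂ \ F₁, e.repr x i • B (e i)‖ ≤ ∑ i ∈ F₂ \ F₁, ‖e.repr x i‖ * ‖B (e i)‖ :=
        norm_sum_le_of_le _ fun i _ => (norm_smul _ _).le
    _ ≤ √(∑ i ∈ F₂ \ F₁, ‖e.repr x i‖ ^ 2) * √(∑ i ∈ F₂ \ F₁, ‖B (e i)‖ ^ 2) :=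
        Real.sum_mul_le_sqrt_mul_sqrt _ _ _
    _ ≤ ‖x‖ * (ε / 2) := by
        gcongr
        · exact (Real.sqrt_le_left (norm_nonneg _)).2 h2
        · exact (Real.sqrt_le_left (by positivity)).2 h1.le
    _ = ε / 2 * ‖x‖ := mul_comm _ _

theorem isCompactOperator_iff_totallyBounded (B : H →L[ℝ] H) :
    IsCompactOperator B ↔ TotallyBounded (B '' Metric.ball 0 1) := by
  rw [show (B : H → H) = (B : H →ₗ[ℝ] H) from rfl,
    isCompactOperator_iff_isCompact_closure_image_ball (B : H →ₗ[ℝ] H) one_pos]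
  exact ⟨fun h => h.totallyBounded.subset subset_closure, fun h =>
    TotallyBounded.isCompact_of_isClosed h.closure isClosed_closure⟩

/-- Since `‖B z‖² = ⟨z, B² z⟩` and differences of points of the unit ball have norm at most `2`, an
`ε²/2`-net for the image under `B²` yields an `ε`-net for the image under `B`. -/
theorem isCompactOperator_of_symmetric_comp {B : H →L[ℝ] H}
    (hB : (B : H →ₗ[ℝ] H).IsSymmetric) (h : IsCompactOperator (B * B)) : IsCompactOperator B := by
  rw [isCompactOperator_iff_totallyBounded] at h ⊢
  rw [Metric.totallyBounded_iff]
  intro ε hε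
  obtain ⟨t, ht, htf, hcov⟩ := totallyBounded_iff_subset.1 h {p | dist p.1 p.2 < ε ^ 2 / 2}
    (Metric.dist_mem_uniformity (by positivity))
  choose! g hg using fun y (hy : y ∈ t) => ht hy
  refine ⟨(fun y => B (g y)) '' t, htf.image _, ?_⟩
  rintro _ ⟨x, hx, rfl⟩
  obtain ⟨y, hy, hxy⟩ := mem_iUnion₂.1 (hcov (mem_image_of_mem _ hx))
  refine mem_iUnion₂.2 ⟨B (g y), mem_image_of_mem _ hy, ?_⟩
  have hgy := hg y hy
  rw [mem_ball_iff_norm, ← map_sub]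
  have h1 : ‖B (x - g y)‖ ^ 2 < ε ^ 2 := by
    rw [← real_inner_self_eq_norm_sq]
    have e1 : inner ℝ (B (x - g y)) (B (x - g y)) = inner ℝ (x - g y) ((B * B) (x - g y)) :=
      hB (x - g y) (B (x - g y))
    rw [e1]
    have h2 : ‖(B * B) (x - g y)‖ < ε ^ 2 / 2 := by
      rw [map_sub, hgy.2, ← dist_eq_norm]
      exact hxy
    have h3 : ‖x - g y‖ ≤ 2 := by
      have h4 := mem_ball_zero_iff.1 hx
      have h5 := mem_ball_zero_iff.1 hgy.1
      linarith [norm_sub_le x (g y)]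
    calc _ ≤ ‖x - g y‖ * ‖(B * B) (x - g y)‖ := real_inner_le_norm _ _
      _ ≤ 2 * ‖(B * B) (x - g y)‖ := by gcongr
      _ < ε ^ 2 := by linarith
  exact lt_of_pow_lt_pow_left₀ 2 hε.le h1

/-- Multiplying by a further power reaches the exponent `2^n ≥ n`; the exponent is then halved
repeatedly by the square-root step. -/
theorem isCompactOperator_of_symmetric_pow {T : H →L[ℝ] H} (hT : (T : H →ₗ[ℝ] H).IsSymmetric)
    {n : ℕ} (h : IsCompactOperator (T ^ n)) : IsCompactOperator T := by
  have hsymm : ∀ m : ℕ, ((T ^ m : H →L[ℝ] H) : H →ₗ[ℝ] H).IsSymmetric := by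
    intro m
    rw [ContinuousLinearMap.toLinearMap_pow]
    exact hT.pow m
  have hpow : ∀ k : ℕ, IsCompactOperator (T ^ (2 ^ k : ℕ) : H →L[ℝ] H) → IsCompactOperator T := by
    intro k
    induction k with
    | zero => intro h; simpa using h
    | succ k ih =>
      intro h
      refine ih (isCompactOperator_of_symmetric_comp (hsymm _) ?_)
      rwa [← pow_add, ← two_mul, ← pow_succ']
  refine hpow n ?_
  have e : T ^ 2 ^ n = T ^ (2 ^ n - n) * T ^ n := by
    rw [← pow_add]; congr 1; have := n.lt_two_pow_self; omega
  rw [e]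
  exact h.clm_comp (T ^ (2 ^ n - n))

/-- A compact symmetric operator on an infinite-dimensional separable Hilbert space has an
orthonormal basis of eigenvectors indexed by `ℕ`. -/
theorem exists_hilbertBasis_eigenvectors [TopologicalSpace.SeparableSpace H]
    (hinf : ¬ FiniteDimensional ℝ H) {T : H →L[ℝ] H} (hT : (T : H →ₗ[ℝ] H).IsSymmetric)
    (hc : IsCompactOperator T) :
    ∃ (φ : HilbertBasis ℕ ℝ H) (ev : ℕ → ℝ), ∀ j, T (φ j) = ev j • φ j := by
  classical
  let V := fun m : ℝ => Module.End.eigenspace (T : H →ₗ[ℝ] H) m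
  have hcomp : ∀ m, CompleteSpace (V m) := by
    intro m
    have hcl : IsClosed (V m : Set H) := by
      have e : (V m : Set H) = {x | T x = m • x} := by
        ext x
        exact Module.End.mem_eigenspace_iff
      rw [e]
      exact isClosed_eq (by fun_prop) (by fun_prop)
    exact hcl.completeSpace_coe
  choose w b hb using fun m => exists_hilbertBasis ℝ (V m)
  let v : (Σ m, w m) → H := fun a => (b a.1 a.2 : V a.1)
  have hv : Orthonormal ℝ v :=
    hT.orthogonalFamily_eigenspaces.orthonormal_sigma_orthonormal fun m => (b m).orthonormal
  have hspan : (Submodule.span ℝ (range v))ᗮ = ⊥ := by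
    rw [Submodule.eq_bot_iff]
    intro x hx
    rw [Submodule.mem_orthogonal] at hx
    -- The spectral theorem concerns whole eigenspaces, so orthogonality to the chosen bases is
    -- first extended to every eigenvector.
    have hx' : x ∈ (⨆ m, V m)ᗮ := by
      rw [Submodule.mem_orthogonal]
      intro u hu
      refine Submodule.iSup_induction V (motive := fun u => inner ℝ u x = 0) hu ?_ ?_ ?_
      · intro m u hu
        have hs : HasSum (fun i => (b m).repr ⟨u, hu⟩ i • ((b m i : V m) : H)) u := by
          simpa using ((b m).hasSum_repr ⟨u, hu⟩).mapL (V m).subtypeL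
        have h1 := hs.mapL ((innerSL ℝ).flip x)
        have h2 : ∀ i, inner ℝ ((b m i : V m) : H) x = 0 := fun i =>
          hx _ (Submodule.subset_span ⟨⟨m, i⟩, rfl⟩)
        have h3 : ∀ i, (innerSL ℝ).flip x ((b m).repr ⟨u, hu⟩ i • ((b m i : V m) : H)) = 0 := by
          intro i
          rw [map_smul]
          change _ • inner ℝ ((b m i : V m) : H) x = 0
          rw [h2, smul_zero]
        simp only [h3] at h1
        exact h1.unique hasSum_zero
      · simp
      · intro y z hy hz
        rw [inner_add_left, hy, hz, add_zero]
    rwa [ContinuousLinearMap.orthogonalComplement_iSup_eigenspaces_eq_bot hc hT,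
      Submodule.mem_bot] at hx'
  -- Distinct orthonormal vectors lie `√2` apart, so the balls of radius `1/2` around them are
  -- disjoint; a separable space contains only countably many.
  have hcount : Countable (Σ m, w m) := by
    refine Pairwise.countable_of_isOpen_disjoint (s := fun a => Metric.ball (v a) (1 / 2)) ?_
      (fun _ => Metric.isOpen_ball) (fun a => ⟨v a, Metric.mem_ball_self (by norm_num)⟩)
    intro a a' haa
    refine Metric.ball_disjoint_ball ?_
    have h1 : ‖v a - v a'‖ ^ 2 = 2 := by
      rw [norm_sub_sq_real, hv.1 a, hv.1 a', hv.2 haa]; norm_num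
    rw [dist_eq_norm]
    nlinarith [norm_nonneg (v a - v a')]
  have hinfι : Infinite (Σ m, w m) := by
    by_contra hfin
    rw [not_infinite_iff_finite] at hfin
    refine hinf ?_
    have hfd : FiniteDimensional ℝ (Submodule.span ℝ (range v)) :=
      FiniteDimensional.span_of_finite ℝ (finite_range v)
    have htop : Submodule.span ℝ (range v) = ⊤ := by
      rwa [Submodule.orthogonal_eq_bot_iff] at hspan
    rw [htop] at hfd
    exact Module.Finite.equiv Submodule.topEquiv
  obtain ⟨hden⟩ := nonempty_denumerable (Σ m, w m)
  let ε : ℕ ≃ (Σ m, w m) := (Denumerable.eqv _).symm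
  have hv' : Orthonormal ℝ (v ∘ ε) := hv.comp ε ε.injective
  have hspan' : (Submodule.span ℝ (range (v ∘ ε)))ᗮ = ⊥ := by
    rw [EquivLike.range_comp]; exact hspan
  refine ⟨HilbertBasis.mkOfOrthogonalEqBot hv' hspan', fun j => (ε j).1, fun j => ?_⟩
  rw [HilbertBasis.coe_mkOfOrthogonalEqBot]
  exact Module.End.mem_eigenspace_iff.1 (b (ε j).1 (ε j).2).2

end Compact

/-! ### Existence of the eigenbasis. -/

section Eigenbasis

variable {d : ℕ} {Ω : Set (EuclideanSpace ℝ (Fin d))}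
  {G : EuclideanSpace ℝ (Fin d) → EuclideanSpace ℝ (Fin d) → ℝ}

/-- Indicators of disjoint open annuli inside a ball contained in `Ω` are nonzero and pairwise
orthogonal. Infinite dimension is what allows the basis to be indexed by `ℕ`. -/
theorem not_finiteDimensional_L2 (hd : 1 ≤ d) (hΩ : IsBoundedSmoothDomain Ω) :
    ¬ FiniteDimensional ℝ (L2 Ω) := by
  have := isFiniteMeasure_restrict hΩ
  have : Nonempty (Fin d) := ⟨⟨0, hd⟩⟩
  intro hfin
  obtain ⟨x₀, hx₀⟩ := hΩ.connected.nonempty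
  obtain ⟨R, hR, hball⟩ := Metric.isOpen_iff.1 hΩ.isOpen x₀ hx₀
  let A : ℕ → Set (EuclideanSpace ℝ (Fin d)) := fun n =>
    {y | R / (n + 2) < dist y x₀ ∧ dist y x₀ < R / (n + 1)}
  have hdist : Continuous fun y : EuclideanSpace ℝ (Fin d) => dist y x₀ := by fun_prop
  have hAo : ∀ n, IsOpen (A n) := fun n =>
    (isOpen_lt continuous_const hdist).inter (isOpen_lt hdist continuous_const)
  have hAm : ∀ n, MeasurableSet (A n) := fun n => (hAo n).measurableSet
  have hlt : ∀ n : ℕ, R / (n + 2) < R / (n + 1) := fun n =>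
    div_lt_div_of_pos_left hR (by positivity) (by linarith)
  have hAΩ : ∀ n, A n ⊆ Ω := by
    intro n y hy
    refine hball (hy.2.trans_le (div_le_self hR.le ?_))
    have : (0 : ℝ) ≤ n := n.cast_nonneg
    linarith
  have hApos : ∀ n, (volume.restrict Ω) (A n) ≠ 0 := by
    intro n
    rw [Measure.restrict_apply (hAm n), inter_eq_left.2 (hAΩ n)]
    refine ((hAo n).measure_pos volume ?_).ne'
    obtain ⟨c, hc1, hc2⟩ := exists_between (hlt n)
    have hc0 : 0 ≤ c := le_trans (by positivity) hc1.le
    obtain ⟨z, hz⟩ := _root_.exists_norm_eq (EuclideanSpace ℝ (Fin d)) hc0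
    exact ⟨x₀ + z, by simp [A, hz, hc1, hc2]⟩
  have hdisj : ∀ m n, m < n → Disjoint (A m) (A n) := by
    intro m n hmn
    rw [Set.disjoint_left]
    intro y hy hy'
    have h1 : (m : ℝ) + 1 ≤ n := by exact_mod_cast hmn
    have h2 : R / (n + 1) ≤ R / (m + 2) :=
      div_le_div_of_nonneg_left hR.le (by positivity) (by linarith)
    exact absurd (hy.1.trans (hy'.2.trans_le h2)) (lt_irrefl _)
  let e : ℕ → L2 Ω := fun n => indicatorConstLp 2 (hAm n) (measure_ne_top _ _) (1 : ℝ)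
  have hinner : ∀ m n, inner ℝ (e m) (e n) = (volume.restrict Ω).real (A n ∩ A m) := by
    intro m n
    rw [L2.inner_indicatorConstLp_one]
    have h1 : ∫ x in A m, e n x ∂(volume.restrict Ω)
        = ∫ x in A m, (A n).indicator (fun _ => (1 : ℝ)) x ∂(volume.restrict Ω) := by
      refine integral_congr_ae (ae_restrict_of_ae ?_)
      exact indicatorConstLp_coeFn
    rw [h1, integral_indicator_const _ (hAm n)]
    simp [measureReal_restrict_apply (hAm n)]
  have hne : ∀ n, e n ≠ 0 := by
    intro n h0
    have h1 := hinner n n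
    rw [h0, inner_zero_left, inter_self, eq_comm, measureReal_eq_zero_iff] at h1
    exact hApos n h1
  have hli : LinearIndependent ℝ e := by
    refine linearIndependent_of_ne_zero_of_inner_eq_zero hne ?_
    intro m n hmn
    change inner ℝ (e m) (e n) = 0
    rw [hinner]
    have : A n ∩ A m = ∅ := by
      rcases lt_or_gt_of_ne hmn with h | h
      · exact (hdisj m n h).symm.inter_eq
      · exact (hdisj n m h).inter_eq
    rw [this, measureReal_empty]
  have := hli.finite
  exact _root_.not_finite ℕ

/-- A right derivative at `0` is unique. This is the source of the injectivity of the Green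
operator. -/
theorem IsHeatSemigroup.isOpValue_unique {S : ℝ → L2 Ω →L[ℝ] L2 Ω} (hS : IsHeatSemigroup Ω G S)
    {v w w' : L2 Ω} (h : IsOpValue Ω G v w) (h' : IsOpValue Ω G v w') : w = w' := by
  have h1 := (hS.generator v w).2 h
  have h2 := (hS.generator v w').2 h'
  exact neg_injective ((uniqueDiffWithinAt_Ici (0 : ℝ)).eq_deriv _ h1 h2)

theorem exists_isEigenbasis (hd : 1 ≤ d) (hΩ : IsBoundedSmoothDomain Ω) {s γ : ℝ}
    (hs : 0 < s) (hγ : 0 ≤ γ) (hGmeas : Measurable (Function.uncurry G)) (hG1 : HypG1 Ω G s γ)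
    (hS1 : HypS1 Ω G) :
    ∃ (φ : HilbertBasis ℕ ℝ (L2 Ω)) (lam : ℕ → ℝ), IsEigenbasis Ω G φ lam := by
  have := isFiniteMeasure_restrict hΩ
  obtain ⟨T, hT, hsymm, N, hN, C, hC, hbdd⟩ := exists_greenOperator hd hΩ hs hγ hGmeas hG1
  obtain ⟨w, b, hb⟩ := exists_hilbertBasis ℝ (L2 Ω)
  have hcN : IsCompactOperator (T ^ N) := by
    refine isCompactOperator_of_summable_sq b ?_
    refine summable_of_sum_le (c := C ^ 2 * (volume.restrict Ω).real univ) (fun i => sq_nonneg _) fun F => ?_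
    exact sum_norm_sq_le_of_bounded hbdd b.orthonormal F
  have hc : IsCompactOperator T := isCompactOperator_of_symmetric_pow hsymm hcN
  have : Fact ((2 : ℝ≥0∞) ≠ ⊤) := ⟨by simp⟩
  obtain ⟨φ, ev, hev⟩ := exists_hilbertBasis_eigenvectors (not_finiteDimensional_L2 hd hΩ) hsymm hc
  refine ⟨φ, fun j => (ev j)⁻¹, fun j => ?_⟩
  rw [hT, map_smul, hev, smul_smul, inv_mul_cancel₀, one_smul]
  -- An eigenvalue `0` of the Green operator would make both `φ j` and `0` values of `L` at `0`.
  intro h0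
  obtain ⟨S, hS, -⟩ := hS1
  have h1 : IsOpValue Ω G 0 (φ j) := by rw [hT, hev, h0, zero_smul]
  have h2 : IsOpValue Ω G 0 0 := by rw [hT, map_zero]
  have h3 := hS.isOpValue_unique h1 h2
  have h4 := φ.orthonormal.1 j
  rw [h3, norm_zero] at h4
  exact zero_ne_one h4

end Eigenbasis

/-! ### The semigroup on eigenvectors, positivity of the eigenvalues, pointwise bounds. -/

section Semigroup

variable {d : ℕ} {Ω : Set (EuclideanSpace ℝ (Fin d))}
  {G : EuclideanSpace ℝ (Fin d) → EuclideanSpace ℝ (Fin d) → ℝ}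
  {φ : HilbertBasis ℕ ℝ (L2 Ω)} {lam : ℕ → ℝ}

/-- The function `e^(l r) S(r) v` is continuous with zero right derivative, hence constant. The
right derivative at `r` comes from the one at `0` through the semigroup law. -/
theorem IsHeatSemigroup.apply_eigenvector {S : ℝ → L2 Ω →L[ℝ] L2 Ω} (hS : IsHeatSemigroup Ω G S)
    {v : L2 Ω} {l : ℝ} (h : IsOpValue Ω G v (l • v)) {t : ℝ} (ht : 0 ≤ t) :
    S t v = Real.exp (-(l * t)) • v := by
  have hgen := (hS.generator v (l • v)).2 h
  have hderiv : ∀ r ∈ Ico 0 t,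
      HasDerivWithinAt (fun r => Real.exp (l * r) • S r v) 0 (Ici r) r := by
    intro r hr
    have h1 : HasDerivWithinAt (fun q => S (q - r) v) (-(l • v)) (Ici r) r := by
      have h2 : HasDerivWithinAt (fun q : ℝ => q - r) 1 (Ici r) r :=
        (hasDerivWithinAt_id r _).sub_const r
      have h3 : HasDerivWithinAt (fun t => S t v) (-(l • v)) (Ici 0) (r - r) := by
        rw [sub_self]; exact hgen
      have := HasDerivWithinAt.scomp (g₁ := fun t => S t v) (h := fun q : ℝ => q - r)
        (t' := Ici 0) r h3 h2 (fun q hq => mem_Ici.2 (sub_nonneg.2 (mem_Ici.1 hq)))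
      rw [one_smul] at this
      exact this
    have h4 : HasDerivWithinAt (fun q => S q v) (S r (-(l • v))) (Ici r) r := by
      have h5 := (S r).hasFDerivAt.comp_hasDerivWithinAt r h1
      refine h5.congr (fun q hq => ?_) ?_
      · have := hS.add r (q - r) hr.1 (sub_nonneg.2 hq)
        rw [add_sub_cancel] at this
        rw [this]; rfl
      · simp [hS.zero]
    have h6 : HasDerivWithinAt (fun q => Real.exp (l * q)) (Real.exp (l * r) * l) (Ici r) r := by
      simpa using ((hasDerivWithinAt_id r (Ici r)).const_mul l).exp
    have h7 := h6.smul h4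
    have h8 : Real.exp (l * r) • (S r) (-(l • v)) + (Real.exp (l * r) * l) • (S r) v = 0 := by
      rw [map_neg, map_smul, smul_neg, smul_smul, neg_add_cancel]
    rw [h8] at h7
    exact h7
  have hcont : ContinuousOn (fun r => Real.exp (l * r) • S r v) (Icc 0 t) :=
    (show Continuous fun r => Real.exp (l * r) by fun_prop).continuousOn.smul ((hS.continuous v).mono Icc_subset_Ici_self)
  have h0 := constant_of_has_deriv_right_zero hcont hderiv t (right_mem_Icc.2 ht)
  simp only [mul_zero, Real.exp_zero, one_smul, hS.zero, ContinuousLinearMap.id_apply] at h0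
  conv_rhs => rw [← h0]
  rw [smul_smul, ← Real.exp_add, neg_add_cancel, Real.exp_zero, one_smul]

/-- Symmetry of `S t` is not assumed: `v` is expanded in the basis, and `S t` is continuous and
diagonal on it. -/
theorem IsHeatSemigroup.repr_apply {S : ℝ → L2 Ω →L[ℝ] L2 Ω} (hS : IsHeatSemigroup Ω G S)
    (hφ : IsEigenbasis Ω G φ lam) {t : ℝ} (ht : 0 ≤ t) (v : L2 Ω) (j : ℕ) :
    inner ℝ (S t v) (φ j) = Real.exp (-(lam j * t)) * inner ℝ v (φ j) := by
  have h1 : HasSum (fun k => φ.repr v k • Real.exp (-(lam k * t)) • φ k) (S t v) := by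
    have := (φ.hasSum_repr v).mapL (S t)
    simpa only [map_smul, hS.apply_eigenvector (hφ _) ht] using this
  have h2 := h1.mapL (innerSL ℝ (φ j))
  have h3 : ∀ k, innerSL ℝ (φ j) (φ.repr v k • Real.exp (-(lam k * t)) • φ k) =
      if k = j then Real.exp (-(lam j * t)) * inner ℝ v (φ j) else 0 := by
    intro k
    rw [map_smul, map_smul, innerSL_apply_apply, orthonormal_iff_ite.1 φ.orthonormal]
    by_cases hk : k = j
    · subst hk
      simp [φ.repr_apply_apply, real_inner_comm, mul_comm]
    · simp [hk, Ne.symm hk]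
  simp only [h3] at h2
  have h4 := h2.unique (hasSum_ite_eq j _)
  rw [real_inner_comm]
  exact h4

theorem IsEigenbasis.lam_ne_zero (hφ : IsEigenbasis Ω G φ lam) (j : ℕ) : lam j ≠ 0 := by
  intro h0
  have h1 := hφ j
  rw [h0, zero_smul] at h1
  have h2 : φ j = 0 := by
    rw [Lp.ext_iff]
    refine h1.trans ?_
    refine EventuallyEq.trans (Eventually.of_forall fun x => ?_) (Lp.coeFn_zero ℝ 2 _).symm
    have : ∫ y in Ω, G x y * (0 : L2 Ω) y = ∫ _ in Ω, (0 : ℝ) := by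
      refine integral_congr_ae ?_
      filter_upwards [Lp.coeFn_zero ℝ 2 (volume.restrict Ω)] with y hy
      rw [hy]; simp
    simpa [greenOp] using this
  have h4 := φ.orthonormal.1 j
  rw [h2, norm_zero] at h4
  exact zero_ne_one h4

/-- The functions `S(t) 1_A` stay between `0` and `1`, so their coefficient `e^(-λ_j t) ⟨1_A, φ_j⟩`
is bounded in `t`. A negative `λ_j` would force `∫_A φ_j = 0` for every `A`, that is `φ_j = 0`. -/
theorem IsEigenbasis.lam_pos (hΩ : IsBoundedSmoothDomain Ω) (hφ : IsEigenbasis Ω G φ lam)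
    (hS1 : HypS1 Ω G) (j : ℕ) : 0 < lam j := by
  have := isFiniteMeasure_restrict hΩ
  obtain ⟨S, hS, hsub⟩ := hS1
  refine lt_of_le_of_ne ?_ (hφ.lam_ne_zero j).symm
  by_contra! hneg
  have hzero : ∀ A : Set (EuclideanSpace ℝ (Fin d)), MeasurableSet A →
      ∫ x in A, φ j x ∂(volume.restrict Ω) = 0 := by
    intro A hA
    set v : L2 Ω := indicatorConstLp 2 hA (measure_ne_top _ _) (1 : ℝ) with hv
    have hin : inner ℝ v (φ j) = ∫ x in A, φ j x ∂(volume.restrict Ω) :=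
      L2.inner_indicatorConstLp_one hA _ _
    rw [← hin]
    by_contra hne
    have hv01 : ∀ᵐ x ∂(volume.restrict Ω), 0 ≤ v x ∧ v x ≤ 1 := by
      filter_upwards [indicatorConstLp_coeFn (p := 2) (hs := hA)
        (hμs := measure_ne_top (volume.restrict Ω) A) (c := (1 : ℝ))] with x hx
      rw [hv, hx]
      by_cases hxA : x ∈ A <;> simp [hxA]
    obtain ⟨M, hM⟩ : ∃ M, ∀ t, 0 ≤ t → ‖S t v‖ ≤ M := by
      refine ⟨_, fun t ht => Lp.norm_le_of_ae_bound zero_le_one ?_⟩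
      filter_upwards [hsub t ht v hv01] with x hx
      rw [Real.norm_eq_abs, abs_of_nonneg hx.1]; exact hx.2
    have hb : ∀ t, 0 ≤ t → Real.exp (-(lam j * t)) * |inner ℝ v (φ j)| ≤ M := by
      intro t ht
      have h1 := abs_real_inner_le_norm (S t v) (φ j)
      rw [hS.repr_apply hφ ht, φ.orthonormal.1 j, mul_one, abs_mul, Real.abs_exp] at h1
      exact h1.trans (hM t ht)
    have htend : Tendsto (fun t => Real.exp (-(lam j * t)) * |inner ℝ v (φ j)|) atTop atTop := by
      refine Tendsto.atTop_mul_const (abs_pos.2 hne) (Real.tendsto_exp_atTop.comp ?_)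
      have : (fun t => -(lam j * t)) = fun t => (-lam j) * t := by funext t; ring
      rw [this]
      exact tendsto_id.const_mul_atTop (by linarith)
    obtain ⟨t, ht1, ht2⟩ := ((htend.eventually_gt_atTop M).and (eventually_ge_atTop 0)).exists
    exact absurd (hb t ht2) (not_le.2 ht1)
  have h1 : (φ j : EuclideanSpace ℝ (Fin d) → ℝ) =ᵐ[volume.restrict Ω] 0 :=
    ae_eq_zero_of_forall_setIntegral_eq_of_sigmaFinite
      (fun A _ _ => ((Lp.memLp (φ j)).integrable (by norm_num)).integrableOn)
      (fun A hA _ => hzero A hA)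
  have h2 : φ j = 0 := (Lp.eq_zero_iff_ae_eq_zero).2 h1
  have h4 := φ.orthonormal.1 j
  rw [h2, norm_zero] at h4
  exact zero_ne_one h4

/-- Pointwise bound for the eigenfunctions. -/
theorem IsEigenbasis.exists_ae_sum_sq_le (hd : 1 ≤ d) (hΩ : IsBoundedSmoothDomain Ω) {s γ : ℝ}
    (hs : 0 < s) (hγ : 0 ≤ γ) (hGmeas : Measurable (Function.uncurry G)) (hG1 : HypG1 Ω G s γ)
    (hφ : IsEigenbasis Ω G φ lam) :
    ∃ (N : ℕ) (C : ℝ), ∀ᵐ x ∂(volume.restrict Ω), ∀ F : Finset ℕ,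
      ∑ j ∈ F, ((lam j)⁻¹ ^ N * φ j x) ^ 2 ≤ C := by
  obtain ⟨T, hT, hsymm, N, hN, C, hC, hbdd⟩ := exists_greenOperator hd hΩ hs hγ hGmeas hG1
  have hTφ : ∀ j, T (φ j) = (lam j)⁻¹ • φ j := by
    intro j
    have h1 := (hT _ _).1 (hφ j)
    rw [map_smul] at h1
    conv_rhs => rw [h1]
    rw [smul_smul, inv_mul_cancel₀ (hφ.lam_ne_zero j), one_smul]
  have hTn : ∀ n j, (T ^ n) (φ j) = (lam j)⁻¹ ^ n • φ j := by
    intro n j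
    induction n with
    | zero => simp
    | succ n ih =>
      rw [pow_succ, mul_apply_eq_comp, hTφ, map_smul, ih, smul_smul, pow_succ']
  refine ⟨N, C ^ 2, ?_⟩
  rw [ae_all_iff]
  intro F
  have h1 : ∀ᵐ x ∂(volume.restrict Ω), ∀ j, ((T ^ N) (φ j)) x = (lam j)⁻¹ ^ N * φ j x := by
    rw [ae_all_iff]
    intro j
    rw [hTn]
    exact Lp.coeFn_smul _ _
  filter_upwards [h1, ae_sum_sq_le_of_bounded hbdd φ.orthonormal F] with x hx1 hx2
  rwa [Finset.sum_congr rfl fun j _ => by rw [hx1 j]] at hx2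

end Semigroup

/-! ### Gamma integrals along horizontal lines in the logarithmic variable. -/

section GammaLine

theorem image_exp_univ : Real.exp '' univ = Ioi 0 := by
  rw [image_univ, Real.range_exp]

/-- The substitution `r = e^v` turns rays in the plane into horizontal lines, so rotating a contour
becomes a vertical shift and no complex power needs a branch. -/
theorem integral_exp_smul_comp_exp {E : Type*} [NormedAddCommGroup E] [NormedSpace ℝ E]
    (f : ℝ → E) : ∫ v : ℝ, Real.exp v • f (Real.exp v) = ∫ r in Ioi (0 : ℝ), f r := by
  rw [← image_exp_univ, integral_image_eq_integral_abs_deriv_smul MeasurableSet.univ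
    (fun x _ => (Real.hasDerivAt_exp x).hasDerivWithinAt) Real.exp_injective.injOn]
  simp

theorem integrable_exp_smul_comp_exp {E : Type*} [NormedAddCommGroup E] [NormedSpace ℝ E]
    {f : ℝ → E} : Integrable (fun v : ℝ => Real.exp v • f (Real.exp v)) ↔
      IntegrableOn f (Ioi (0 : ℝ)) := by
  rw [← image_exp_univ, integrableOn_image_iff_integrableOn_abs_deriv_smul MeasurableSet.univ
    (fun x _ => (Real.hasDerivAt_exp x).hasDerivWithinAt) Real.exp_injective.injOn]
  simp

theorem integrable_exp_mul_sub_mul_exp {p c : ℝ} (hp : 0 < p) (hc : 0 < c) :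
    Integrable fun v : ℝ => Real.exp (p * v - c * Real.exp v) := by
  have h1 : IntegrableOn (fun r : ℝ => r ^ (p - 1) * Real.exp (-c * r)) (Ioi 0) := by
    simpa using integrableOn_rpow_mul_exp_neg_mul_rpow (p := 1) (s := p - 1) (b := c)
      (by linarith) one_pos hc
  refine (integrable_exp_smul_comp_exp.2 h1).congr (Eventually.of_forall fun v => ?_)
  simp only [smul_eq_mul]
  rw [← Real.exp_mul, ← Real.exp_add, ← Real.exp_add]
  congr 1; ring

variable {α ψ : ℝ}

/-- Cauchy's theorem for a half strip. -/
theorem integral_Iic_sub_integral_Iic {F : ℂ → ℂ} (hF : Differentiable ℂ F) {a b : ℝ} {g : ℝ → ℝ}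
    (hg : ∀ v : ℝ, ∀ θ ∈ uIcc a b, ‖F (v + θ * Complex.I)‖ ≤ g v) (hg0 : Tendsto g atBot (𝓝 0))
    {B : ℝ} (ha : IntegrableOn (fun v : ℝ => F (v + a * Complex.I)) (Iic B))
    (hb : IntegrableOn (fun v : ℝ => F (v + b * Complex.I)) (Iic B)) :
    (∫ v in Iic B, F (v + a * Complex.I)) - (∫ v in Iic B, F (v + b * Complex.I)) +
      Complex.I • ∫ θ in a..b, F (B + θ * Complex.I) = 0 := by
  have hrect : ∀ A : ℝ, (∫ v in A..B, F (v + a * Complex.I)) - (∫ v in A..B, F (v + b * Complex.I)) +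
      Complex.I • (∫ θ in a..b, F (B + θ * Complex.I)) =
        Complex.I • ∫ θ in a..b, F (A + θ * Complex.I) := by
    intro A
    have := Complex.integral_boundary_rect_eq_zero_of_differentiableOn F ⟨A, a⟩ ⟨B, b⟩
      hF.differentiableOn
    exact sub_eq_zero.1 this
  have h1 : Tendsto (fun A : ℝ => (∫ v in A..B, F (v + a * Complex.I)) -
      (∫ v in A..B, F (v + b * Complex.I)) + Complex.I • (∫ θ in a..b, F (B + θ * Complex.I))) atBot
      (𝓝 ((∫ v in Iic B, F (v + a * Complex.I)) - (∫ v in Iic B, F (v + b * Complex.I)) +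
      Complex.I • ∫ θ in a..b, F (B + θ * Complex.I))) :=
    ((intervalIntegral_tendsto_integral_Iic B ha tendsto_id).sub
      (intervalIntegral_tendsto_integral_Iic B hb tendsto_id)).add_const _
  have h2 : Tendsto (fun A : ℝ => Complex.I • ∫ θ in a..b, F (A + θ * Complex.I)) atBot (𝓝 0) := by
    refine squeeze_zero_norm (a := fun A => g A * |b - a|) (fun A => ?_)
      (by simpa using hg0.mul_const |b - a|)
    rw [norm_smul, Complex.norm_I, one_mul]
    exact intervalIntegral.norm_integral_le_of_norm_le_const fun θ hθ =>
      hg A θ (uIoc_subset_uIcc hθ)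
  simp only [hrect] at h1
  exact tendsto_nhds_unique h1 h2

theorem tendsto_exp_mul_atBot {p : ℝ} (hp : 0 < p) :
    Tendsto (fun v : ℝ => Real.exp (p * v)) atBot (𝓝 0) :=
  Real.tendsto_exp_atBot.comp (tendsto_id.const_mul_atBot hp)

theorem norm_cexp_mul_sub_cexp (p v θ : ℝ) :
    ‖Complex.exp (p * (v + θ * Complex.I) - Complex.exp (v + θ * Complex.I))‖ =
      Real.exp (p * v - Real.cos θ * Real.exp v) := by
  rw [Complex.norm_exp]
  congr 1
  rw [Complex.sub_re, Complex.re_ofReal_mul, Complex.exp_re]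
  simp [mul_comm]

/-- Cauchy's theorem on the strip between heights `0` and `θ`: there `Re e^w ≥ cos θ · e^v` with
`cos θ > 0`, which makes the integrand vanish at both ends. -/
theorem integral_cexp_mul_sub_cexp {p θ : ℝ} (hp : 0 < p) (hθ : |θ| < Real.pi / 2) :
    ∫ v : ℝ, Complex.exp (p * (v + θ * Complex.I) - Complex.exp (v + θ * Complex.I)) =
      Real.Gamma p := by
  set c := Real.cos θ with hc
  have hc0 : 0 < c := Real.cos_pos_of_mem_Ioo ⟨by linarith [neg_abs_le θ], by linarith [le_abs_self θ]⟩
  let F : ℂ → ℂ := fun w => Complex.exp (p * w - Complex.exp w)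
  have hF : Differentiable ℂ F := by fun_prop
  have hcos : ∀ y ∈ uIcc 0 θ, c ≤ Real.cos y := by
    intro y hy
    have hy' : |y| ≤ |θ| := by
      have := abs_sub_left_of_mem_uIcc hy
      simpa using this
    rw [hc, ← Real.cos_abs θ, ← Real.cos_abs y]
    exact Real.cos_le_cos_of_nonneg_of_le_pi (abs_nonneg _) (by linarith [Real.pi_pos]) hy'
  have hbound : ∀ v : ℝ, ∀ y ∈ uIcc 0 θ, ‖F (v + y * Complex.I)‖ ≤
      Real.exp (p * v - c * Real.exp v) := by
    intro v y hy
    simp only [F]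
    rw [norm_cexp_mul_sub_cexp]
    have := hcos y hy
    have := Real.exp_pos v
    exact Real.exp_le_exp.2 (by gcongr)
  have hint : ∀ y ∈ uIcc 0 θ, Integrable fun v : ℝ => F (v + y * Complex.I) := fun y hy =>
    (integrable_exp_mul_sub_mul_exp hp hc0).mono'
      (show Continuous fun v : ℝ => F (v + y * Complex.I) by fun_prop).aestronglyMeasurable
      (Eventually.of_forall fun v => hbound v y hy)
  have hbot : Tendsto (fun v => Real.exp (p * v - c * Real.exp v)) atBot (𝓝 0) :=
    squeeze_zero (fun v => (Real.exp_pos _).le)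
      (fun v => Real.exp_le_exp.2 (sub_le_self _ (mul_nonneg hc0.le (Real.exp_pos v).le)))
      (tendsto_exp_mul_atBot hp)
  have htop : Tendsto (fun v => Real.exp (p * v - c * Real.exp v)) atTop (𝓝 0) := by
    have h1 : Tendsto (fun r : ℝ => r ^ p * Real.exp (-c * r)) atTop (𝓝 0) :=
      tendsto_rpow_mul_exp_neg_mul_atTop_nhds_zero p c hc0
    refine (h1.comp Real.tendsto_exp_atTop).congr fun v => ?_
    simp only [Function.comp_apply]
    rw [← Real.exp_mul, ← Real.exp_add]
    congr 1; ring
  have hshift : ∫ v : ℝ, F (v + (0 : ℝ) * Complex.I) = ∫ v : ℝ, F (v + θ * Complex.I) := by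
    have h0 := hint 0 left_mem_uIcc
    have h1 := hint θ right_mem_uIcc
    have hrect := fun B : ℝ => integral_Iic_sub_integral_Iic hF hbound hbot (B := B)
      h0.integrableOn h1.integrableOn
    have hlim : Tendsto (fun B : ℝ => (∫ v in Iic B, F (v + (0 : ℝ) * Complex.I)) -
        (∫ v in Iic B, F (v + θ * Complex.I)) + Complex.I • ∫ y in (0 : ℝ)..θ, F (B + y * Complex.I))
        atTop (𝓝 ((∫ v : ℝ, F (v + (0 : ℝ) * Complex.I)) - (∫ v : ℝ, F (v + θ * Complex.I)) + 0)) := by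
      refine (((aecover_Iic tendsto_id).integral_tendsto_of_countably_generated h0).sub
        ((aecover_Iic tendsto_id).integral_tendsto_of_countably_generated h1)).add ?_
      refine squeeze_zero_norm (a := fun B => Real.exp (p * B - c * Real.exp B) * |θ - 0|)
        (fun B => ?_) (by simpa using htop.mul_const |θ - 0|)
      rw [norm_smul, Complex.norm_I, one_mul]
      exact intervalIntegral.norm_integral_le_of_norm_le_const fun y hy =>
        hbound B y (uIoc_subset_uIcc hy)
    simp only [hrect, add_zero] at hlim
    exact (sub_eq_zero.1 (tendsto_nhds_unique hlim tendsto_const_nhds))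
  simp only [F] at hshift
  rw [← hshift, Real.Gamma_eq_integral hp, ← integral_exp_smul_comp_exp, ← integral_complex_ofReal]
  refine integral_congr_ae (Eventually.of_forall fun v => ?_)
  simp only [smul_eq_mul]
  rw [← Real.exp_mul, ← Real.exp_add, ← Real.exp_add, Complex.ofReal_exp]
  congr 1
  push_cast
  ring_nf

/-- Gamma integral along the horizontal line of height `ψ` in logarithmic coordinates. -/
theorem integral_cexp_line (hψ : ψ ∈ Ioo (Real.pi / 2) Real.pi) {p : ℝ} (hp : 0 < p) :
    ∫ v : ℝ, Complex.exp (p * (v + ψ * Complex.I) + Complex.exp (v + ψ * Complex.I)) =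
      Complex.exp (Real.pi * p * Complex.I) * Real.Gamma p := by
  -- Lowering the line by `π` changes the sign of `e^w` and multiplies `e^(pw)` by a constant phase;
  -- the new height `ψ - π` lies in `(-π/2, 0)`.
  rw [← integral_cexp_mul_sub_cexp (θ := ψ - Real.pi) hp
    (by rw [abs_lt]; constructor <;> linarith [hψ.1, hψ.2, Real.pi_pos]), ← integral_const_mul]
  refine integral_congr_ae (Eventually.of_forall fun v => ?_)
  simp only []
  rw [← Complex.exp_add]
  congr 1
  push_cast
  rw [show (v : ℂ) + (ψ - Real.pi) * Complex.I = v + ψ * Complex.I - Real.pi * Complex.I by ring,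
    Complex.exp_sub _ (Real.pi * Complex.I), Complex.exp_pi_mul_I]
  ring

/-- The reflection formula. At the poles of `Γ(1 - p)` the sine vanishes, and the left side is `0`
by the default values of `Γ` and of the inverse. -/
theorem inv_Gamma_one_sub {p : ℝ} (hp : 0 < p) :
    (Real.Gamma (1 - p))⁻¹ = Real.Gamma p * Real.sin (Real.pi * p) / Real.pi := by
  have h := Real.Gamma_mul_Gamma_one_sub p
  have hG := (Real.Gamma_pos_of_pos hp).ne'
  by_cases hs : Real.sin (Real.pi * p) = 0
  · rw [hs, div_zero, mul_eq_zero] at h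
    rw [h.resolve_left hG, hs]; simp
  · have hπ := Real.pi_ne_zero
    have h1 : Real.Gamma (1 - p) ≠ 0 := by
      intro h0
      rw [h0, mul_zero, eq_comm, div_eq_zero_iff] at h
      tauto
    rw [eq_div_iff hs] at h
    rw [inv_eq_one_div, div_eq_div_iff h1 hπ]
    linarith

theorem im_cexp_pi_mul_Gamma {p : ℝ} (hp : 0 < p) :
    (Complex.exp (Real.pi * p * Complex.I) * Real.Gamma p).im = Real.pi * (Real.Gamma (1 - p))⁻¹ := by
  rw [inv_Gamma_one_sub hp, Complex.im_mul_ofReal, ← Complex.ofReal_mul,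
    Complex.exp_ofReal_mul_I_im]
  field_simp

end GammaLine

/-! ### Hankel representation of the Mainardi function. -/

section Mainardi

variable {α ψ : ℝ}

/-- The integrand of the Hankel representation of the Mainardi function, in logarithmic
coordinates. -/
noncomputable def hankelIntegrand (α τ : ℝ) (w : ℂ) : ℂ :=
  Complex.exp (α * w + Complex.exp w - τ * Complex.exp (α * w))

theorem differentiable_hankelIntegrand (α τ : ℝ) : Differentiable ℂ (hankelIntegrand α τ) := by
  unfold hankelIntegrand; fun_prop

theorem norm_hankelIntegrand (α τ v θ : ℝ) :
    ‖hankelIntegrand α τ (v + θ * Complex.I)‖ =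
      Real.exp (α * v + Real.exp v * Real.cos θ - τ * (Real.exp (α * v) * Real.cos (α * θ))) := by
  rw [hankelIntegrand, Complex.norm_exp]
  congr 1
  have e : (α : ℂ) * (v + θ * Complex.I) = (α * v : ℝ) + (α * θ : ℝ) * Complex.I := by
    push_cast; ring
  have hre : ∀ a b : ℝ, (Complex.exp (a + b * Complex.I)).re = Real.exp a * Real.cos b := by
    intro a b; rw [Complex.exp_re]; simp
  rw [Complex.sub_re, Complex.add_re, e, Complex.re_ofReal_mul, hre, hre]
  simp

theorem conj_hankelIntegrand (α τ v θ : ℝ) :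
    (starRingEnd ℂ) (hankelIntegrand α τ (v + θ * Complex.I)) =
      hankelIntegrand α τ (v - θ * Complex.I) := by
  simp only [hankelIntegrand, ← Complex.exp_conj, map_sub, map_add, map_mul, Complex.conj_ofReal,
    Complex.conj_I]
  simp only [mul_neg, ← sub_eq_add_neg]

/-- An opening angle adapted to the order `α`. -/
noncomputable def hankelAngle (α : ℝ) : ℝ := Real.pi / (1 + α)

/-- The decay rate on the rays with the adapted opening angle. -/
noncomputable def hankelRate (α : ℝ) : ℝ := Real.cos (α * hankelAngle α)

theorem hankelAngle_mem (hα : α ∈ Ioo (0 : ℝ) 1) : hankelAngle α ∈ Ioo (Real.pi / 2) Real.pi := by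
  have hpi := Real.pi_pos
  have h0 := hα.1
  have h1 := hα.2
  unfold hankelAngle
  constructor
  · exact div_lt_div_of_pos_left hpi (by linarith) (by linarith)
  · exact div_lt_self hpi (by linarith)

/-- This balance motivates the angle: `cos ψ` and `cos (α ψ)` become opposite numbers, so on the ray
both `e^z` and `e^(-τ z^α)` decay, with the same constant. -/
theorem mul_hankelAngle (hα : α ∈ Ioo (0 : ℝ) 1) : α * hankelAngle α = Real.pi - hankelAngle α := by
  have : (1 + α) ≠ 0 := by linarith [hα.1]
  unfold hankelAngle
  field_simp; ring

theorem hankelRate_pos (hα : α ∈ Ioo (0 : ℝ) 1) : 0 < hankelRate α := by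
  have h := hankelAngle_mem hα
  unfold hankelRate
  rw [mul_hankelAngle hα]
  exact Real.cos_pos_of_mem_Ioo ⟨by linarith [h.2, Real.pi_pos], by linarith [h.1]⟩

theorem cos_hankelAngle (hα : α ∈ Ioo (0 : ℝ) 1) : Real.cos (hankelAngle α) = -hankelRate α := by
  unfold hankelRate
  rw [mul_hankelAngle hα, Real.cos_pi_sub, neg_neg]

theorem norm_hankelIntegrand_ray (hα : α ∈ Ioo (0 : ℝ) 1) (τ v : ℝ) :
    ‖hankelIntegrand α τ (v + hankelAngle α * Complex.I)‖ =
      Real.exp (α * v - hankelRate α * Real.exp v - τ * (hankelRate α * Real.exp (α * v))) := by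
  rw [norm_hankelIntegrand, cos_hankelAngle hα]
  congr 1
  unfold hankelRate; ring

theorem norm_hankelIntegrand_ray_le (hα : α ∈ Ioo (0 : ℝ) 1) {τ : ℝ} (hτ : 0 ≤ τ) (v : ℝ) :
    ‖hankelIntegrand α τ (v + hankelAngle α * Complex.I)‖ ≤
      Real.exp (α * v - hankelRate α * Real.exp v) := by
  rw [norm_hankelIntegrand_ray hα]
  have := (hankelRate_pos hα).le
  exact Real.exp_le_exp.2 (sub_le_self _ (by positivity))

theorem continuous_hankelIntegrand_line (α τ θ : ℝ) :
    Continuous fun v : ℝ => hankelIntegrand α τ (v + θ * Complex.I) := by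
  unfold hankelIntegrand; fun_prop

theorem integrable_hankelIntegrand (hα : α ∈ Ioo (0 : ℝ) 1) {τ : ℝ} (hτ : 0 ≤ τ) :
    Integrable fun v : ℝ => hankelIntegrand α τ (v + hankelAngle α * Complex.I) :=
  (integrable_exp_mul_sub_mul_exp hα.1 (hankelRate_pos hα)).mono'
    (continuous_hankelIntegrand_line _ _ _).aestronglyMeasurable
    (Eventually.of_forall fun v => norm_hankelIntegrand_ray_le hα hτ v)

/-- Weighted arithmetic–geometric mean for `c r` and `b`, where `b` is chosen so that `b^(1-α) = τ /
c^α`. -/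
theorem exists_mul_rpow_le (hα : α ∈ Ioo (0 : ℝ) 1) {c τ : ℝ} (hc : 0 < c) (hτ : 0 ≤ τ) :
    ∃ M : ℝ, ∀ r : ℝ, 0 ≤ r → τ * r ^ α ≤ M + c * r := by
  set b : ℝ := (τ / c ^ α) ^ (1 / (1 - α)) with hb
  have h1α : 0 < 1 - α := by linarith [hα.2]
  have hb0 : 0 ≤ b := by positivity
  refine ⟨b, fun r hr => ?_⟩
  have h := Real.geom_mean_le_arith_mean2_weighted hα.1.le h1α.le (mul_nonneg hc.le hr) hb0
    (by ring)
  rw [Real.mul_rpow hc.le hr, hb, ← Real.rpow_mul (by positivity), one_div_mul_cancel h1α.ne', Real.rpow_one] at h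
  have e : c ^ α * r ^ α * (τ / c ^ α) = τ * r ^ α := by
    have : c ^ α ≠ 0 := (Real.rpow_pos_of_pos hc _).ne'
    field_simp
  rw [e, ← hb] at h
  nlinarith [mul_nonneg hc.le hr, hα.1, hα.2]

/-- The Hankel representation of the Mainardi function. -/
theorem hasSum_mainardi (hα : α ∈ Ioo (0 : ℝ) 1) {τ : ℝ} (hτ : 0 ≤ τ) :
    HasSum (fun k : ℕ => (-τ) ^ k / ((k.factorial : ℝ) * Real.Gamma (1 - α * (k + 1))))
      (Real.pi⁻¹ * (∫ v : ℝ, hankelIntegrand α τ (v + hankelAngle α * Complex.I)).im) := by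
  set ψ := hankelAngle α with hψ
  set c := hankelRate α with hc
  have hc0 : 0 < c := hankelRate_pos hα
  have hα0 := hα.1
  -- The terms of the expansion of `exp (-τ e^(αw))` inside the Hankel integrand; each integrates to
  -- a Gamma integral of exponent `α (k + 1)`.
  let F : ℕ → ℝ → ℂ := fun k v => ((-τ) ^ k / (k.factorial : ℝ) : ℝ) *
    Complex.exp ((α * (k + 1) : ℝ) * (v + ψ * Complex.I) + Complex.exp (v + ψ * Complex.I))
  let b : ℕ → ℝ → ℝ := fun k v => Real.exp (α * v - c * Real.exp v) *
    ((τ * Real.exp (α * v)) ^ k / k.factorial)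
  have hFb : ∀ k v, ‖F k v‖ ≤ b k v := by
    intro k v
    have h1 : ‖Complex.exp ((α * (k + 1) : ℝ) * (v + ψ * Complex.I) +
        Complex.exp (v + ψ * Complex.I))‖ = Real.exp (α * (k + 1) * v - c * Real.exp v) := by
      rw [Complex.norm_exp]
      congr 1
      have hre : (Complex.exp (v + ψ * Complex.I)).re = -(c * Real.exp v) := by
        rw [Complex.exp_re]
        simp only [Complex.add_re, Complex.ofReal_re, Complex.mul_re, Complex.I_re, mul_zero,
          Complex.ofReal_im, Complex.I_im, mul_one, sub_self, add_zero, Complex.add_im,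
          Complex.mul_im, zero_add]
        rw [cos_hankelAngle hα]; ring
      rw [Complex.add_re, Complex.re_ofReal_mul, hre]
      simp; ring
    rw [norm_mul, h1, Complex.norm_real, norm_div, norm_pow, norm_neg, Real.norm_of_nonneg hτ,
      Real.norm_of_nonneg (by positivity)]
    refine le_of_eq ?_
    simp only [b]
    rw [mul_pow, ← Real.exp_nat_mul, show α * (k + 1) * v - c * Real.exp v =
      (α * v - c * Real.exp v) + k * (α * v) by ring, Real.exp_add]
    ring
  have hbsum : ∀ v, HasSum (fun k => b k v)
      (Real.exp (α * v - c * Real.exp v) * Real.exp (τ * Real.exp (α * v))) := by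
    intro v
    have := NormedSpace.expSeries_div_hasSum_exp (τ * Real.exp (α * v))
    rw [← Real.exp_eq_exp_ℝ] at this
    exact this.mul_left _
  -- The absolute values sum to `exp (αv - c e^v + τ e^(αv))`; as `α < 1`, half of `c e^v` absorbs
  -- the growing term up to a constant.
  have hbint : Integrable fun v => ∑' k, b k v := by
    obtain ⟨M, hM⟩ := exists_mul_rpow_le hα (half_pos hc0) hτ
    simp_rw [fun v => (hbsum v).tsum_eq]
    refine ((integrable_exp_mul_sub_mul_exp hα0 (half_pos hc0)).const_mul (Real.exp M)).mono'
      (by fun_prop) (Eventually.of_forall fun v => ?_)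
    rw [Real.norm_of_nonneg (by positivity), ← Real.exp_add, ← Real.exp_add]
    have h1 := hM (Real.exp v) (Real.exp_pos v).le
    rw [← Real.exp_mul, mul_comm v α] at h1
    exact Real.exp_le_exp.2 (by linarith)
  have hsum : ∀ v : ℝ, HasSum (fun k => F k v) (hankelIntegrand α τ (v + ψ * Complex.I)) := by
    intro v
    have h1 : HasSum (fun k : ℕ => (-(τ * Complex.exp (α * (v + ψ * Complex.I)))) ^ k / k.factorial)
        (Complex.exp (-(τ * Complex.exp (α * (v + ψ * Complex.I))))) := by
      rw [Complex.exp_eq_exp_ℂ]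
      exact NormedSpace.expSeries_div_hasSum_exp _
    have h2 := h1.mul_left (Complex.exp (α * (v + ψ * Complex.I) + Complex.exp (v + ψ * Complex.I)))
    rw [← Complex.exp_add, ← sub_eq_add_neg] at h2
    refine h2.congr_fun fun k => ?_
    simp only [F]
    rw [neg_pow (τ * _ : ℂ), mul_pow, ← Complex.exp_nat_mul]
    push_cast
    rw [show (α : ℂ) * (k + 1) * (v + ψ * Complex.I) + Complex.exp (v + ψ * Complex.I) =
      (α * (v + ψ * Complex.I) + Complex.exp (v + ψ * Complex.I)) +
        k * (α * (v + ψ * Complex.I)) by ring, Complex.exp_add _ (k * _), neg_pow (τ : ℂ)]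
    ring
  have key := hasSum_integral_of_dominated_convergence (μ := (volume : Measure ℝ)) (F := F) b
    (fun k => (show Continuous (F k) by fun_prop).aestronglyMeasurable)
    (fun k => Eventually.of_forall fun v => hFb k v)
    (Eventually.of_forall fun v => (hbsum v).summable) hbint
    (Eventually.of_forall fun v => hsum v)
  have key2 := (Complex.hasSum_im key).mul_left Real.pi⁻¹
  refine key2.congr_fun fun k => ?_
  have hp : 0 < α * ((k : ℝ) + 1) := by positivity
  simp only [F]
  rw [integral_const_mul, integral_cexp_line (hankelAngle_mem hα) hp, Complex.im_ofReal_mul,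
    im_cexp_pi_mul_Gamma hp]
  have := Real.pi_ne_zero
  field_simp

theorem mainardi_eq (hα : α ∈ Ioo (0 : ℝ) 1) {τ : ℝ} (hτ : 0 ≤ τ) :
    mainardi α τ =
      Real.pi⁻¹ * (∫ v : ℝ, hankelIntegrand α τ (v + hankelAngle α * Complex.I)).im :=
  (hasSum_mainardi hα hτ).tsum_eq

end Mainardi

/-! ### Superexponential decay of the Mainardi function. -/

section MainardiDecay

variable {α : ℝ}

theorem two_mul_I_mul_im (z : ℂ) : z - (starRingEnd ℂ) z = 2 * Complex.I * z.im := by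
  rw [Complex.sub_conj]; push_cast; ring

/-- The Mainardi function decays faster than every exponential. -/
theorem exists_abs_mainardi_le (hα : α ∈ Ioo (0 : ℝ) 1) (b : ℝ) :
    ∃ C : ℝ, ∀ τ : ℝ, 0 ≤ τ → |mainardi α τ| ≤ C * Real.exp (-b * τ) := by
  set c := hankelRate α with hc
  have hc0 : 0 < c := hankelRate_pos hα
  set ψ := hankelAngle α with hψ
  have hψm := hankelAngle_mem hα
  have hpi := Real.pi_pos
  have hψ0 : 0 < ψ := by linarith [hψm.1]
  -- In the original variable `e^B` is the radius of an arc that replaces the inner parts of the two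
  -- conjugate rays. It is chosen so that `e^(-τ z^α)` has modulus at most `e^(-bτ)` on the arc and
  -- on the outer rays.
  obtain ⟨B, hB⟩ : ∃ B : ℝ, b ≤ c * Real.exp (α * B) := by
    have h1 : Tendsto (fun B => c * Real.exp (α * B)) atTop atTop :=
      (Real.tendsto_exp_atTop.comp (tendsto_id.const_mul_atTop hα.1)).const_mul_atTop hc0
    exact (h1.eventually_ge_atTop b).exists
  set D := ∫ v : ℝ, Real.exp (α * v - c * Real.exp v) with hD
  have hDint := integrable_exp_mul_sub_mul_exp hα.1 hc0
  refine ⟨Real.pi⁻¹ * (D + Real.exp (α * B + Real.exp B) * ψ), fun τ hτ => ?_⟩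
  have hint := integrable_hankelIntegrand hα hτ
  have hconj : ∀ v : ℝ, hankelIntegrand α τ (v + (-ψ : ℝ) * Complex.I) =
      (starRingEnd ℂ) (hankelIntegrand α τ (v + ψ * Complex.I)) := by
    intro v
    rw [conj_hankelIntegrand]
    congr 1; push_cast; ring
  have hint' : Integrable fun v : ℝ => hankelIntegrand α τ (v + (-ψ : ℝ) * Complex.I) := by
    simp_rw [hconj]
    exact hint.norm.mono' (Complex.continuous_conj.comp_aestronglyMeasurable hint.1)
      (Eventually.of_forall fun v => by rw [RCLike.norm_conj])
  have hcos : ∀ θ ∈ uIcc ψ (-ψ), c ≤ Real.cos (α * θ) := by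
    intro θ hθ
    rw [uIcc_of_ge (by linarith), mem_Icc, ← abs_le] at hθ
    rw [hc, hankelRate, ← Real.cos_abs (α * θ), abs_mul, abs_of_pos hα.1, ← hψ]
    refine Real.cos_le_cos_of_nonneg_of_le_pi (mul_nonneg hα.1.le (abs_nonneg _)) ?_
      (mul_le_mul_of_nonneg_left hθ hα.1.le)
    rw [mul_hankelAngle hα]; linarith [hψm.1]
  have hstrip : ∀ v : ℝ, ∀ θ ∈ uIcc ψ (-ψ), ‖hankelIntegrand α τ (v + θ * Complex.I)‖ ≤
      Real.exp (α * v + Real.exp v - τ * (Real.exp (α * v) * c)) := by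
    intro v θ hθ
    rw [norm_hankelIntegrand]
    have h1 := hcos θ hθ
    have h2 : Real.exp v * Real.cos θ ≤ Real.exp v :=
      mul_le_of_le_one_right (Real.exp_pos v).le (Real.cos_le_one θ)
    have h3 : τ * (Real.exp (α * v) * c) ≤ τ * (Real.exp (α * v) * Real.cos (α * θ)) := by gcongr
    exact Real.exp_le_exp.2 (by linarith)
  have hbot : Tendsto (fun v => Real.exp (α * v + Real.exp v - τ * (Real.exp (α * v) * c))) atBot
      (𝓝 0) := by
    have h1 : Tendsto (fun v => Real.exp (α * v) * Real.exp (Real.exp v)) atBot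
        (𝓝 (0 * Real.exp 0)) :=
      (tendsto_exp_mul_atBot hα.1).mul
        ((Real.continuous_exp.tendsto 0).comp Real.tendsto_exp_atBot)
    rw [zero_mul] at h1
    refine squeeze_zero (fun v => (Real.exp_pos _).le) (fun v => ?_) h1
    rw [← Real.exp_add]
    exact Real.exp_le_exp.2 (sub_le_self _ (by positivity))
  have hrect := integral_Iic_sub_integral_Iic (differentiable_hankelIntegrand α τ) hstrip hbot
    (B := B) hint.integrableOn hint'.integrableOn
  have hsplit : ∀ {f : ℝ → ℂ}, Integrable f → ∫ v, f v = (∫ v in Iic B, f v) + ∫ v in Ioi B, f v :=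
    fun hf => (intervalIntegral.integral_Iic_add_Ioi hf.integrableOn hf.integrableOn).symm
  have htail : ∀ {f : ℝ → ℂ}, (∀ v, ‖f v‖ = ‖hankelIntegrand α τ (v + ψ * Complex.I)‖) →
      ‖∫ v in Ioi B, f v‖ ≤ Real.exp (-b * τ) * D := by
    intro f hf
    rw [hD, ← integral_const_mul]
    refine (norm_integral_le_of_norm_le (hDint.const_mul (Real.exp (-b * τ))).integrableOn
      ((ae_restrict_iff' measurableSet_Ioi).2 (Eventually.of_forall fun v hv => ?_))).trans
      (setIntegral_le_integral (hDint.const_mul _) (Eventually.of_forall fun v => by positivity))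
    rw [hf, norm_hankelIntegrand_ray hα, ← Real.exp_add]
    refine Real.exp_le_exp.2 ?_
    have h1 : Real.exp (α * B) ≤ Real.exp (α * v) :=
      Real.exp_le_exp.2 (mul_le_mul_of_nonneg_left (le_of_lt hv) hα.1.le)
    have h2 : b * τ ≤ τ * (c * Real.exp (α * v)) := by
      rw [mul_comm b]
      exact mul_le_mul_of_nonneg_left (hB.trans (mul_le_mul_of_nonneg_left h1 hc0.le)) hτ
    linarith
  have harc : ‖Complex.I • ∫ θ in ψ..(-ψ), hankelIntegrand α τ (B + θ * Complex.I)‖ ≤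
      Real.exp (-b * τ) * Real.exp (α * B + Real.exp B) * (2 * ψ) := by
    rw [norm_smul, Complex.norm_I, one_mul]
    refine (intervalIntegral.norm_integral_le_of_norm_le_const fun θ hθ =>
      hstrip B θ (uIoc_subset_uIcc hθ)).trans (le_of_eq_of_le ?_
        (mul_le_mul_of_nonneg_right (?_ : Real.exp (α * B + Real.exp B -
          τ * (Real.exp (α * B) * c)) ≤ _) (by positivity)))
    · rw [show -ψ - ψ = -(2 * ψ) by ring, abs_neg, abs_of_pos (by positivity)]
    · rw [← Real.exp_add]
      refine Real.exp_le_exp.2 ?_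
      have := mul_le_mul_of_nonneg_left hB hτ
      linarith
  -- The imaginary part is half the difference of the conjugate ray integrals, up to `i`. Cauchy's
  -- theorem on the half strip exchanges their parts over `v ≤ B` for the arc.
  have hI : (2 * Complex.I * ((∫ v : ℝ, hankelIntegrand α τ (v + ψ * Complex.I)).im : ℂ)) =
      (∫ v in Ioi B, hankelIntegrand α τ (v + ψ * Complex.I)) -
      (∫ v in Ioi B, hankelIntegrand α τ (v + (-ψ : ℝ) * Complex.I)) -
      Complex.I • ∫ θ in ψ..(-ψ), hankelIntegrand α τ (B + θ * Complex.I) := by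
    rw [← two_mul_I_mul_im, ← integral_conj]
    simp_rw [← hconj]
    rw [hsplit hint, hsplit hint']
    linear_combination hrect
  have hnorm : 2 * |(∫ v : ℝ, hankelIntegrand α τ (v + ψ * Complex.I)).im| ≤
      Real.exp (-b * τ) * D + Real.exp (-b * τ) * D +
        Real.exp (-b * τ) * Real.exp (α * B + Real.exp B) * (2 * ψ) := by
    have h1 : 2 * |(∫ v : ℝ, hankelIntegrand α τ (v + ψ * Complex.I)).im| =
        ‖(2 * Complex.I * ((∫ v : ℝ, hankelIntegrand α τ (v + ψ * Complex.I)).im : ℂ))‖ := by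
      rw [norm_mul, norm_mul, Complex.norm_I, Complex.norm_real]; simp
    rw [h1, hI]
    refine (norm_sub_le _ _).trans (add_le_add ((norm_sub_le _ _).trans (add_le_add ?_ ?_)) harc)
    · exact htail fun v => rfl
    · exact htail fun v => by rw [hconj, RCLike.norm_conj]
  rw [mainardi_eq hα hτ, abs_mul, abs_of_pos (inv_pos.2 hpi), mul_assoc]
  refine mul_le_mul_of_nonneg_left ?_ (inv_pos.2 hpi).le
  rw [← hψ]
  linarith

theorem aestronglyMeasurable_mainardi (hα : α ∈ Ioo (0 : ℝ) 1) :
    AEStronglyMeasurable (mainardi α) (volume.restrict (Ioi 0)) := by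
  have hm : StronglyMeasurable fun p : ℝ × ℝ =>
      hankelIntegrand α p.1 (p.2 + hankelAngle α * Complex.I) := by
    have : Continuous fun p : ℝ × ℝ => hankelIntegrand α p.1 (p.2 + hankelAngle α * Complex.I) := by
      unfold hankelIntegrand; fun_prop
    exact this.stronglyMeasurable
  have h1 : Measurable fun τ : ℝ => Real.pi⁻¹ *
      (∫ v : ℝ, hankelIntegrand α τ (v + hankelAngle α * Complex.I)).im :=
    (Complex.measurable_im.comp hm.integral_prod_right'.measurable).const_mul _
  refine h1.aestronglyMeasurable.congr ?_
  filter_upwards [ae_restrict_mem measurableSet_Ioi] with τ hτ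
  rw [mainardi_eq hα (le_of_lt hτ)]

/-- All exponentially weighted moments of the Mainardi function converge. -/
theorem integrableOn_rpow_mul_mainardi (hα : α ∈ Ioo (0 : ℝ) 1) {p : ℝ} (hp : -1 < p) (b : ℝ) :
    IntegrableOn (fun τ => τ ^ p * Real.exp (b * τ) * mainardi α τ) (Ioi 0) := by
  obtain ⟨C, hC⟩ := exists_abs_mainardi_le hα (b + 1)
  have h1 : IntegrableOn (fun r : ℝ => r ^ p * Real.exp (-1 * r)) (Ioi 0) := by
    simpa using integrableOn_rpow_mul_exp_neg_mul_rpow (p := 1) (s := p) (b := 1) hp one_pos one_pos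
  refine (h1.const_mul C).mono' ?_ ?_
  · exact ((measurable_id.pow_const p).mul (by fun_prop)).aestronglyMeasurable.mul
      (aestronglyMeasurable_mainardi hα)
  · filter_upwards [ae_restrict_mem measurableSet_Ioi] with τ hτ
    have hτ0 : 0 < τ := hτ
    rw [norm_mul, Real.norm_of_nonneg (by positivity), Real.norm_eq_abs]
    calc τ ^ p * Real.exp (b * τ) * |mainardi α τ|
        ≤ τ ^ p * Real.exp (b * τ) * (C * Real.exp (-(b + 1) * τ)) := by
          gcongr; exact hC τ hτ0.le
      _ = C * (τ ^ p * (Real.exp (b * τ) * Real.exp (-(b + 1) * τ))) := by ring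
      _ = C * (τ ^ p * Real.exp (-1 * τ)) := by rw [← Real.exp_add]; congr 3; ring

end MainardiDecay

/-! ### Mellin transform and moments of the Mainardi function. -/

section MainardiMoments

variable {α : ℝ}

/-- The Gamma integral with a complex rate `e^(q+iθ)`: put `τ = e^u`, shift `u` by `q`, and use the
Gamma integral at height `θ`. -/
theorem integral_rpow_mul_cexp_neg_mul {z q θ : ℝ} (hz : 0 < z) (hθ : |θ| < Real.pi / 2) :
    ∫ τ in Ioi (0 : ℝ), ((τ ^ (z - 1) : ℝ) : ℂ) *
      Complex.exp (-(τ * Complex.exp (q + θ * Complex.I))) =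
      Complex.exp (-(z * (q + θ * Complex.I))) * Real.Gamma z := by
  rw [← integral_exp_smul_comp_exp, ← integral_cexp_mul_sub_cexp hz hθ, ← integral_const_mul]
  symm
  rw [← integral_add_right_eq_self _ q]
  refine integral_congr_ae (Eventually.of_forall fun u => ?_)
  simp only [Complex.real_smul]
  rw [← Real.exp_mul, Complex.ofReal_exp, Complex.ofReal_exp, ← Complex.exp_add, ← Complex.exp_add,
    ← Complex.exp_add, ← Complex.exp_add]
  congr 1
  push_cast
  rw [show ((u : ℂ) + q + θ * Complex.I) = u + (q + θ * Complex.I) by ring,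
    Complex.exp_add (u : ℂ) (q + θ * Complex.I)]
  ring

/-- Integrating the modulus in `τ` first leaves `e^(α(1-z)v - c e^v)`. Integrability at `v → -∞` is
where `z < 1` is needed. -/
theorem integrable_prod_hankelIntegrand (hα : α ∈ Ioo (0 : ℝ) 1) {z : ℝ} (hz0 : 0 < z)
    (hz1 : z < 1) :
    Integrable (fun p : ℝ × ℝ => ((p.1 ^ (z - 1) : ℝ) : ℂ) *
      hankelIntegrand α p.1 (p.2 + hankelAngle α * Complex.I))
      ((volume.restrict (Ioi 0)).prod volume) := by
  set c := hankelRate α with hc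
  have hc0 : 0 < c := hankelRate_pos hα
  have hm : AEStronglyMeasurable (fun p : ℝ × ℝ => ((p.1 ^ (z - 1) : ℝ) : ℂ) *
      hankelIntegrand α p.1 (p.2 + hankelAngle α * Complex.I))
      ((volume.restrict (Ioi 0)).prod volume) := by
    have h1 : Measurable fun p : ℝ × ℝ => ((p.1 ^ (z - 1) : ℝ) : ℂ) :=
      Complex.measurable_ofReal.comp (measurable_fst.pow_const _)
    have h2 : Continuous fun p : ℝ × ℝ => hankelIntegrand α p.1 (p.2 + hankelAngle α * Complex.I) := by
      unfold hankelIntegrand; fun_prop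
    exact (h1.mul h2.measurable).aestronglyMeasurable
  have hnorm : ∀ v : ℝ, ∀ τ ∈ Ioi (0 : ℝ), ‖((τ ^ (z - 1) : ℝ) : ℂ) *
      hankelIntegrand α τ (v + hankelAngle α * Complex.I)‖ =
      Real.exp (α * v - c * Real.exp v) *
        (τ ^ (z - 1) * Real.exp (-((c * Real.exp (α * v)) * τ))) := by
    intro v τ hτ
    have hτ0 : 0 < τ := hτ
    rw [norm_mul, Complex.norm_real, Real.norm_of_nonneg (by positivity),
      norm_hankelIntegrand_ray hα, ← hc,
      show α * v - c * Real.exp v - τ * (c * Real.exp (α * v)) = (α * v - c * Real.exp v) +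
        -((c * Real.exp (α * v)) * τ) by ring, Real.exp_add]
    ring
  have hI : ∀ v : ℝ, IntegrableOn (fun τ : ℝ => τ ^ (z - 1) *
      Real.exp (-((c * Real.exp (α * v)) * τ))) (Ioi 0) := by
    intro v
    simpa using integrableOn_rpow_mul_exp_neg_mul_rpow (p := 1) (s := z - 1)
      (b := c * Real.exp (α * v)) (by linarith) one_pos (by positivity)
  rw [integrable_prod_iff' hm]
  constructor
  · refine Eventually.of_forall fun v => ?_
    refine ((hI v).const_mul (Real.exp (α * v - c * Real.exp v))).mono' ?_ ?_
    · have h1 : Measurable fun τ : ℝ => ((τ ^ (z - 1) : ℝ) : ℂ) :=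
        Complex.measurable_ofReal.comp (measurable_id.pow_const _)
      have h2 : Continuous fun τ : ℝ => hankelIntegrand α τ (v + hankelAngle α * Complex.I) := by
        unfold hankelIntegrand; fun_prop
      exact (h1.mul h2.measurable).aestronglyMeasurable
    · filter_upwards [ae_restrict_mem measurableSet_Ioi] with τ hτ using (hnorm v τ hτ).le
  · have e : ∀ v : ℝ, ∫ τ in Ioi (0 : ℝ), ‖((τ ^ (z - 1) : ℝ) : ℂ) *
        hankelIntegrand α τ (v + hankelAngle α * Complex.I)‖ =
        (1 / c) ^ z * Real.Gamma z * Real.exp (α * (1 - z) * v - c * Real.exp v) := by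
      intro v
      rw [setIntegral_congr_fun measurableSet_Ioi (hnorm v), integral_const_mul,
        Real.integral_rpow_mul_exp_neg_mul_Ioi hz0 (by positivity), ← one_div_mul_one_div,
        Real.mul_rpow (by positivity) (by positivity), one_div (Real.exp _), ← Real.exp_neg,
        ← Real.exp_mul,
        show α * (1 - z) * v - c * Real.exp v = (α * v - c * Real.exp v) + -(α * v) * z by ring,
        Real.exp_add]
      ring
    simp only [e]
    exact (integrable_exp_mul_sub_mul_exp (mul_pos hα.1 (by linarith)) hc0).const_mul _

theorem integral_rpow_mul_mainardi_of_lt_one (hα : α ∈ Ioo (0 : ℝ) 1) {z : ℝ} (hz0 : 0 < z)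
    (hz1 : z < 1) :
    ∫ τ in Ioi (0 : ℝ), τ ^ (z - 1) * mainardi α τ =
      Real.Gamma z * (Real.Gamma (1 - α * (1 - z)))⁻¹ := by
  have hψ := hankelAngle_mem hα
  have hp : 0 < α * (1 - z) := mul_pos hα.1 (by linarith)
  have hθ : |α * hankelAngle α| < Real.pi / 2 := by
    rw [mul_hankelAngle hα, abs_lt]
    constructor <;> linarith [hψ.1, hψ.2, Real.pi_pos]
  have hint := integrable_prod_hankelIntegrand hα hz0 hz1
  have h1 : ∫ τ in Ioi (0 : ℝ), ∫ v : ℝ, ((τ ^ (z - 1) : ℝ) : ℂ) *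
      hankelIntegrand α τ (v + hankelAngle α * Complex.I) =
      Complex.exp (Real.pi * (α * (1 - z) : ℝ) * Complex.I) * Real.Gamma (α * (1 - z)) *
        Real.Gamma z := by
    rw [integral_integral_swap hint, ← integral_cexp_line hψ hp, ← integral_mul_const]
    refine integral_congr_ae (Eventually.of_forall fun v => ?_)
    simp only []
    have e : ∀ τ : ℝ, ((τ ^ (z - 1) : ℝ) : ℂ) *
        hankelIntegrand α τ (v + hankelAngle α * Complex.I) =
        Complex.exp (α * (v + hankelAngle α * Complex.I) +
          Complex.exp (v + hankelAngle α * Complex.I)) * (((τ ^ (z - 1) : ℝ) : ℂ) *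
          Complex.exp (-(τ * Complex.exp ((α * v : ℝ) + (α * hankelAngle α : ℝ) * Complex.I)))) := by
      intro τ
      rw [hankelIntegrand, sub_eq_add_neg (_ + _), Complex.exp_add _ (-_),
        show ((α * v : ℝ) : ℂ) + (α * hankelAngle α : ℝ) * Complex.I =
          α * (v + hankelAngle α * Complex.I) by push_cast; ring]
      ring
    simp only [e]
    rw [integral_const_mul, integral_rpow_mul_cexp_neg_mul hz0 hθ, ← mul_assoc, ← Complex.exp_add]
    congr 2
    push_cast
    ring
  have h2 : Integrable (fun τ : ℝ => ∫ v : ℝ, ((τ ^ (z - 1) : ℝ) : ℂ) *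
      hankelIntegrand α τ (v + hankelAngle α * Complex.I)) (volume.restrict (Ioi 0)) :=
    hint.integral_prod_left
  have h3 := congrArg Complex.im h1
  rw [← Complex.imCLM_apply, ← Complex.imCLM.integral_comp_comm h2] at h3
  have h4 : ∫ τ in Ioi (0 : ℝ), τ ^ (z - 1) * mainardi α τ = ∫ τ in Ioi (0 : ℝ), Real.pi⁻¹ *
      Complex.imCLM (∫ v : ℝ, ((τ ^ (z - 1) : ℝ) : ℂ) *
      hankelIntegrand α τ (v + hankelAngle α * Complex.I)) := by
    refine setIntegral_congr_fun measurableSet_Ioi fun τ hτ => ?_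
    rw [integral_const_mul, Complex.imCLM_apply, Complex.im_ofReal_mul,
      mainardi_eq hα (le_of_lt hτ)]
    ring
  rw [h4, integral_const_mul, h3, Complex.im_mul_ofReal, im_cexp_pi_mul_Gamma hp]
  have := Real.pi_ne_zero
  field_simp

/-- Fubini in the Hankel integral reaches only `0 < z < 1`, whereas the moments need `z = k + 1`.
Both sides are analytic for `Re z > 0`, the left by the decay of `Φ_α` and the right because `1/Γ`
is entire, so the identity theorem extends the equality. -/
theorem mellin_mainardi (hα : α ∈ Ioo (0 : ℝ) 1) {z : ℂ} (hz : 0 < z.re) :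
    mellin (fun τ => (mainardi α τ : ℂ)) z =
      Complex.Gamma z * (Complex.Gamma (1 - α * (1 - z)))⁻¹ := by
  set U : Set ℂ := {z | 0 < z.re} with hU
  have hUo : IsOpen U := isOpen_lt continuous_const Complex.continuous_re
  have hUc : IsPreconnected U := (convex_halfSpace_re_gt 0).isPreconnected
  obtain ⟨C, hC⟩ := exists_abs_mainardi_le hα 1
  have hloc : LocallyIntegrableOn (fun τ => (mainardi α τ : ℂ)) (Ioi 0) := by
    have := integrableOn_rpow_mul_mainardi hα (p := 0) (by norm_num) 0
    simp only [Real.rpow_zero, zero_mul, Real.exp_zero, one_mul] at this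
    have h : IntegrableOn (fun τ => (mainardi α τ : ℂ)) (Ioi 0) := this.ofReal
    exact h.locallyIntegrableOn
  have hM : DifferentiableOn ℂ (mellin fun τ => (mainardi α τ : ℂ)) U := by
    intro z hz
    refine (mellin_differentiableAt_of_isBigO_rpow_exp (a := 1) (b := 0) one_pos hloc ?_ ?_
      hz).differentiableWithinAt
    · refine Asymptotics.IsBigO.of_bound C ?_
      filter_upwards [eventually_ge_atTop 0] with τ hτ
      rw [Complex.norm_real, Real.norm_eq_abs, Real.norm_of_nonneg (Real.exp_pos _).le]
      exact hC τ hτ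
    · refine Asymptotics.IsBigO.of_bound C ?_
      filter_upwards [self_mem_nhdsWithin] with τ hτ
      have hτ0 : 0 < τ := hτ
      have h0 : 0 ≤ C := by
        have := (abs_nonneg _).trans (hC 0 le_rfl)
        simpa using this
      rw [Complex.norm_real, Real.norm_eq_abs, neg_zero, Real.rpow_zero, norm_one]
      refine (hC τ hτ0.le).trans (mul_le_mul_of_nonneg_left ?_ h0)
      exact Real.exp_le_one_iff.2 (by linarith)
  have hN : DifferentiableOn ℂ (fun z => Complex.Gamma z * (Complex.Gamma (1 - α * (1 - z)))⁻¹) U := by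
    intro z hz
    have h1 : DifferentiableAt ℂ Complex.Gamma z := by
      refine Complex.differentiableAt_Gamma z fun m hm => ?_
      have hz' : 0 < z.re := hz
      rw [hm] at hz'
      simp only [Complex.neg_re, Complex.natCast_re] at hz'
      linarith [m.cast_nonneg (α := ℝ)]
    have h2 : DifferentiableAt ℂ (fun z : ℂ => (Complex.Gamma (1 - α * (1 - z)))⁻¹) z :=
      (Complex.differentiable_one_div_Gamma.differentiableAt).comp z
        (show DifferentiableAt ℂ (fun z : ℂ => 1 - α * (1 - z)) z by fun_prop)
    exact (h1.mul h2).differentiableWithinAt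
  have hreal : ∀ x : ℝ, 0 < x → x < 1 → mellin (fun τ => (mainardi α τ : ℂ)) x =
      Complex.Gamma x * (Complex.Gamma (1 - α * (1 - x)))⁻¹ := by
    intro x hx0 hx1
    have h1 := congrArg (fun r : ℝ => (r : ℂ)) (integral_rpow_mul_mainardi_of_lt_one hα hx0 hx1)
    rw [← integral_complex_ofReal] at h1
    rw [mellin]
    have h2 : ∫ τ in Ioi (0 : ℝ), (τ : ℂ) ^ ((x : ℂ) - 1) • (mainardi α τ : ℂ) =
        ∫ τ in Ioi (0 : ℝ), ((τ ^ (x - 1) * mainardi α τ : ℝ) : ℂ) := by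
      refine setIntegral_congr_fun measurableSet_Ioi fun τ hτ => ?_
      simp only [smul_eq_mul]
      rw [Complex.ofReal_mul, Complex.ofReal_cpow (le_of_lt hτ)]
      push_cast; rfl
    rw [h2, h1]
    push_cast
    rw [← Complex.Gamma_ofReal, ← Complex.Gamma_ofReal]
    push_cast; rfl
  refine AnalyticOnNhd.eqOn_of_preconnected_of_frequently_eq (hM.analyticOnNhd hUo)
    (hN.analyticOnNhd hUo) hUc (z₀ := ((1 / 2 : ℝ) : ℂ)) (by simp [hU]) ?_ hz
  -- Real points `1/2 + 1/(4(n+1))` of `(0,1)` accumulate at `1/2` without reaching it.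
  have htend : Tendsto (fun n : ℕ => (((1 / 2 : ℝ) + (1 / 4) / ((n : ℝ) + 1) : ℝ) : ℂ)) atTop
      (𝓝[≠] ((1 / 2 : ℝ) : ℂ)) := by
    refine tendsto_nhdsWithin_iff.2 ⟨?_, Eventually.of_forall fun n => ?_⟩
    · have h1 : Tendsto (fun n : ℕ => (1 / 2 : ℝ) + (1 / 4) / ((n : ℝ) + 1)) atTop
          (𝓝 (1 / 2 + 0)) := by
        refine tendsto_const_nhds.add ?_
        have := (tendsto_one_div_add_atTop_nhds_zero_nat (𝕜 := ℝ)).const_mul (1 / 4)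
        simpa [div_eq_mul_inv] using this
      rw [add_zero] at h1
      exact (Complex.continuous_ofReal.tendsto _).comp h1
    · simp only [mem_compl_iff, mem_singleton_iff, Complex.ofReal_inj]
      have : (0 : ℝ) < (1 / 4) / ((n : ℝ) + 1) := by positivity
      linarith
  refine htend.frequently (Frequently.of_forall fun n => ?_)
  have h0 : (0 : ℝ) < (1 / 4) / ((n : ℝ) + 1) := by positivity
  have h1 : (1 / 4 : ℝ) / ((n : ℝ) + 1) ≤ 1 / 4 :=
    div_le_self (by norm_num) (by linarith [n.cast_nonneg (α := ℝ)])
  exact hreal _ (by linarith) (by linarith)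

theorem integral_pow_mul_mainardi (hα : α ∈ Ioo (0 : ℝ) 1) (k : ℕ) :
    ∫ τ in Ioi (0 : ℝ), τ ^ k * mainardi α τ = k.factorial / Real.Gamma (1 + α * k) := by
  have h := mellin_mainardi hα (z := (k : ℂ) + 1) (by simp; positivity)
  rw [mellin] at h
  have h2 : ∫ τ in Ioi (0 : ℝ), (τ : ℂ) ^ ((k : ℂ) + 1 - 1) • (mainardi α τ : ℂ) =
      ∫ τ in Ioi (0 : ℝ), ((τ ^ k * mainardi α τ : ℝ) : ℂ) := by
    refine setIntegral_congr_fun measurableSet_Ioi fun τ hτ => ?_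
    simp only [smul_eq_mul, add_sub_cancel_right, Complex.cpow_natCast]
    push_cast; rfl
  rw [h2, integral_complex_ofReal, Complex.Gamma_nat_eq_factorial] at h
  have e : (1 : ℂ) - α * (1 - (k + 1)) = ((1 + α * k : ℝ) : ℂ) := by push_cast; ring
  rw [e, Complex.Gamma_ofReal, ← div_eq_mul_inv] at h
  exact_mod_cast h

end MainardiMoments

/-! ### Mittag-Leffler functions as Laplace transforms of the Mainardi function. -/

section MittagLeffler

variable {α : ℝ}

/-- Laplace transform of `τ ^ n` times the Mainardi function. -/
noncomputable def mainardiMoment (α : ℝ) (n : ℕ) (x : ℝ) : ℝ :=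
  ∫ τ in Ioi (0 : ℝ), τ ^ n * mainardi α τ * Real.exp (-(x * τ))

theorem integrableOn_pow_mul_mainardi (hα : α ∈ Ioo (0 : ℝ) 1) (n : ℕ) (b : ℝ) :
    IntegrableOn (fun τ => τ ^ n * mainardi α τ * Real.exp (b * τ)) (Ioi 0) := by
  refine (integrableOn_rpow_mul_mainardi hα (p := n) (by linarith [n.cast_nonneg (α := ℝ)])
    b).congr_fun (fun τ _ => ?_) measurableSet_Ioi
  simp only [Real.rpow_natCast]
  ring

theorem integrableOn_pow_mul_mainardi' (hα : α ∈ Ioo (0 : ℝ) 1) (n : ℕ) :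
    IntegrableOn (fun τ => τ ^ n * mainardi α τ) (Ioi 0) := by
  simpa using integrableOn_pow_mul_mainardi hα n 0

/-- The bound is independent of `x ≥ 0`; with `x = λ t^α` it makes estimates uniform in the
eigenvalue. -/
theorem abs_mainardiMoment_le (hα : α ∈ Ioo (0 : ℝ) 1) (n : ℕ) {x : ℝ} (hx : 0 ≤ x) :
    |mainardiMoment α n x| ≤ ∫ τ in Ioi (0 : ℝ), τ ^ n * |mainardi α τ| := by
  have h := (integrableOn_pow_mul_mainardi' hα n).norm
  have e : ∀ τ ∈ Ioi (0 : ℝ), ‖τ ^ n * mainardi α τ‖ = τ ^ n * |mainardi α τ| := fun τ hτ => by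
    have : (0 : ℝ) < τ := hτ
    rw [norm_mul, Real.norm_of_nonneg (by positivity), Real.norm_eq_abs]
  rw [mainardiMoment, ← Real.norm_eq_abs, ← setIntegral_congr_fun measurableSet_Ioi e]
  refine norm_integral_le_of_norm_le h ?_
  filter_upwards [ae_restrict_mem measurableSet_Ioi] with τ hτ
  have hτ0 : (0 : ℝ) < τ := hτ
  rw [norm_mul _ (Real.exp _), Real.norm_of_nonneg (Real.exp_pos _).le]
  exact mul_le_of_le_one_right (norm_nonneg _) (Real.exp_le_one_iff.2 (by
    rw [neg_nonpos]; positivity))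

theorem hasDerivAt_mainardiMoment (hα : α ∈ Ioo (0 : ℝ) 1) (n : ℕ) (x : ℝ) :
    HasDerivAt (mainardiMoment α n) (-mainardiMoment α (n + 1) x) x := by
  have hm : ∀ (n : ℕ) (x : ℝ), AEStronglyMeasurable
      (fun τ => τ ^ n * mainardi α τ * Real.exp (-(x * τ))) (volume.restrict (Ioi 0)) := by
    intro n x
    have := (integrableOn_pow_mul_mainardi hα n (-x)).1
    simpa only [neg_mul] using this
  have hi : Integrable (fun τ => τ ^ n * mainardi α τ * Real.exp (-(x * τ)))
      (volume.restrict (Ioi (0 : ℝ))) := by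
    have h := integrableOn_pow_mul_mainardi hα n (-x)
    simp only [neg_mul] at h
    exact h
  have key := hasDerivAt_integral_of_dominated_loc_of_deriv_le (μ := volume.restrict (Ioi (0 : ℝ)))
    (F := fun x τ => τ ^ n * mainardi α τ * Real.exp (-(x * τ)))
    (F' := fun x τ => -(τ ^ (n + 1) * mainardi α τ * Real.exp (-(x * τ))))
    -- For `|y - x| < 1` one has `e^(-yτ) ≤ e^((1-x)τ)`. The sign of `x` is arbitrary, so
    -- integrability uses that `Φ_α` beats every exponential.
    (bound := fun τ => ‖τ ^ (n + 1) * mainardi α τ * Real.exp ((-x + 1) * τ)‖)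
    (Metric.ball_mem_nhds x one_pos) (Eventually.of_forall (hm n))
    hi
    (hm (n + 1) x).neg ?_ (integrableOn_pow_mul_mainardi hα (n + 1) (-x + 1)).norm ?_
  · have h := key.2
    rw [integral_neg] at h
    exact h
  · filter_upwards [ae_restrict_mem measurableSet_Ioi] with τ hτ y hy
    have hτ0 : (0 : ℝ) < τ := hτ
    have hy' := abs_lt.1 (by simpa [Real.dist_eq] using hy : |y - x| < 1)
    rw [norm_neg, norm_mul, norm_mul _ (Real.exp _), Real.norm_of_nonneg (Real.exp_pos _).le,
      Real.norm_of_nonneg (Real.exp_pos _).le]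
    gcongr
    nlinarith [hy'.1]
  · refine Eventually.of_forall fun τ y _ => ?_
    have h1 : HasDerivAt (fun y : ℝ => Real.exp (-(y * τ))) (Real.exp (-(y * τ)) * -(1 * τ)) y :=
      (((hasDerivAt_id y).mul_const τ).neg).exp
    refine (h1.const_mul (τ ^ n * mainardi α τ)).congr_deriv ?_
    ring

theorem continuous_mainardiMoment (hα : α ∈ Ioo (0 : ℝ) 1) (n : ℕ) :
    Continuous (mainardiMoment α n) :=
  continuous_iff_continuousAt.2 fun x => (hasDerivAt_mainardiMoment hα n x).continuousAt

/-- Expand `e^(-xτ)` and insert the moments; the exponentially weighted integral of `|Φ_α|`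
justifies the exchange. -/
theorem hasSum_mainardiMoment (hα : α ∈ Ioo (0 : ℝ) 1) (n : ℕ) (x : ℝ) :
    HasSum (fun k : ℕ => (-x) ^ k / k.factorial *
      ((k + n).factorial / Real.Gamma (1 + α * (k + n : ℕ)))) (mainardiMoment α n x) := by
  let F : ℕ → ℝ → ℝ := fun k τ => τ ^ n * mainardi α τ * ((-(x * τ)) ^ k / k.factorial)
  have hexp : ∀ y : ℝ, HasSum (fun k : ℕ => y ^ k / k.factorial) (Real.exp y) := by
    intro y
    have := NormedSpace.expSeries_div_hasSum_exp y
    rwa [← Real.exp_eq_exp_ℝ] at this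
  have key := hasSum_integral_of_dominated_convergence (μ := volume.restrict (Ioi (0 : ℝ))) (F := F)
    (f := fun τ => τ ^ n * mainardi α τ * Real.exp (-(x * τ)))
    (fun k τ => ‖τ ^ n * mainardi α τ‖ * ((|x| * |τ|) ^ k / k.factorial))
    (fun k => ((integrableOn_pow_mul_mainardi' hα n).1).mul
      (by fun_prop : Continuous fun τ : ℝ => (-(x * τ)) ^ k / k.factorial).aestronglyMeasurable)
    (fun k => Eventually.of_forall fun τ => by
      simp only [F]
      rw [norm_mul _ (_ / _), norm_div, norm_pow, norm_neg, norm_mul x, Real.norm_natCast,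
        Real.norm_eq_abs x, Real.norm_eq_abs τ])
    (Eventually.of_forall fun τ => ((hexp _).mul_left _).summable) ?_
    (Eventually.of_forall fun τ => (hexp _).mul_left _)
  · refine key.congr_fun fun k => ?_
    simp only [F]
    have e : ∀ τ : ℝ, τ ^ n * mainardi α τ * ((-(x * τ)) ^ k / k.factorial) =
        ((-x) ^ k / k.factorial) * (τ ^ (k + n) * mainardi α τ) := by
      intro τ
      rw [← neg_mul, mul_pow, pow_add]; ring
    simp only [e]
    rw [integral_const_mul, integral_pow_mul_mainardi hα]
  · simp_rw [fun τ : ℝ => ((hexp (|x| * |τ|)).mul_left ‖τ ^ n * mainardi α τ‖).tsum_eq]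
    refine (integrableOn_pow_mul_mainardi hα n |x|).norm.congr ?_
    filter_upwards [ae_restrict_mem measurableSet_Ioi] with τ hτ
    rw [norm_mul _ (Real.exp _), Real.norm_of_nonneg (Real.exp_pos _).le, abs_of_pos (mem_Ioi.1 hτ)]

theorem hasSum_mittagLeffler_one (hα : α ∈ Ioo (0 : ℝ) 1) (x : ℝ) :
    HasSum (fun k : ℕ => (-x) ^ k / Real.Gamma (α * k + 1)) (mainardiMoment α 0 x) := by
  refine (hasSum_mainardiMoment hα 0 x).congr_fun fun k => ?_
  have : (k.factorial : ℝ) ≠ 0 := by positivity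
  rw [add_zero, add_comm (α * (k : ℝ))]
  field_simp

theorem hasSum_mittagLeffler_self (hα : α ∈ Ioo (0 : ℝ) 1) (x : ℝ) :
    HasSum (fun k : ℕ => (-x) ^ k / Real.Gamma (α * k + α)) (α * mainardiMoment α 1 x) := by
  refine ((hasSum_mainardiMoment hα 1 x).mul_left α).congr_fun fun k => ?_
  have h1 : (k.factorial : ℝ) ≠ 0 := by positivity
  have h2 : α * k + α ≠ 0 := by have := hα.1; positivity
  have h3 : Real.Gamma (α * k + α) ≠ 0 :=
    (Real.Gamma_pos_of_pos (by have := hα.1; positivity)).ne'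
  rw [Nat.factorial_succ, show 1 + α * ((k + 1 : ℕ) : ℝ) = (α * k + α) + 1 by push_cast; ring,
    Real.Gamma_add_one h2]
  push_cast
  have h4 := hα.1.ne'
  have h5 : (k : ℝ) + 1 ≠ 0 := by positivity
  have e : α * k + α = α * (k + 1) := by ring
  rw [e] at h2 h3 ⊢
  field_simp

theorem mittagLeffler_one_eq (hα : α ∈ Ioo (0 : ℝ) 1) (x : ℝ) :
    mittagLeffler α 1 (-x) = mainardiMoment α 0 x :=
  (hasSum_mittagLeffler_one hα x).tsum_eq

theorem mittagLeffler_self_eq (hα : α ∈ Ioo (0 : ℝ) 1) (x : ℝ) :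
    mittagLeffler α α (-x) = α * mainardiMoment α 1 x :=
  (hasSum_mittagLeffler_self hα x).tsum_eq

theorem mainardiMoment_zero_zero (hα : α ∈ Ioo (0 : ℝ) 1) : mainardiMoment α 0 0 = 1 := by
  refine (hasSum_mittagLeffler_one hα 0).unique ?_
  have := hasSum_single (f := fun k : ℕ => (-(0 : ℝ)) ^ k / Real.Gamma (α * k + 1)) 0
    (fun k hk => by simp [hk])
  simpa using this

end MittagLeffler

/-! ### Beta integrals on `[0,t]`. -/

section Beta

theorem integral_rpow_mul_sub_rpow {p q t : ℝ} (hp : 0 < p) (hq : 0 < q) (ht : 0 < t) :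
    ∫ r in (0 : ℝ)..t, (t - r) ^ (q - 1) * r ^ (p - 1) =
      t ^ (p + q - 1) * ProbabilityTheory.beta p q := by
  have h := Complex.betaIntegral_scaled (p : ℂ) (q : ℂ) ht
  have h1 : ∫ x in (0 : ℝ)..t, (x : ℂ) ^ ((p : ℂ) - 1) * ((t : ℂ) - x) ^ ((q : ℂ) - 1) =
      ∫ x in (0 : ℝ)..t, (((t - x) ^ (q - 1) * x ^ (p - 1) : ℝ) : ℂ) := by
    refine intervalIntegral.integral_congr fun x hx => ?_
    rw [uIcc_of_le ht.le] at hx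
    rw [Complex.ofReal_mul, Complex.ofReal_cpow hx.1, Complex.ofReal_cpow (sub_nonneg.2 hx.2)]
    push_cast
    ring
  rw [h1, intervalIntegral.integral_ofReal, Complex.betaIntegral_eq_Gamma_mul_div _ _ (by simpa)
    (by simpa)] at h
  have h2 : (t : ℂ) ^ ((p : ℂ) + q - 1) = ((t ^ (p + q - 1) : ℝ) : ℂ) := by
    rw [Complex.ofReal_cpow ht.le]; push_cast; rfl
  rw [h2, ← Complex.ofReal_add, Complex.Gamma_ofReal, Complex.Gamma_ofReal, Complex.Gamma_ofReal] at h
  exact_mod_cast h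

/-- The integral of a non-integrable function is `0` by default, which the positive value just
computed excludes. -/
theorem intervalIntegrable_rpow_mul_sub_rpow {p q t : ℝ} (hp : 0 < p) (hq : 0 < q) (ht : 0 < t) :
    IntervalIntegrable (fun r => (t - r) ^ (q - 1) * r ^ (p - 1)) volume 0 t := by
  by_contra h
  have h1 := integral_rpow_mul_sub_rpow hp hq ht
  rw [intervalIntegral.integral_undef h] at h1
  have := ProbabilityTheory.beta_pos hp hq
  have : 0 < t ^ (p + q - 1) * ProbabilityTheory.beta p q := by positivity
  linarith

end Beta

/-! ### The scalar relaxation function and its resolvent kernel. -/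

section Relaxation

variable {α l : ℝ}

/-- The relaxation function `E_{α,1}(-l t^α)`. -/
noncomputable def relaxation (α l t : ℝ) : ℝ := mittagLeffler α 1 (-(l * t ^ α))

theorem relaxation_eq (hα : α ∈ Ioo (0 : ℝ) 1) (t : ℝ) :
    relaxation α l t = mainardiMoment α 0 (l * t ^ α) := mittagLeffler_one_eq hα _

theorem scalarP_eq (hα : α ∈ Ioo (0 : ℝ) 1) (t : ℝ) :
    scalarP α l t = t ^ (α - 1) * (α * mainardiMoment α 1 (l * t ^ α)) := by
  rw [scalarP, mittagLeffler_self_eq hα]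

theorem relaxation_zero (hα : α ∈ Ioo (0 : ℝ) 1) : relaxation α l 0 = 1 := by
  rw [relaxation_eq hα, Real.zero_rpow hα.1.ne', mul_zero, mainardiMoment_zero_zero hα]

theorem continuous_relaxation (hα : α ∈ Ioo (0 : ℝ) 1) : Continuous (relaxation α l) := by
  simp_rw [funext fun t => relaxation_eq (l := l) hα t]
  exact (continuous_mainardiMoment hα 0).comp
    (continuous_const.mul (Real.continuous_rpow_const hα.1.le))

theorem measurable_scalarP (hα : α ∈ Ioo (0 : ℝ) 1) : Measurable (scalarP α l) := by
  simp_rw [funext fun t => scalarP_eq (l := l) hα t]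
  exact (measurable_id.pow_const _).mul (((continuous_mainardiMoment hα 1).comp
    (continuous_const.mul (Real.continuous_rpow_const hα.1.le))).measurable.const_mul α)

theorem continuousOn_scalarP (hα : α ∈ Ioo (0 : ℝ) 1) : ContinuousOn (scalarP α l) (Ioi 0) := by
  simp_rw [funext fun t => scalarP_eq (l := l) hα t]
  refine ContinuousOn.mul (fun t ht => ?_) (Continuous.continuousOn ?_)
  · exact (Real.continuousAt_rpow_const _ _ (Or.inl (ne_of_gt ht))).continuousWithinAt
  · exact continuous_const.mul ((continuous_mainardiMoment hα 1).comp
      (continuous_const.mul (Real.continuous_rpow_const hα.1.le)))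

theorem exists_abs_scalarP_le (hα : α ∈ Ioo (0 : ℝ) 1) :
    ∃ C : ℝ, 0 ≤ C ∧ ∀ l t : ℝ, 0 ≤ l → 0 ≤ t → |scalarP α l t| ≤ C * t ^ (α - 1) := by
  have hα0 := hα.1
  refine ⟨α * ∫ τ in Ioi (0 : ℝ), τ ^ 1 * |mainardi α τ|, ?_, fun l t hl ht => ?_⟩
  · exact mul_nonneg hα.1.le (setIntegral_nonneg measurableSet_Ioi fun τ hτ => by
      have : (0 : ℝ) < τ := hτ
      positivity)
  · rw [scalarP_eq hα, abs_mul, abs_mul, abs_of_pos hα.1, abs_of_nonneg (by positivity), mul_comm]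
    gcongr
    exact abs_mainardiMoment_le hα 1 (by positivity)

theorem hasDerivAt_relaxation (hα : α ∈ Ioo (0 : ℝ) 1) {t : ℝ} (ht : 0 < t) :
    HasDerivAt (relaxation α l) (-(l * scalarP α l t)) t := by
  have h1 : HasDerivAt (fun t : ℝ => l * t ^ α) (l * (α * t ^ (α - 1))) t :=
    (Real.hasDerivAt_rpow_const (Or.inl ht.ne')).const_mul l
  have h2 := (hasDerivAt_mainardiMoment hα 0 (l * t ^ α)).comp t h1
  have e : relaxation α l = mainardiMoment α 0 ∘ fun t => l * t ^ α :=
    funext fun t => relaxation_eq hα t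
  rw [e]
  refine h2.congr_deriv ?_
  rw [scalarP_eq hα]; ring

/-- The identity `P * k = E`: integrated termwise, the power `r^(αk+α-1)` becomes by the beta
integral a multiple of `t^(αk)`, with `Γ(αk+α)` replaced by `Γ(αk+1)`. -/
theorem rlIntegral_scalarP (hα : α ∈ Ioo (0 : ℝ) 1) (hl : 0 ≤ l) {t : ℝ} (ht : 0 < t) :
    rlIntegral (1 - α) (scalarP α l) t = relaxation α l t := by
  have hα0 := hα.1
  have hα1 : 0 < 1 - α := by linarith [hα.2]
  have hG := Real.Gamma_pos_of_pos hα1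
  let F : ℕ → ℝ → ℝ := fun k r => (t - r) ^ ((1 - α) - 1) * (r ^ (α - 1) *
    ((-(l * r ^ α)) ^ k / Real.Gamma (α * k + α)))
  let b : ℕ → ℝ → ℝ := fun k r => (t - r) ^ ((1 - α) - 1) * r ^ (α - 1) *
    ((l * t ^ α) ^ k / Real.Gamma (α * k + α))
  -- The majorant is the same series at `+l t^α`, where all terms are nonnegative.
  have hb : HasSum (fun k : ℕ => (l * t ^ α) ^ k / Real.Gamma (α * k + α))
      (α * mainardiMoment α 1 (-(l * t ^ α))) := by
    simpa using hasSum_mittagLeffler_self hα (-(l * t ^ α))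
  have hGk : ∀ k : ℕ, 0 < Real.Gamma (α * k + α) := fun k =>
    Real.Gamma_pos_of_pos (by positivity)
  have hI := intervalIntegrable_rpow_mul_sub_rpow hα0 hα1 ht
  have key := intervalIntegral.hasSum_integral_of_dominated_convergence (μ := volume)
    (a := 0) (b := t) (F := F)
    (f := fun r => (t - r) ^ ((1 - α) - 1) • scalarP α l r) b ?_ ?_ ?_ ?_ ?_
  · have h1 := key.mul_left (Real.Gamma (1 - α))⁻¹
    rw [rlIntegral, smul_eq_mul, relaxation_eq hα]
    refine h1.unique ((hasSum_mittagLeffler_one hα (l * t ^ α)).congr_fun fun k => ?_)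
    have e : ∀ r ∈ Ioc (0 : ℝ) t, F k r = ((-l) ^ k / Real.Gamma (α * k + α)) *
        ((t - r) ^ ((1 - α) - 1) * r ^ ((α * k + α) - 1)) := by
      intro r hr
      simp only [F]
      rw [show (α * k + α) - 1 = (α - 1) + α * k by ring, Real.rpow_add hr.1, Real.rpow_mul hr.1.le,
        Real.rpow_natCast, ← neg_mul, mul_pow]
      ring
    rw [intervalIntegral.integral_of_le ht.le, setIntegral_congr_fun measurableSet_Ioc e,
      ← intervalIntegral.integral_of_le ht.le, intervalIntegral.integral_const_mul,
      integral_rpow_mul_sub_rpow (by positivity) hα1 ht, ProbabilityTheory.beta,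
      show α * k + α + (1 - α) - 1 = α * k by ring, show α * k + α + (1 - α) = α * k + 1 by ring,
      Real.rpow_mul ht.le, Real.rpow_natCast, ← neg_mul, mul_pow]
    have := (hGk k).ne'
    have := hG.ne'
    field_simp
  · intro k
    have : Measurable (F k) := by
      refine ((measurable_const.sub measurable_id).pow_const _).mul
        ((measurable_id.pow_const _).mul ((((measurable_id.pow_const _).const_mul l).neg.pow_const
          k).div_const _))
    exact this.aestronglyMeasurable
  · intro k
    refine Eventually.of_forall fun r hr => ?_
    rw [uIoc_of_le ht.le] at hr
    have h0 : 0 ≤ t - r := sub_nonneg.2 hr.2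
    have hr0 := hr.1
    have hle : r ^ α ≤ t ^ α := Real.rpow_le_rpow hr0.le hr.2 hα0.le
    simp only [F, b]
    rw [norm_mul, norm_mul, norm_div, norm_pow, norm_neg, Real.norm_of_nonneg (by positivity),
      Real.norm_of_nonneg (by positivity), Real.norm_of_nonneg (by positivity),
      Real.norm_of_nonneg (hGk k).le, mul_assoc]
    have := hGk k
    gcongr
  · exact Eventually.of_forall fun r _ => hb.summable.mul_left _
  · simp only [b]
    simp_rw [tsum_mul_left]
    exact hI.mul_const _
  · refine Eventually.of_forall fun r _ => ?_
    simp only [F, smul_eq_mul]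
    rw [scalarP_eq hα]
    exact ((hasSum_mittagLeffler_self hα (l * r ^ α)).mul_left _).mul_left _

end Relaxation

/-! ### Convolution on the half-line -/

section Convolution

/-- The convolution `∫₀ᵗ a(t-τ) g(τ) dτ` of functions on the half-line. -/
noncomputable def conv (a g : ℝ → ℝ) (t : ℝ) : ℝ := ∫ τ in (0 : ℝ)..t, a (t - τ) * g τ

variable {a b g : ℝ → ℝ} {p q C D t : ℝ}

theorem conv_comm (a b : ℝ → ℝ) (t : ℝ) : conv a b t = conv b a t := by
  have h := intervalIntegral.integral_comp_sub_left (fun r => a (t - r) * b r) t (a := 0) (b := t)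
  simp only [sub_zero, sub_self, sub_sub_cancel] at h
  rw [conv, conv, ← h]
  simp_rw [mul_comm (a _)]

theorem conv_one_left (g : ℝ → ℝ) (t : ℝ) : conv (fun _ => 1) g t = ∫ τ in (0 : ℝ)..t, g τ := by
  simp [conv]

/-- On the triangle `0 < σ < τ < t` the majorant integrates in `τ` to a multiple of `(t-σ)^(p+q-1)
|g σ|`, and `p + q ≥ 1` keeps that power bounded. -/
theorem integrable_mul_comp_sub (hp : 0 < p) (hq : 0 < q) (hpq : 1 ≤ p + q) (ht : 0 < t)
    (ha : Measurable a) (hb : Measurable b)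
    (hA : ∀ r ∈ Ioo 0 t, |a r| ≤ C * r ^ (p - 1)) (hB : ∀ r ∈ Ioo 0 t, |b r| ≤ D * r ^ (q - 1))
    (hg : IntervalIntegrable g volume 0 t) :
    Integrable (fun z : ℝ × ℝ => (Ioi z.2).indicator (fun τ => a (t - τ) * b (τ - z.2) * g z.2) z.1)
      ((volume.restrict (Ioo 0 t)).prod (volume.restrict (Ioo 0 t))) := by
  have hg' : IntegrableOn g (Ioo 0 t) :=
    ((intervalIntegrable_iff_integrableOn_Ioo_of_le ht.le).1 hg)
  have hind : ∀ f : ℝ × ℝ → ℝ, (fun z : ℝ × ℝ => (Ioi z.2).indicator (fun τ => f (τ, z.2)) z.1) =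
      {z : ℝ × ℝ | z.2 < z.1}.indicator f := by
    intro f
    ext z
    by_cases h : z.2 < z.1
    · rw [indicator_of_mem (show z.1 ∈ Ioi z.2 from h), indicator_of_mem (by exact h)]
    · rw [indicator_of_notMem (show z.1 ∉ Ioi z.2 from h), indicator_of_notMem (by exact h)]
  have hset : MeasurableSet {z : ℝ × ℝ | z.2 < z.1} := measurableSet_lt measurable_snd measurable_fst
  have hm : ∀ a b : ℝ → ℝ, Measurable a → Measurable b → ∀ g : ℝ → ℝ, IntegrableOn g (Ioo 0 t) →
      AEStronglyMeasurable (fun z : ℝ × ℝ =>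
        (Ioi z.2).indicator (fun τ => a (t - τ) * b (τ - z.2) * g z.2) z.1)
      ((volume.restrict (Ioo 0 t)).prod (volume.restrict (Ioo 0 t))) := by
    intro a b ha hb g hg
    rw [hind fun z => a (t - z.1) * b (z.1 - z.2) * g z.2]
    refine AEStronglyMeasurable.indicator ?_ hset
    refine AEStronglyMeasurable.mul (Measurable.aestronglyMeasurable ?_)
      hg.aestronglyMeasurable.comp_snd
    exact (ha.comp (measurable_const.sub measurable_fst)).mul
      (hb.comp (measurable_fst.sub measurable_snd))
  have hG : Integrable (fun z : ℝ × ℝ => (Ioi z.2).indicator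
      (fun τ => (t - τ) ^ (p - 1) * (τ - z.2) ^ (q - 1) * (C * D * |g z.2|)) z.1)
      ((volume.restrict (Ioo 0 t)).prod (volume.restrict (Ioo 0 t))) := by
    have hbeta : ∀ σ ∈ Ioo 0 t, IntervalIntegrable (fun τ => (t - τ) ^ (p - 1) * (τ - σ) ^ (q - 1))
        volume σ t ∧ ∫ τ in σ..t, (t - τ) ^ (p - 1) * (τ - σ) ^ (q - 1) =
          (t - σ) ^ (q + p - 1) * ProbabilityTheory.beta q p := by
      intro σ hσ
      have h0 : 0 < t - σ := sub_pos.2 hσ.2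
      constructor
      · have := (intervalIntegrable_rpow_mul_sub_rpow hq hp h0).comp_sub_right σ
        simpa only [zero_add, sub_add_cancel, sub_sub, add_sub_cancel] using this
      · rw [← integral_rpow_mul_sub_rpow hq hp h0]
        have := intervalIntegral.integral_comp_sub_right (a := σ) (b := t)
          (fun r => (t - σ - r) ^ (p - 1) * r ^ (q - 1)) σ
        simpa only [sub_self, sub_sub, add_sub_cancel] using this
    have hslice : ∀ σ ∈ Ioo 0 t, (volume.restrict (Ioo 0 t)).restrict (Ioi σ) =
        volume.restrict (Ioo σ t) := by
      intro σ hσ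
      rw [Measure.restrict_restrict measurableSet_Ioi]
      congr 1
      ext r
      simp only [mem_inter_iff, mem_Ioi, mem_Ioo]
      exact ⟨fun h => ⟨h.1, h.2.2⟩, fun h => ⟨h.1, hσ.1.trans h.1, h.2⟩⟩
    refine (integrable_prod_iff' ?_).2 ⟨?_, ?_⟩
    · exact hm (fun r => r ^ (p - 1)) (fun r => r ^ (q - 1)) (by fun_prop) (by fun_prop)
        (fun σ => C * D * |g σ|) (hg'.abs.const_mul _)
    · filter_upwards [ae_restrict_mem measurableSet_Ioo] with σ hσ
      rw [integrable_indicator_iff measurableSet_Ioi, IntegrableOn, hslice σ hσ]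
      exact ((intervalIntegrable_iff_integrableOn_Ioo_of_le hσ.2.le).1 (hbeta σ hσ).1).mul_const _
    · have h1 : Integrable (fun σ => (t - σ) ^ (q + p - 1) * ProbabilityTheory.beta q p *
          abs (C * D * |g σ|)) (volume.restrict (Ioo 0 t)) := by
        have hc : IntervalIntegrable (fun σ => ((t - σ) ^ (q + p - 1) *
            ProbabilityTheory.beta q p) * abs (C * D * |g σ|)) volume 0 t := by
          refine IntervalIntegrable.continuousOn_mul ((hg.abs.const_mul _).abs) ?_
          refine Continuous.continuousOn ?_
          exact ((continuous_const.sub continuous_id).rpow_const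
            fun _ => Or.inr (by linarith)).mul continuous_const
        exact (intervalIntegrable_iff_integrableOn_Ioo_of_le ht.le).1 hc
      refine h1.congr ?_
      filter_upwards [ae_restrict_mem measurableSet_Ioo] with σ hσ
      simp_rw [norm_indicator_eq_indicator_norm]
      rw [integral_indicator measurableSet_Ioi, hslice σ hσ, ← (hbeta σ hσ).2,
        intervalIntegral.integral_of_le hσ.2.le, integral_Ioc_eq_integral_Ioo,
        ← integral_mul_const]
      refine setIntegral_congr_fun measurableSet_Ioo fun τ hτ => ?_
      have h1 := hτ.1
      have h2 := hτ.2
      have h3 : 0 ≤ (t - τ) ^ (p - 1) := Real.rpow_nonneg (by linarith) _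
      have h4 : 0 ≤ (τ - σ) ^ (q - 1) := Real.rpow_nonneg (by linarith) _
      simp only [Real.norm_eq_abs, abs_mul, abs_of_nonneg h3, abs_of_nonneg h4, abs_abs]
  refine hG.mono' (hm a b ha hb g hg') ?_
  have hmem : ∀ᵐ z ∂((volume.restrict (Ioo 0 t)).prod (volume.restrict (Ioo 0 t))),
      z ∈ Ioo 0 t ×ˢ Ioo 0 t := by
    rw [Measure.prod_restrict]
    exact ae_restrict_mem (measurableSet_Ioo.prod measurableSet_Ioo)
  filter_upwards [hmem] with z hz
  by_cases h : z.1 ∈ Ioi z.2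
  · rw [indicator_of_mem h, indicator_of_mem h]
    have h : z.2 < z.1 := h
    have h1 := hz.1.1
    have h2 := hz.1.2
    have h3 := hz.2.1
    have e1 := hA (t - z.1) ⟨by linarith, by linarith⟩
    have e2 := hB (z.1 - z.2) ⟨by linarith, by linarith⟩
    rw [Real.norm_eq_abs, abs_mul, abs_mul]
    calc |a (t - z.1)| * |b (z.1 - z.2)| * |g z.2|
        ≤ (C * (t - z.1) ^ (p - 1)) * (D * (z.1 - z.2) ^ (q - 1)) * |g z.2| := by
          have := (abs_nonneg _).trans e1
          gcongr
      _ = _ := by ring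
  · rw [indicator_of_notMem h, indicator_of_notMem h, norm_zero]

/-- Fubini on the triangle `0 < σ < τ < t`. Local power bounds on the kernels suffice because only
their values on `(0,t)` enter. -/
theorem conv_assoc (hp : 0 < p) (hq : 0 < q) (hpq : 1 ≤ p + q) (ht : 0 < t)
    (ha : Measurable a) (hb : Measurable b)
    (hA : ∀ r ∈ Ioo 0 t, |a r| ≤ C * r ^ (p - 1)) (hB : ∀ r ∈ Ioo 0 t, |b r| ≤ D * r ^ (q - 1))
    (hg : IntervalIntegrable g volume 0 t) :
    IntervalIntegrable (fun τ => a (t - τ) * conv b g τ) volume 0 t ∧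
    IntervalIntegrable (fun σ => conv a b (t - σ) * g σ) volume 0 t ∧
    conv a (conv b g) t = conv (conv a b) g t := by
  have hF := integrable_mul_comp_sub hp hq hpq ht ha hb hA hB hg
  have hl : ∀ τ ∈ Ioo 0 t, ∫ σ in Ioo 0 t,
      (Ioi σ).indicator (fun τ => a (t - τ) * b (τ - σ) * g σ) τ = a (t - τ) * conv b g τ := by
    intro τ hτ
    have e : (fun σ => (Ioi σ).indicator (fun τ => a (t - τ) * b (τ - σ) * g σ) τ) =
        (Iio τ).indicator (fun σ => a (t - τ) * (b (τ - σ) * g σ)) := by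
      ext σ
      by_cases h : σ < τ
      · rw [indicator_of_mem (show τ ∈ Ioi σ from h), indicator_of_mem (show σ ∈ Iio τ from h),
          mul_assoc]
      · rw [indicator_of_notMem (show τ ∉ Ioi σ from h),
          indicator_of_notMem (show σ ∉ Iio τ from h)]
    have hs : Iio τ ∩ Ioo 0 t = Ioo 0 τ := by
      ext r
      simp only [mem_inter_iff, mem_Iio, mem_Ioo]
      exact ⟨fun h => ⟨h.2.1, h.1⟩, fun h => ⟨h.2, h.1, h.2.trans hτ.2⟩⟩
    rw [e, integral_indicator measurableSet_Iio, Measure.restrict_restrict measurableSet_Iio, hs,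
      integral_const_mul, conv, intervalIntegral.integral_of_le hτ.1.le,
      integral_Ioc_eq_integral_Ioo]
  have hr : ∀ σ ∈ Ioo 0 t, ∫ τ in Ioo 0 t,
      (Ioi σ).indicator (fun τ => a (t - τ) * b (τ - σ) * g σ) τ = conv a b (t - σ) * g σ := by
    intro σ hσ
    have hs : Ioi σ ∩ Ioo 0 t = Ioo σ t := by
      ext r
      simp only [mem_inter_iff, mem_Ioi, mem_Ioo]
      exact ⟨fun h => ⟨h.1, h.2.2⟩, fun h => ⟨h.1, hσ.1.trans h.1, h.2⟩⟩
    have h1 := intervalIntegral.integral_comp_sub_right (a := σ) (b := t)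
      (fun r => a (t - σ - r) * b r) σ
    simp only [sub_self, sub_sub, add_sub_cancel] at h1
    simp only [conv, sub_sub]
    rw [← h1, integral_indicator measurableSet_Ioi, Measure.restrict_restrict measurableSet_Ioi,
      hs, integral_mul_const, intervalIntegral.integral_of_le hσ.2.le,
      integral_Ioc_eq_integral_Ioo]
  refine ⟨?_, ?_, ?_⟩
  · rw [intervalIntegrable_iff_integrableOn_Ioo_of_le ht.le]
    exact hF.integral_prod_left.congr
      ((ae_restrict_iff' measurableSet_Ioo).2 (Eventually.of_forall hl))
  · rw [intervalIntegrable_iff_integrableOn_Ioo_of_le ht.le]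
    exact hF.integral_prod_right.congr
      ((ae_restrict_iff' measurableSet_Ioo).2 (Eventually.of_forall hr))
  · have h := integral_integral_swap (f := fun τ σ =>
      (Ioi σ).indicator (fun τ => a (t - τ) * b (τ - σ) * g σ) τ) hF
    rw [setIntegral_congr_fun measurableSet_Ioo hl, setIntegral_congr_fun measurableSet_Ioo hr] at h
    rw [conv, conv, intervalIntegral.integral_of_le ht.le, intervalIntegral.integral_of_le ht.le,
      integral_Ioc_eq_integral_Ioo, integral_Ioc_eq_integral_Ioo, h]

theorem conv_congr {a' g' : ℝ → ℝ} (ht : 0 ≤ t) (ha : ∀ r ∈ Ioo 0 t, a r = a' r)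
    (hg : ∀ r ∈ Ioo 0 t, g r = g' r) : conv a g t = conv a' g' t := by
  rw [conv, conv, intervalIntegral.integral_of_le ht, intervalIntegral.integral_of_le ht,
    integral_Ioc_eq_integral_Ioo, integral_Ioc_eq_integral_Ioo]
  refine setIntegral_congr_fun measurableSet_Ioo fun τ hτ => ?_
  simp only [hg τ hτ, ha (t - τ) ⟨by linarith [hτ.2], by linarith [hτ.1]⟩]

end Convolution


/-! ### Continuity of weakly singular Volterra integrals. -/

section VolterraContinuity

variable {E F : Type*} [NormedAddCommGroup E] [NormedAddCommGroup F] [NormedSpace ℝ F]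

theorem intervalIntegrable_rpow_sub {p : ℝ} (hp : 0 < p) (t : ℝ) :
    IntervalIntegrable (fun τ => (t - τ) ^ (p - 1)) volume 0 t := by
  have := (intervalIntegral.intervalIntegrable_rpow' (a := 0) (b := t)
    (show -1 < p - 1 by linarith)).comp_sub_left t
  simp only [sub_zero, sub_self] at this
  exact this.symm

theorem intervalIntegrable_rpow_smul_comp_sub {A : ℝ → E → F}
    (hA : Continuous (Function.uncurry A)) {g : ℝ → E} (hg : Continuous g) {p : ℝ} (hp : 0 < p)
    (t : ℝ) : IntervalIntegrable (fun τ => (t - τ) ^ (p - 1) • A (t - τ) (g τ)) volume 0 t :=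
  (intervalIntegrable_rpow_sub hp t).smul_continuousOn
    (hA.comp ((continuous_const.sub continuous_id).prodMk hg)).continuousOn

/-- Volterra operators with a weakly singular kernel map continuous functions to continuous
functions. -/
theorem continuousOn_integral_rpow_smul_comp_sub {A : ℝ → E → F}
    (hA : Continuous (Function.uncurry A)) {g : ℝ → E} (hg : Continuous g) {p : ℝ} (hp : 0 < p) :
    ContinuousOn (fun t => ∫ τ in (0 : ℝ)..t, (t - τ) ^ (p - 1) • A (t - τ) (g τ)) (Ici 0) := by
  have hB : Continuous fun z : ℝ × ℝ => A (z.1 * (1 - z.2)) (g (z.1 * z.2)) :=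
    hA.comp ((continuous_fst.mul (continuous_const.sub continuous_snd)).prodMk
      (hg.comp (continuous_fst.mul continuous_snd)))
  -- The substitution `τ = t ρ` moves the singularity to the fixed point `ρ = 1`, leaving a factor
  -- `t^p` and an integrand dominated uniformly near `t₀`.
  have hc : Continuous fun t : ℝ => t ^ p • ∫ ρ in (0 : ℝ)..1,
      (1 - ρ) ^ (p - 1) • A (t * (1 - ρ)) (g (t * ρ)) := by
    refine (Real.continuous_rpow_const hp.le).smul (continuous_iff_continuousAt.2 fun t₀ => ?_)
    obtain ⟨K, hK⟩ := ((isCompact_Icc (a := t₀ - 1) (b := t₀ + 1)).prod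
      (isCompact_Icc (a := (0 : ℝ)) (b := 1))).exists_bound_of_continuousOn hB.continuousOn
    refine intervalIntegral.continuousAt_of_dominated_interval
      (bound := fun ρ => (1 - ρ) ^ (p - 1) * K) ?_ ?_ ?_ ?_
    · refine Eventually.of_forall fun t => ?_
      exact ((intervalIntegrable_rpow_sub hp 1).smul_continuousOn
        (hB.comp (Continuous.prodMk_right t)).continuousOn).def'.aestronglyMeasurable
    · filter_upwards [Icc_mem_nhds (show t₀ - 1 < t₀ by linarith)
        (show t₀ < t₀ + 1 by linarith)] with t ht
      refine Eventually.of_forall fun ρ hρ => ?_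
      rw [uIoc_of_le zero_le_one] at hρ
      have h1 : 0 ≤ (1 - ρ) ^ (p - 1) := Real.rpow_nonneg (by linarith [hρ.2]) _
      rw [norm_smul, Real.norm_of_nonneg h1]
      exact mul_le_mul_of_nonneg_left (hK (t, ρ) ⟨ht, hρ.1.le, hρ.2⟩) h1
    · exact (intervalIntegrable_rpow_sub hp 1).mul_const K
    · exact Eventually.of_forall fun ρ _ =>
        ((hB.comp (Continuous.prodMk_left ρ)).const_smul ((1 - ρ) ^ (p - 1))).continuousAt
  refine hc.continuousOn.congr fun t ht => ?_
  have ht : 0 ≤ t := ht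
  have h := intervalIntegral.smul_integral_comp_mul_left (a := 0) (b := 1)
    (fun τ => (t - τ) ^ (p - 1) • A (t - τ) (g τ)) t
  simp only [mul_zero, mul_one] at h
  simp only
  rw [← h]
  rcases ht.eq_or_lt with rfl | ht
  · simp [Real.zero_rpow hp.ne']
  · rw [show t ^ p = t * t ^ (p - 1) by rw [Real.rpow_sub_one ht.ne']; field_simp, mul_smul,
      ← intervalIntegral.integral_smul (t ^ (p - 1)) (fun ρ : ℝ => (1 - ρ) ^ (p - 1) •
        A (t * (1 - ρ)) (g (t * ρ)))]
    congr 1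
    refine intervalIntegral.integral_congr fun ρ hρ => ?_
    rw [uIcc_of_le zero_le_one] at hρ
    rw [show t - t * ρ = t * (1 - ρ) by ring, Real.mul_rpow ht.le (by linarith [hρ.2]), mul_smul]

end VolterraContinuity

/-! ### Convolution calculus for the scalar equations. -/

section Scalar

variable {α l T : ℝ} {g h h' : ℝ → ℝ}

/-- The kernel of the Riemann–Liouville integral of order `1 - α`. -/
noncomputable def fracKernel (α r : ℝ) : ℝ := (Real.Gamma (1 - α))⁻¹ * r ^ ((1 - α) - 1)

theorem rlIntegral_eq_conv (α : ℝ) (g : ℝ → ℝ) (t : ℝ) :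
    rlIntegral (1 - α) g t = conv (fracKernel α) g t := by
  simp only [rlIntegral, conv, fracKernel, smul_eq_mul, mul_assoc,
    intervalIntegral.integral_const_mul]

theorem abs_fracKernel_le (hα : α ∈ Ioo (0 : ℝ) 1) {r : ℝ} (hr : 0 < r) :
    |fracKernel α r| ≤ (Real.Gamma (1 - α))⁻¹ * r ^ ((1 - α) - 1) := by
  have := Real.Gamma_pos_of_pos (show 0 < 1 - α by linarith [hα.2])
  rw [fracKernel, abs_of_nonneg (by positivity)]

theorem measurable_fracKernel (α : ℝ) : Measurable (fracKernel α) := by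
  unfold fracKernel; fun_prop

theorem intervalIntegrable_scalarP (hα : α ∈ Ioo (0 : ℝ) 1) (t : ℝ) :
    IntervalIntegrable (scalarP α l) volume 0 t := by
  simp_rw [funext fun t => scalarP_eq (l := l) hα t]
  exact (intervalIntegral.intervalIntegrable_rpow' (by linarith [hα.1])).mul_continuousOn
    (continuous_const.mul ((continuous_mainardiMoment hα 1).comp
      (continuous_const.mul (Real.continuous_rpow_const hα.1.le)))).continuousOn

theorem integral_scalarP (hα : α ∈ Ioo (0 : ℝ) 1) {t : ℝ} (ht : 0 ≤ t) :
    l * ∫ r in (0 : ℝ)..t, scalarP α l r = 1 - relaxation α l t := by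
  have h := intervalIntegral.integral_eq_sub_of_hasDerivAt_of_le ht
    (continuous_relaxation (l := l) hα).continuousOn
    (fun r hr => hasDerivAt_relaxation hα hr.1)
    ((intervalIntegrable_scalarP hα t).const_mul l).neg
  rw [intervalIntegral.integral_neg, intervalIntegral.integral_const_mul, relaxation_zero hα] at h
  linarith

theorem conv_scalarP_assoc (hα : α ∈ Ioo (0 : ℝ) 1) (hl : 0 ≤ l) {b : ℝ → ℝ} (hb : Measurable b)
    {D : ℝ} {t : ℝ} (ht : 0 < t) (hB : ∀ r ∈ Ioo 0 t, |b r| ≤ D * r ^ ((1 - α) - 1))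
    (hg : IntervalIntegrable g volume 0 t) :
    conv (scalarP α l) (conv b g) t = conv (conv (scalarP α l) b) g t ∧
    conv b (conv (scalarP α l) g) t = conv (conv (scalarP α l) b) g t := by
  obtain ⟨C, -, hC⟩ := exists_abs_scalarP_le hα
  have hA : ∀ r ∈ Ioo 0 t, |scalarP α l r| ≤ C * r ^ (α - 1) := fun r hr => hC l r hl hr.1.le
  have h1 : 0 < 1 - α := by linarith [hα.2]
  refine ⟨(conv_assoc hα.1 h1 (by linarith) ht (measurable_scalarP hα) hb hA hB hg).2.2, ?_⟩
  rw [(conv_assoc h1 hα.1 (by linarith) ht hb (measurable_scalarP hα) hB hA hg).2.2]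
  exact conv_congr ht.le (fun r _ => conv_comm _ _ _) fun _ _ => rfl

theorem conv_scalarP_fracKernel (hα : α ∈ Ioo (0 : ℝ) 1) (hl : 0 ≤ l) {t : ℝ} (ht : 0 < t) :
    conv (scalarP α l) (fracKernel α) t = relaxation α l t := by
  rw [conv_comm, ← rlIntegral_eq_conv, rlIntegral_scalarP hα hl ht]

theorem conv_scalarP_one (hα : α ∈ Ioo (0 : ℝ) 1) {t : ℝ} (ht : 0 ≤ t) :
    l * conv (scalarP α l) (fun _ => 1) t = 1 - relaxation α l t := by
  rw [conv_comm, conv_one_left, integral_scalarP hα ht]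

/-- Puts the constant kernel `1` under the same power bound as `fracKernel`, so that one
associativity lemma serves both. -/
theorem one_le_mul_rpow (hα : α ∈ Ioo (0 : ℝ) 1) {t : ℝ} :
    ∀ r ∈ Ioo 0 t, |(1 : ℝ)| ≤ t ^ α * r ^ ((1 - α) - 1) := by
  intro r hr
  rw [abs_one, show (1 - α) - 1 = -α by ring, Real.rpow_neg hr.1.le, ← div_eq_mul_inv,
    one_le_div (Real.rpow_pos_of_pos hr.1 _)]
  exact Real.rpow_le_rpow hr.1.le hr.2.le hα.1.le

theorem intervalIntegrable_relaxation_mul (hα : α ∈ Ioo (0 : ℝ) 1) {t : ℝ}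
    (hg : IntervalIntegrable g volume 0 t) :
    IntervalIntegrable (fun τ => relaxation α l (t - τ) * g τ) volume 0 t :=
  hg.continuousOn_mul
    ((continuous_relaxation hα).comp (continuous_const.sub continuous_id)).continuousOn

theorem mul_conv_conv_scalarP_one (hα : α ∈ Ioo (0 : ℝ) 1) {t : ℝ} (ht : 0 < t)
    (hg : IntervalIntegrable g volume 0 t) :
    l * conv (conv (scalarP α l) fun _ => 1) g t =
      (∫ τ in (0 : ℝ)..t, g τ) - conv (relaxation α l) g t := by
  have h1 := conv_congr (g := g) (g' := g) ht.le
    (fun r hr => conv_scalarP_one (l := l) hα (t := r) hr.1.le) fun _ _ => rfl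
  have h2 : conv (fun r => l * conv (scalarP α l) (fun _ => 1) r) g t =
      l * conv (conv (scalarP α l) fun _ => 1) g t := by
    simp only [conv, mul_assoc, intervalIntegral.integral_const_mul]
  rw [← h2, h1, conv, conv, ← intervalIntegral.integral_sub hg
    (intervalIntegrable_relaxation_mul hα hg)]
  simp only [sub_mul, one_mul]

/-- Uniqueness for the scalar homogeneous fractional equation. -/
theorem integral_eq_zero_of_rlIntegral_eq (hα : α ∈ Ioo (0 : ℝ) 1) (hl : 0 ≤ l)
    (hg : ∀ t ∈ Ioo 0 T, IntervalIntegrable g volume 0 t)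
    (he : ∀ t ∈ Ioo 0 T, rlIntegral (1 - α) g t = -(l * ∫ τ in (0 : ℝ)..t, g τ)) :
    ∀ t ∈ Ioo 0 T, ∫ τ in (0 : ℝ)..t, g τ = 0 := by
  intro t ht
  -- Convolve the equation with `P`. Its left side becomes `E * g` since `P * k = E`, its right side
  -- `-(1 - E) * g` since `λ (P * 1) = 1 - E`; the terms `E * g` cancel.
  have h1 := (conv_scalarP_assoc hα hl (measurable_fracKernel α) ht.1
    (fun r hr => abs_fracKernel_le hα hr.1) (hg t ht)).1
  rw [conv_congr ht.1.le (fun r hr => conv_scalarP_fracKernel hα hl hr.1) fun _ _ => rfl,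
    conv_congr (g' := fun r => -(l * conv (fun _ => 1) g r)) ht.1.le (fun _ _ => rfl)
      (fun r hr => by
        rw [← rlIntegral_eq_conv, he r ⟨hr.1, hr.2.trans ht.2⟩, conv_one_left])] at h1
  have h2 := (conv_scalarP_assoc (b := fun _ => 1) hα hl measurable_const ht.1
    (one_le_mul_rpow hα) (hg t ht)).1
  have h3 := mul_conv_conv_scalarP_one (l := l) hα ht.1 (hg t ht)
  rw [← h2] at h3
  have h4 : conv (scalarP α l) (fun r => -(l * conv (fun _ => 1) g r)) t =
      -(l * conv (scalarP α l) (conv (fun _ => 1) g) t) := by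
    simp only [conv, mul_neg, mul_left_comm _ l, intervalIntegral.integral_neg,
      intervalIntegral.integral_const_mul]
  rw [h4, h3] at h1
  linarith

theorem conv_fracKernel_scalarP_conv (hα : α ∈ Ioo (0 : ℝ) 1) (hl : 0 ≤ l) {t : ℝ} (ht : 0 < t)
    (hg : IntervalIntegrable g volume 0 t) :
    rlIntegral (1 - α) (conv (scalarP α l) g) t = conv (relaxation α l) g t := by
  rw [rlIntegral_eq_conv, (conv_scalarP_assoc hα hl (measurable_fracKernel α) ht
    (fun r hr => abs_fracKernel_le hα hr.1) hg).2]
  exact conv_congr ht.le (fun r hr => conv_scalarP_fracKernel hα hl hr.1) fun _ _ => rfl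

/-- Integrated form of `E' = -λ P`, `E(0) = 1`; differentiating it later gives the derivative of `E
* g`. -/
theorem conv_relaxation_eq (hα : α ∈ Ioo (0 : ℝ) 1) (hl : 0 ≤ l) {t : ℝ} (ht : 0 < t)
    (hg : IntervalIntegrable g volume 0 t) :
    conv (relaxation α l) g t =
      (∫ τ in (0 : ℝ)..t, g τ) - l * ∫ τ in (0 : ℝ)..t, conv (scalarP α l) g τ := by
  have h2 := (conv_scalarP_assoc (b := fun _ => 1) hα hl measurable_const ht
    (one_le_mul_rpow hα) hg).2
  rw [conv_one_left] at h2
  rw [h2, mul_conv_conv_scalarP_one hα ht hg]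
  ring

theorem intervalIntegrable_scalarP_mul (hα : α ∈ Ioo (0 : ℝ) 1) (hg : Continuous g) (t : ℝ) :
    IntervalIntegrable (fun τ => scalarP α l (t - τ) * g τ) volume 0 t := by
  refine IntervalIntegrable.mul_continuousOn ?_ hg.continuousOn
  have := (intervalIntegrable_scalarP (l := l) hα t).comp_sub_left t
  simp only [sub_zero, sub_self] at this
  exact this.symm

theorem continuousOn_conv_scalarP (hα : α ∈ Ioo (0 : ℝ) 1) (hg : Continuous g) :
    ContinuousOn (conv (scalarP α l) g) (Ici 0) := by
  have h := continuousOn_integral_rpow_smul_comp_sub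
    (A := fun t x : ℝ => α * mainardiMoment α 1 (l * t ^ α) * x) (p := α)
    ((continuous_const.mul ((continuous_mainardiMoment hα 1).comp (continuous_const.mul
      ((Real.continuous_rpow_const hα.1.le).comp continuous_fst)))).mul continuous_snd) hg hα.1
  refine h.congr fun t _ => ?_
  simp only [conv, scalarP_eq hα, smul_eq_mul, mul_assoc]

/-- Write `h = h(0) + 1 * h'` and commute the convolution by `1` with that by `P`. The right side
can be differentiated although `P` is singular at `0`. -/
theorem conv_scalarP_eq_of_hasDerivAt (hα : α ∈ Ioo (0 : ℝ) 1) (hl : 0 ≤ l)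
    (hh : ∀ t, HasDerivAt h (h' t) t) (hh' : Continuous h') {t : ℝ} (ht : 0 < t) :
    conv (scalarP α l) h t =
      ∫ r in (0 : ℝ)..t, (h 0 * scalarP α l r + conv (scalarP α l) h' r) := by
  have hint : ∀ r, h r = h 0 + conv (fun _ => 1) h' r := fun r => by
    rw [conv_one_left, intervalIntegral.integral_eq_sub_of_hasDerivAt (fun x _ => hh x)
      (hh'.intervalIntegrable _ _)]
    ring
  have h1 := conv_scalarP_assoc (b := fun _ => 1) hα hl measurable_const ht
    (one_le_mul_rpow hα) (hh'.intervalIntegrable 0 t)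
  have hc : Continuous (conv (fun _ => 1) h') := by
    have : conv (fun _ => 1) h' = fun r => h r - h 0 := funext fun r => by rw [hint r]; ring
    rw [this]
    exact (continuous_iff_continuousAt.2 fun t => (hh t).continuousAt).sub continuous_const
  rw [intervalIntegral.integral_add ((intervalIntegrable_scalarP hα t).const_mul _)
    ((continuousOn_conv_scalarP hα hh').mono (by
      rw [uIcc_of_le ht.le]; exact Icc_subset_Ici_self)).intervalIntegrable,
    intervalIntegral.integral_const_mul, ← conv_one_left (conv _ _), h1.2, ← h1.1,
    ← conv_one_left (scalarP α l), conv_comm (fun _ => 1) (scalarP α l)]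
  have e : conv (scalarP α l) h t = conv (scalarP α l) (fun r => h 0 + conv (fun _ => 1) h' r) t :=
    conv_congr ht.le (fun _ _ => rfl) fun r _ => hint r
  rw [e, conv, conv, conv, ← intervalIntegral.integral_const_mul, ← intervalIntegral.integral_add]
  · simp only [mul_add, mul_one, mul_comm (h 0)]
  · exact (intervalIntegrable_scalarP_mul hα continuous_const t).const_mul _
  · exact intervalIntegrable_scalarP_mul hα hc t

/-- Integration by parts, using `λ P = -E'`. The factor `λ` disappears from the right side, so the
formula has an `L²` counterpart. -/
theorem mul_conv_scalarP_eq (hα : α ∈ Ioo (0 : ℝ) 1) (hl : 0 ≤ l)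
    (hh : ∀ t, HasDerivAt h (h' t) t) (hh' : Continuous h') {t : ℝ} (ht : 0 < t) :
    l * conv (scalarP α l) h t = h t - h 0 * relaxation α l t - conv (relaxation α l) h' t := by
  rw [conv_scalarP_eq_of_hasDerivAt hα hl hh hh' ht,
    intervalIntegral.integral_add ((intervalIntegrable_scalarP hα t).const_mul _)
    ((continuousOn_conv_scalarP hα hh').mono (by
      rw [uIcc_of_le ht.le]; exact Icc_subset_Ici_self)).intervalIntegrable,
    intervalIntegral.integral_const_mul, mul_add, mul_left_comm, integral_scalarP hα ht.le,
    conv_relaxation_eq hα hl ht (hh'.intervalIntegrable 0 t),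
    intervalIntegral.integral_eq_sub_of_hasDerivAt (fun x _ => hh x) (hh'.intervalIntegrable _ _)]
  ring

end Scalar


/-! ### From coefficients in a Hilbert basis to vectors. -/

section HilbertCoefficients

variable {H : Type*} [NormedAddCommGroup H] [InnerProductSpace ℝ H]
  (φ : HilbertBasis ℕ ℝ H)

theorem hilbertBasis_ext {x y : H} (h : ∀ j, inner ℝ x (φ j) = inner ℝ y (φ j)) : x = y := by
  refine φ.repr.injective (lp.ext (funext fun j => ?_))
  rw [φ.repr_apply_apply, φ.repr_apply_apply, real_inner_comm, h j, real_inner_comm]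

theorem hasSum_inner_sq (x : H) : HasSum (fun j => (inner ℝ x (φ j)) ^ 2) (‖x‖ ^ 2) := by
  have h := φ.hasSum_inner_mul_inner x x
  rw [real_inner_self_eq_norm_sq] at h
  refine h.congr_fun fun j => ?_
  rw [real_inner_comm x (φ j), sq]

theorem hasSum_inner_smul (x : H) : HasSum (fun j => (inner ℝ x (φ j)) • φ j) x := by
  refine (φ.hasSum_repr x).congr_fun fun j => ?_
  rw [φ.repr_apply_apply, real_inner_comm]

theorem exists_of_summable_sq {c : ℕ → ℝ} (hc : Summable fun j => c j ^ 2) :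
    ∃ x : H, ∀ j, inner ℝ x (φ j) = c j := by
  have hmem : Memℓp c 2 := by
    refine memℓp_gen ?_
    simpa using hc
  refine ⟨φ.repr.symm ⟨c, hmem⟩, fun j => ?_⟩
  rw [real_inner_comm, ← φ.repr_apply_apply, LinearIsometryEquiv.apply_symm_apply]

variable [CompleteSpace H]

theorem inner_integral_left {X : Type*} [MeasurableSpace X] {μ : Measure X} {g : X → H}
    (hg : Integrable g μ) (e : H) : inner ℝ (∫ x, g x ∂μ) e = ∫ x, inner ℝ (g x) e ∂μ := by
  rw [real_inner_comm, ← integral_inner hg]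
  simp_rw [real_inner_comm e]

theorem inner_intervalIntegral_left {g : ℝ → H} {a b : ℝ} (hg : IntervalIntegrable g volume a b)
    (e : H) : inner ℝ (∫ x in a..b, g x) e = ∫ x in a..b, inner ℝ (g x) e := by
  have h := (innerSL ℝ e).intervalIntegral_comp_comm hg
  simp only [innerSL_apply_apply] at h
  rw [real_inner_comm, ← h]
  simp_rw [real_inner_comm e]

/-- Coefficientwise differentiability alone would be weak. Continuity of `V` gives `U(r) = U(t/2) +
∫ V` by comparing coefficients, and this differentiates in norm. The base point `t/2` keeps away
from a singularity at `0`. -/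
theorem hasDerivAt_of_hasDerivAt_inner {U V : ℝ → H}
    (hV : ContinuousOn V (Ioi 0))
    (h : ∀ j, ∀ t, 0 < t → HasDerivAt (fun r => inner ℝ (U r) (φ j)) (inner ℝ (V t) (φ j)) t)
    {t : ℝ} (ht : 0 < t) : HasDerivAt U (V t) t := by
  have hint : ∀ r, 0 < r → IntervalIntegrable V volume (t / 2) r := fun r hr =>
    (hV.mono fun x hx => lt_of_lt_of_le (lt_min (half_pos ht) hr) hx.1).intervalIntegrable
  have e : ∀ r, 0 < r → U r = U (t / 2) + ∫ x in (t / 2)..r, V x := by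
    intro r hr
    refine hilbertBasis_ext φ fun j => ?_
    rw [inner_add_left, inner_intervalIntegral_left (hint r hr),
      intervalIntegral.integral_eq_sub_of_hasDerivAt (f := fun r => inner ℝ (U r) (φ j))
        (fun x hx => h j x (lt_of_lt_of_le (lt_min (half_pos ht) hr) hx.1))]
    · ring
    · refine ContinuousOn.intervalIntegrable ?_
      refine ContinuousOn.inner ?_ continuousOn_const
      exact hV.mono fun x hx => lt_of_lt_of_le (lt_min (half_pos ht) hr) hx.1
  have h1 : HasDerivAt (fun r => U (t / 2) + ∫ x in (t / 2)..r, V x) (V t) t := by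
    refine (intervalIntegral.integral_hasDerivAt_right (hint t ht) ?_ ?_).const_add _
    · exact hV.stronglyMeasurableAtFilter isOpen_Ioi t ht
    · exact hV.continuousAt (Ioi_mem_nhds ht)
  refine h1.congr_of_eventuallyEq ?_
  filter_upwards [Ioi_mem_nhds ht] with r hr using e r hr

end HilbertCoefficients

/-! ### Subordination -/

section Subordination

variable {H : Type*} [NormedAddCommGroup H] [InnerProductSpace ℝ H]

/-- A strongly continuous family acting on the basis `φ` as multiplication by `exp (-λ_j t)`, with
positive rates `λ_j`. -/
structure IsDiagonalSemigroup (φ : HilbertBasis ℕ ℝ H) (lam : ℕ → ℝ) (S : ℝ → H →L[ℝ] H) :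
    Prop where
  lam_pos : ∀ j, 0 < lam j
  inner_apply : ∀ t : ℝ, 0 ≤ t → ∀ v j,
    inner ℝ (S t v) (φ j) = Real.exp (-(lam j * t)) * inner ℝ v (φ j)
  continuousOn : ∀ v : H, ContinuousOn (fun t => S t v) (Ici 0)

variable {φ : HilbertBasis ℕ ℝ H} {lam : ℕ → ℝ} {S : ℝ → H →L[ℝ] H} {α : ℝ}

theorem IsDiagonalSemigroup.norm_apply_le (hS : IsDiagonalSemigroup φ lam S) {t : ℝ} (ht : 0 ≤ t)
    (v : H) : ‖S t v‖ ≤ ‖v‖ := by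
  refine le_of_sq_le_sq ?_ (norm_nonneg v)
  refine hasSum_le (fun j => ?_) (hasSum_inner_sq φ (S t v)) (hasSum_inner_sq φ v)
  rw [hS.inner_apply t ht, mul_pow]
  refine mul_le_of_le_one_left (sq_nonneg _) (pow_le_one₀ (Real.exp_pos _).le ?_)
  rw [Real.exp_le_one_iff]
  have := mul_nonneg (hS.lam_pos j).le ht
  linarith

/-- Contractivity upgrades strong continuity to joint continuity. Clamping time at `0` yields a
function continuous on the whole line, as the later compositions require. -/
theorem IsDiagonalSemigroup.continuous_uncurry (hS : IsDiagonalSemigroup φ lam S) :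
    Continuous fun z : ℝ × H => S (max z.1 0) z.2 := by
  refine continuous_iff_continuousAt.2 fun z₀ => ?_
  have h1 : Continuous fun t : ℝ => S (max t 0) z₀.2 :=
    (hS.continuousOn z₀.2).comp_continuous (by fun_prop) fun t => mem_Ici.2 (le_max_right _ _)
  have h2 : Tendsto (fun z : ℝ × H => S (max z.1 0) (z.2 - z₀.2)) (𝓝 z₀) (𝓝 0) := by
    refine squeeze_zero_norm (fun z => hS.norm_apply_le (le_max_right _ _) _) ?_
    have : Continuous fun z : ℝ × H => ‖z.2 - z₀.2‖ := by fun_prop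
    simpa using this.tendsto z₀
  have h3 := h2.add ((h1.comp continuous_fst).tendsto z₀)
  simpa [ContinuousAt] using h3

/-- The subordinated operator `∫₀^∞ σ^k Φ_α(σ) S(σ r) dσ`. -/
noncomputable def subord (α : ℝ) (k : ℕ) (S : ℝ → H →L[ℝ] H) (r : ℝ) (v : H) : H :=
  ∫ σ in Ioi (0 : ℝ), (σ ^ k * mainardi α σ) • S (σ * max r 0) v

theorem IsDiagonalSemigroup.continuous_mul_max (hS : IsDiagonalSemigroup φ lam S)
    {X : Type*} [TopologicalSpace X] {a b : X → ℝ} {v : X → H} (ha : Continuous a)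
    (hb : Continuous b) (hv : Continuous v) :
    Continuous fun x => S (max (a x) 0 * max (b x) 0) (v x) := by
  have hm : Continuous fun x => max (a x) 0 * max (b x) 0 := by fun_prop
  have h := hS.continuous_uncurry.comp (hm.prodMk hv)
  refine h.congr fun x => ?_
  simp only [Function.comp]
  rw [max_eq_left (mul_nonneg (le_max_right (a x) 0) (le_max_right (b x) 0))]

theorem IsDiagonalSemigroup.aestronglyMeasurable_subord (hS : IsDiagonalSemigroup φ lam S)
    (hα : α ∈ Ioo (0 : ℝ) 1) (k : ℕ) (r : ℝ) (v : H) :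
    AEStronglyMeasurable (fun σ : ℝ => (σ ^ k * mainardi α σ) • S (σ * max r 0) v)
      (volume.restrict (Ioi 0)) := by
  refine (integrableOn_pow_mul_mainardi' hα k).1.smul ?_
  have hc : Continuous fun σ : ℝ => S (max σ 0 * max r 0) v :=
    hS.continuous_mul_max continuous_id continuous_const continuous_const
  refine hc.aestronglyMeasurable.congr ?_
  filter_upwards [ae_restrict_mem measurableSet_Ioi] with σ hσ
  rw [max_eq_left (le_of_lt (mem_Ioi.1 hσ))]

theorem IsDiagonalSemigroup.norm_subord_integrand_le (hS : IsDiagonalSemigroup φ lam S)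
    (k : ℕ) (r : ℝ) (v : H) {σ : ℝ} (hσ : σ ∈ Ioi (0 : ℝ)) :
    ‖(σ ^ k * mainardi α σ) • S (σ * max r 0) v‖ ≤ ‖σ ^ k * mainardi α σ‖ * ‖v‖ := by
  rw [norm_smul]
  exact mul_le_mul_of_nonneg_left
    (hS.norm_apply_le (mul_nonneg (le_of_lt hσ) (le_max_right _ _)) v) (norm_nonneg _)

theorem IsDiagonalSemigroup.integrable_subord (hS : IsDiagonalSemigroup φ lam S)
    (hα : α ∈ Ioo (0 : ℝ) 1) (k : ℕ) (r : ℝ) (v : H) :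
    IntegrableOn (fun σ : ℝ => (σ ^ k * mainardi α σ) • S (σ * max r 0) v) (Ioi 0) := by
  refine ((integrableOn_pow_mul_mainardi' hα k).norm.mul_const ‖v‖).mono'
    (hS.aestronglyMeasurable_subord hα k r v) ?_
  filter_upwards [ae_restrict_mem measurableSet_Ioi] with σ hσ
  exact hS.norm_subord_integrand_le k r v hσ

theorem IsDiagonalSemigroup.continuous_subord (hS : IsDiagonalSemigroup φ lam S)
    (hα : α ∈ Ioo (0 : ℝ) 1) (k : ℕ) : Continuous (Function.uncurry (subord α k S)) := by
  refine continuous_iff_continuousAt.2 fun z₀ => ?_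
  refine continuousAt_of_dominated (bound := fun σ => ‖σ ^ k * mainardi α σ‖ * (‖z₀.2‖ + 1))
    (Eventually.of_forall fun z => hS.aestronglyMeasurable_subord hα k z.1 z.2) ?_
    ((integrableOn_pow_mul_mainardi' hα k).norm.mul_const _) ?_
  · have hn : ∀ᶠ z : ℝ × H in 𝓝 z₀, ‖z.2‖ < ‖z₀.2‖ + 1 :=
      (continuous_snd.norm.tendsto z₀).eventually_lt_const (by linarith)
    filter_upwards [hn] with z hz
    filter_upwards [ae_restrict_mem measurableSet_Ioi] with σ hσ
    exact (hS.norm_subord_integrand_le k z.1 z.2 hσ).trans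
      (mul_le_mul_of_nonneg_left hz.le (norm_nonneg _))
  · filter_upwards [ae_restrict_mem measurableSet_Ioi] with σ hσ
    have hc : Continuous fun z : ℝ × H => S (max σ 0 * max z.1 0) z.2 :=
      hS.continuous_mul_max continuous_const continuous_fst continuous_snd
    rw [max_eq_left (le_of_lt (mem_Ioi.1 hσ))] at hc
    exact (hc.const_smul _).continuousAt

/-- Subordination acts on the `j`-th coordinate as a Laplace transform of `σ^k Φ_α(σ)`; this links
the operators to Mittag-Leffler functions. -/
theorem IsDiagonalSemigroup.inner_subord [CompleteSpace H] (hS : IsDiagonalSemigroup φ lam S)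
    (hα : α ∈ Ioo (0 : ℝ) 1) (k : ℕ) {r : ℝ} (hr : 0 ≤ r) (v : H) (j : ℕ) :
    inner ℝ (subord α k S r v) (φ j) = mainardiMoment α k (lam j * r) * inner ℝ v (φ j) := by
  rw [subord, inner_integral_left (hS.integrable_subord hα k r v), mainardiMoment,
    ← integral_mul_const]
  refine setIntegral_congr_fun measurableSet_Ioi fun σ hσ => ?_
  rw [max_eq_left hr, real_inner_smul_left,
    hS.inner_apply _ (mul_nonneg (le_of_lt (mem_Ioi.1 hσ)) hr), ← mul_assoc]
  congr 3
  ring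

end Subordination


/-! ### Scalar Caputo and Riemann–Liouville equations solved by Mittag-Leffler formulas. -/

section ScalarDerivatives

variable {α l c : ℝ} {g h h' : ℝ → ℝ}

theorem intervalIntegrable_of_continuousOn_Ici {F : ℝ → ℝ} (hF : ContinuousOn F (Ici 0)) {t : ℝ}
    (ht : 0 ≤ t) : IntervalIntegrable F volume 0 t :=
  (hF.mono (by rw [uIcc_of_le ht]; exact Icc_subset_Ici_self)).intervalIntegrable

theorem hasDerivAt_integral_of_eventually {F U : ℝ → ℝ}
    (hi : ∀ t, 0 < t → IntervalIntegrable F volume 0 t) (hF : ContinuousOn F (Ioi 0))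
    (hU : ∀ t, 0 < t → U t = ∫ x in (0 : ℝ)..t, F x) {t : ℝ} (ht : 0 < t) :
    HasDerivAt U (F t) t := by
  have h := intervalIntegral.integral_hasDerivAt_right (hi t ht)
    (hF.stronglyMeasurableAtFilter isOpen_Ioi t ht) (hF.continuousAt (Ioi_mem_nhds ht))
  refine h.congr_of_eventuallyEq ?_
  filter_upwards [Ioi_mem_nhds ht] with r hr using hU r hr

theorem hasDerivAt_conv_scalarP (hα : α ∈ Ioo (0 : ℝ) 1) (hl : 0 ≤ l)
    (hh : ∀ t, HasDerivAt h (h' t) t) (hh' : Continuous h') {t : ℝ} (ht : 0 < t) :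
    HasDerivAt (conv (scalarP α l) h) (h 0 * scalarP α l t + conv (scalarP α l) h' t) t := by
  have hc := continuousOn_conv_scalarP (l := l) hα hh'
  refine hasDerivAt_integral_of_eventually
    (F := fun t => h 0 * scalarP α l t + conv (scalarP α l) h' t) (fun t ht => ?_) ?_
    (fun t ht => conv_scalarP_eq_of_hasDerivAt hα hl hh hh' ht) ht
  · exact ((intervalIntegrable_scalarP hα t).const_mul _).add
      (intervalIntegrable_of_continuousOn_Ici hc ht.le)
  · exact (continuousOn_const.mul (continuousOn_scalarP hα)).add (hc.mono Ioi_subset_Ici_self)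

theorem hasDerivAt_conv_relaxation (hα : α ∈ Ioo (0 : ℝ) 1) (hl : 0 ≤ l) (hg : Continuous g)
    {t : ℝ} (ht : 0 < t) :
    HasDerivAt (conv (relaxation α l) g) (g t - l * conv (scalarP α l) g t) t := by
  have hc := continuousOn_conv_scalarP (l := l) hα hg
  refine hasDerivAt_integral_of_eventually
    (F := fun t => g t - l * conv (scalarP α l) g t) (fun t ht => ?_) ?_ (fun t ht => ?_) ht
  · exact (hg.intervalIntegrable _ _).sub
      ((intervalIntegrable_of_continuousOn_Ici hc ht.le).const_mul _)
  · exact hg.continuousOn.sub (continuousOn_const.mul (hc.mono Ioi_subset_Ici_self))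
  · rw [conv_relaxation_eq hα hl ht (hg.intervalIntegrable _ _), intervalIntegral.integral_sub
      (hg.intervalIntegrable _ _) ((intervalIntegrable_of_continuousOn_Ici hc ht.le).const_mul _),
      intervalIntegral.integral_const_mul]

theorem intervalIntegrable_rpow_mul_scalarP (hα : α ∈ Ioo (0 : ℝ) 1) {t : ℝ} (ht : 0 < t) :
    IntervalIntegrable (fun τ => (t - τ) ^ ((1 - α) - 1) * scalarP α l τ) volume 0 t := by
  have h := (intervalIntegrable_rpow_mul_sub_rpow hα.1 (show 0 < 1 - α by linarith [hα.2])
    ht).mul_continuousOn (g := fun τ => α * mainardiMoment α 1 (l * τ ^ α))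
      (continuous_const.mul ((continuous_mainardiMoment hα 1).comp
      (continuous_const.mul (Real.continuous_rpow_const hα.1.le)))).continuousOn
  refine h.congr (fun τ _ => ?_)
  simp only [scalarP_eq hα, mul_assoc]

theorem intervalIntegrable_rpow_mul_of_continuousOn {F : ℝ → ℝ} (hα : α ∈ Ioo (0 : ℝ) 1)
    (hF : ContinuousOn F (Ici 0)) {t : ℝ} (ht : 0 < t) :
    IntervalIntegrable (fun τ => (t - τ) ^ ((1 - α) - 1) * F τ) volume 0 t :=
  (intervalIntegrable_rpow_sub (show 0 < 1 - α by linarith [hα.2]) t).mul_continuousOn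
    (hF.mono (by rw [uIcc_of_le ht.le]; exact Icc_subset_Ici_self))

theorem rlIntegral_scalarP_add (hα : α ∈ Ioo (0 : ℝ) 1) (hl : 0 ≤ l) (hg : Continuous g)
    {t : ℝ} (ht : 0 < t) :
    rlIntegral (1 - α) (fun r => c * scalarP α l r + conv (scalarP α l) g r) t =
      c * relaxation α l t + conv (relaxation α l) g t := by
  rw [← rlIntegral_scalarP hα hl ht, ← conv_fracKernel_scalarP_conv hα hl ht
    (hg.intervalIntegrable _ _)]
  simp only [rlIntegral, smul_eq_mul]
  have e : ∀ ξ, (t - ξ) ^ ((1 - α) - 1) * (c * scalarP α l ξ + conv (scalarP α l) g ξ) =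
      c * ((t - ξ) ^ ((1 - α) - 1) * scalarP α l ξ) +
        (t - ξ) ^ ((1 - α) - 1) * conv (scalarP α l) g ξ := fun ξ => by ring
  simp_rw [e]
  rw [intervalIntegral.integral_add ((intervalIntegrable_rpow_mul_scalarP hα ht).const_mul c)
    (intervalIntegrable_rpow_mul_of_continuousOn hα (continuousOn_conv_scalarP hα hg) ht),
    intervalIntegral.integral_const_mul]
  ring

theorem intervalIntegrable_rpow_mul_scalarP_add (hα : α ∈ Ioo (0 : ℝ) 1) (hg : Continuous g)
    {t : ℝ} (ht : 0 < t) :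
    IntervalIntegrable (fun τ => (t - τ) ^ ((1 - α) - 1) *
      (c * scalarP α l τ + conv (scalarP α l) g τ)) volume 0 t := by
  refine (((intervalIntegrable_rpow_mul_scalarP (l := l) hα ht).const_mul c).add
    (intervalIntegrable_rpow_mul_of_continuousOn hα (continuousOn_conv_scalarP (l := l) hα hg)
      ht)).congr (fun τ _ => ?_)
  ring

/-- The Mittag-Leffler formula solves the scalar Caputo equation. -/
theorem hasDerivAt_relaxation_add_conv (hα : α ∈ Ioo (0 : ℝ) 1) (hl : 0 ≤ l)
    (hh : ∀ t, HasDerivAt h (h' t) t) (hh' : Continuous h') {t : ℝ} (ht : 0 < t) :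
    HasDerivAt (fun t => relaxation α l t * c + conv (scalarP α l) h t)
      (-(l * c - h 0) * scalarP α l t + conv (scalarP α l) h' t) t := by
  refine (((hasDerivAt_relaxation hα ht).mul_const c).add
    (hasDerivAt_conv_scalarP hα hl hh hh' ht)).congr_deriv ?_
  ring

/-- The combination `l c - h 0` is the coordinate of `L u₀ - f(0)`; no other factor `l` survives on
the right. -/
theorem mul_relaxation_add_conv (hα : α ∈ Ioo (0 : ℝ) 1) (hl : 0 ≤ l)
    (hh : ∀ t, HasDerivAt h (h' t) t) (hh' : Continuous h') {t : ℝ} (ht : 0 < t) :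
    l * (relaxation α l t * c + conv (scalarP α l) h t) =
      relaxation α l t * (l * c - h 0) + h t - conv (relaxation α l) h' t := by
  rw [mul_add, mul_conv_scalarP_eq hα hl hh hh' ht]
  ring

theorem caputo_relaxation_add_conv (hα : α ∈ Ioo (0 : ℝ) 1) (hl : 0 ≤ l)
    (hh : ∀ t, HasDerivAt h (h' t) t) (hh' : Continuous h') {y : ℝ → ℝ}
    (hy : ∀ t, 0 ≤ t → y t = relaxation α l t * c + conv (scalarP α l) h t) {t : ℝ} (ht : 0 < t) :
    CaputoDifferentiableAt α y t ∧ caputoDeriv α y t + l * y t = h t := by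
  have hd : ∀ r, 0 < r → deriv y r =
      -(l * c - h 0) * scalarP α l r + conv (scalarP α l) h' r := by
    intro r hr
    refine HasDerivAt.deriv ?_
    refine (hasDerivAt_relaxation_add_conv (c := c) hα hl hh hh' hr).congr_of_eventuallyEq ?_
    filter_upwards [Ioi_mem_nhds hr] with r hr using hy r (le_of_lt hr)
  constructor
  · refine (intervalIntegrable_rpow_mul_scalarP_add (l := l) (c := -(l * c - h 0)) hα hh'
      ht).congr ?_
    intro r hr
    rw [uIoc_of_le ht.le] at hr
    simp only [smul_eq_mul, hd r hr.1]
  -- Here `k * y' = -(l c - h(0)) E + E * h'`, while `l y = (l c - h(0)) E + h - E * h'`; the sum is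
  -- `h`.
  · rw [hy t ht.le, mul_relaxation_add_conv hα hl hh hh' ht]
    have e : caputoDeriv α y t = rlIntegral (1 - α)
        (fun r => -(l * c - h 0) * scalarP α l r + conv (scalarP α l) h' r) t := by
      rw [caputoDeriv, rlIntegral, rlIntegral, intervalIntegral.integral_of_le ht.le,
        intervalIntegral.integral_of_le ht.le]
      congr 1
      exact setIntegral_congr_fun measurableSet_Ioc fun r hr => by simp only [hd r hr.1]
    rw [e, rlIntegral_scalarP_add hα hl hh' ht]
    ring

/-- The Mittag-Leffler formula solves the scalar Riemann–Liouville equation. -/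
theorem rl_scalarP_add_conv (hα : α ∈ Ioo (0 : ℝ) 1) (hl : 0 ≤ l) (hh : Continuous h)
    {y : ℝ → ℝ} (hy : ∀ t, 0 < t → y t = c * scalarP α l t + conv (scalarP α l) h t)
    {t : ℝ} (ht : 0 < t) :
    RLDifferentiableAt α y t ∧ rlDeriv α y t + l * y t = h t := by
  -- From `P * k = E` one gets `k * y = c E + E * h`, which is differentiable although `y` is
  -- singular at `0`.
  have e : ∀ r, 0 < r → rlIntegral (1 - α) y r =
      relaxation α l r * c + conv (relaxation α l) h r := by
    intro r hr
    rw [mul_comm, ← rlIntegral_scalarP_add hα hl hh hr, rlIntegral, rlIntegral,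
      intervalIntegral.integral_of_le hr.le, intervalIntegral.integral_of_le hr.le]
    congr 1
    exact setIntegral_congr_fun measurableSet_Ioc fun r hr => by simp only [hy r hr.1]
  have hd : HasDerivAt (rlIntegral (1 - α) y)
      (-(l * scalarP α l t) * c + (h t - l * conv (scalarP α l) h t)) t := by
    refine (((hasDerivAt_relaxation hα ht).mul_const c).add
      (hasDerivAt_conv_relaxation hα hl hh ht)).congr_of_eventuallyEq ?_
    filter_upwards [Ioi_mem_nhds ht] with r hr using e r hr
  refine ⟨hd.differentiableAt, ?_⟩
  rw [rlDeriv, hd.deriv, hy t ht]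
  ring

end ScalarDerivatives


/-! ### The solutions as `L²`-valued functions, and their regularity. -/

section Evolution

variable {H : Type*} [NormedAddCommGroup H] [InnerProductSpace ℝ H]
  {φ : HilbertBasis ℕ ℝ H} {lam : ℕ → ℝ} {S : ℝ → H →L[ℝ] H} {α : ℝ}

/-- The Duhamel integral `∫₀ᵗ 𝓟(t-τ) g(τ) dτ`, with `𝓟(r) = α r^(α-1) ∫ σ Φ_α(σ) S(σ r^α) dσ`. -/
noncomputable def duhamelP (α : ℝ) (S : ℝ → H →L[ℝ] H) (g : ℝ → H) (t : ℝ) : H :=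
  ∫ τ in (0 : ℝ)..t, (t - τ) ^ (α - 1) • (α • subord α 1 S ((t - τ) ^ α) (g τ))

/-- The Duhamel integral `∫₀ᵗ 𝓔(t-τ) g(τ) dτ`, with `𝓔(r) = ∫ Φ_α(σ) S(σ r^α) dσ`. -/
noncomputable def duhamelE (α : ℝ) (S : ℝ → H →L[ℝ] H) (g : ℝ → H) (t : ℝ) : H :=
  ∫ τ in (0 : ℝ)..t, (t - τ) ^ ((1 : ℝ) - 1) • subord α 0 S ((t - τ) ^ α) (g τ)

theorem IsDiagonalSemigroup.continuous_subord_rpow (hS : IsDiagonalSemigroup φ lam S)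
    (hα : α ∈ Ioo (0 : ℝ) 1) (k : ℕ) :
    Continuous (Function.uncurry fun (t : ℝ) v => subord α k S (t ^ α) v) :=
  (hS.continuous_subord hα k).comp
    (((Real.continuous_rpow_const hα.1.le).comp continuous_fst).prodMk continuous_snd)

theorem IsDiagonalSemigroup.continuous_subord_rpow_const (hS : IsDiagonalSemigroup φ lam S)
    (hα : α ∈ Ioo (0 : ℝ) 1) (k : ℕ) (v : H) : Continuous fun t : ℝ => subord α k S (t ^ α) v :=
  (hS.continuous_subord_rpow hα k).comp (Continuous.prodMk_left v)

theorem IsDiagonalSemigroup.continuous_smul_subord_rpow (hS : IsDiagonalSemigroup φ lam S)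
    (hα : α ∈ Ioo (0 : ℝ) 1) :
    Continuous (Function.uncurry fun (t : ℝ) v => α • subord α 1 S (t ^ α) v) :=
  (hS.continuous_subord_rpow hα 1).const_smul α

/-- With `ξ^(1-α) u` continuous, the integrand is a continuous function times the beta weight
`(t-ξ)^(-α) ξ^(α-1)`. -/
theorem intervalIntegrable_rpow_smul_of_scaled {u w : ℝ → H} (hα : α ∈ Ioo (0 : ℝ) 1) {t : ℝ}
    (ht : 0 < t) (hw : ContinuousOn w (Icc 0 t)) (hu : ∀ ξ ∈ Ioc 0 t, w ξ = ξ ^ (1 - α) • u ξ) :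
    IntervalIntegrable (fun ξ => (t - ξ) ^ ((1 - α) - 1) • u ξ) volume 0 t := by
  refine ((intervalIntegrable_rpow_mul_sub_rpow hα.1 (show 0 < 1 - α by linarith [hα.2])
    ht).smul_continuousOn (hw.mono (by rw [uIcc_of_le ht.le]))).congr fun ξ hξ => ?_
  rw [uIoc_of_le ht.le] at hξ
  rw [hu ξ hξ, smul_smul, mul_assoc, ← Real.rpow_add hξ.1,
    show α - 1 + (1 - α) = 0 by ring, Real.rpow_zero, mul_one]

theorem intervalIntegrable_of_scaled {u w : ℝ → H} (hα : α ∈ Ioo (0 : ℝ) 1) {t : ℝ}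
    (ht : 0 < t) (hw : ContinuousOn w (Icc 0 t)) (hu : ∀ ξ ∈ Ioc 0 t, w ξ = ξ ^ (1 - α) • u ξ) :
    IntervalIntegrable u volume 0 t := by
  refine ((intervalIntegral.intervalIntegrable_rpow' (a := 0) (b := t) (r := α - 1)
    (by linarith [hα.1])).smul_continuousOn (hw.mono (by rw [uIcc_of_le ht.le]))).congr
    fun ξ hξ => ?_
  rw [uIoc_of_le ht.le] at hξ
  rw [hu ξ hξ, smul_smul, ← Real.rpow_add hξ.1,
    show α - 1 + (1 - α) = 0 by ring, Real.rpow_zero, one_smul]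

variable {g f f' : ℝ → H} {u₀ w₀ : H}

theorem IsDiagonalSemigroup.continuousOn_duhamelP (hS : IsDiagonalSemigroup φ lam S)
    (hα : α ∈ Ioo (0 : ℝ) 1) (hg : Continuous g) : ContinuousOn (duhamelP α S g) (Ici 0) :=
  continuousOn_integral_rpow_smul_comp_sub (hS.continuous_smul_subord_rpow hα) hg hα.1

/-- The trivial power with exponent `1 - 1` in `duhamelE` lets the weakly singular lemma apply with
`p = 1`. -/
theorem IsDiagonalSemigroup.continuousOn_duhamelE (hS : IsDiagonalSemigroup φ lam S)
    (hα : α ∈ Ioo (0 : ℝ) 1) (hg : Continuous g) : ContinuousOn (duhamelE α S g) (Ici 0) :=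
  continuousOn_integral_rpow_smul_comp_sub (hS.continuous_subord_rpow hα 0) hg one_pos

theorem hasDerivAt_inner_left (hf : ∀ t, HasDerivAt f (f' t) t) (e : H) (t : ℝ) :
    HasDerivAt (fun t => inner ℝ (f t) e) (inner ℝ (f' t) e) t := by
  simpa using (hf t).inner ℝ (hasDerivAt_const t e)

theorem continuous_inner_left (hg : Continuous g) (e : H) :
    Continuous fun t => inner ℝ (g t) e := hg.inner continuous_const

/-- The solution of the Caputo problem. -/
noncomputable def caputoSol (α : ℝ) (S : ℝ → H →L[ℝ] H) (u₀ : H) (f : ℝ → H) (t : ℝ) : H :=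
  subord α 0 S (t ^ α) u₀ + duhamelP α S f t

theorem IsDiagonalSemigroup.continuousOn_caputoSol (hS : IsDiagonalSemigroup φ lam S)
    (hα : α ∈ Ioo (0 : ℝ) 1) (hf : Continuous f) : ContinuousOn (caputoSol α S u₀ f) (Ici 0) :=
  (hS.continuous_subord_rpow_const hα 0 u₀).continuousOn.add (hS.continuousOn_duhamelP hα hf)

/-- The solution of the Riemann–Liouville problem. -/
noncomputable def rlSol (α : ℝ) (S : ℝ → H →L[ℝ] H) (u₀ : H) (f : ℝ → H) (t : ℝ) : H :=
  t ^ (α - 1) • (α • subord α 1 S (t ^ α) u₀) + duhamelP α S f t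

/-- The continuous extension of `t^(1-α)` times the solution of the Riemann–Liouville problem. -/
noncomputable def rlSolScaled (α : ℝ) (S : ℝ → H →L[ℝ] H) (u₀ : H) (f : ℝ → H) (t : ℝ) : H :=
  α • subord α 1 S (t ^ α) u₀ + t ^ (1 - α) • duhamelP α S f t

theorem rlSolScaled_eq {t : ℝ} (ht : 0 < t) :
    rlSolScaled α S u₀ f t = t ^ (1 - α) • rlSol α S u₀ f t := by
  rw [rlSolScaled, rlSol, smul_add, smul_smul, ← Real.rpow_add ht,
    show 1 - α + (α - 1) = 0 by ring, Real.rpow_zero, one_smul]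

theorem IsDiagonalSemigroup.continuousOn_rlSolScaled (hS : IsDiagonalSemigroup φ lam S)
    (hα : α ∈ Ioo (0 : ℝ) 1) (hf : Continuous f) : ContinuousOn (rlSolScaled α S u₀ f) (Ici 0) :=
  ((hS.continuous_subord_rpow_const hα 1 u₀).const_smul α).continuousOn.add
    ((Real.continuous_rpow_const (by linarith [hα.2])).continuousOn.smul
      (hS.continuousOn_duhamelP hα hf))

variable [CompleteSpace H]

theorem IsDiagonalSemigroup.inner_subord_zero (hS : IsDiagonalSemigroup φ lam S)
    (hα : α ∈ Ioo (0 : ℝ) 1) {t : ℝ} (ht : 0 ≤ t) (v : H) (j : ℕ) :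
    inner ℝ (subord α 0 S (t ^ α) v) (φ j) = relaxation α (lam j) t * inner ℝ v (φ j) := by
  rw [hS.inner_subord hα 0 (Real.rpow_nonneg ht α), relaxation_eq hα]

theorem IsDiagonalSemigroup.inner_subord_one (hS : IsDiagonalSemigroup φ lam S)
    (hα : α ∈ Ioo (0 : ℝ) 1) {t : ℝ} (ht : 0 ≤ t) (v : H) (j : ℕ) :
    inner ℝ (t ^ (α - 1) • (α • subord α 1 S (t ^ α) v)) (φ j) =
      scalarP α (lam j) t * inner ℝ v (φ j) := by
  rw [real_inner_smul_left, real_inner_smul_left, hS.inner_subord hα 1 (Real.rpow_nonneg ht α),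
    scalarP_eq hα]
  ring

theorem IsDiagonalSemigroup.inner_duhamelP (hS : IsDiagonalSemigroup φ lam S)
    (hα : α ∈ Ioo (0 : ℝ) 1) (hg : Continuous g) {t : ℝ} (ht : 0 ≤ t) (j : ℕ) :
    inner ℝ (duhamelP α S g t) (φ j) =
      conv (scalarP α (lam j)) (fun τ => inner ℝ (g τ) (φ j)) t := by
  rw [duhamelP, inner_intervalIntegral_left
    (intervalIntegrable_rpow_smul_comp_sub (hS.continuous_smul_subord_rpow hα) hg hα.1 t)]
  refine intervalIntegral.integral_congr fun τ hτ => ?_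
  rw [uIcc_of_le ht] at hτ
  exact hS.inner_subord_one hα (sub_nonneg.2 hτ.2) _ _

theorem IsDiagonalSemigroup.inner_duhamelE (hS : IsDiagonalSemigroup φ lam S)
    (hα : α ∈ Ioo (0 : ℝ) 1) (hg : Continuous g) {t : ℝ} (ht : 0 ≤ t) (j : ℕ) :
    inner ℝ (duhamelE α S g t) (φ j) =
      conv (relaxation α (lam j)) (fun τ => inner ℝ (g τ) (φ j)) t := by
  rw [duhamelE, inner_intervalIntegral_left
    (intervalIntegrable_rpow_smul_comp_sub (hS.continuous_subord_rpow hα 0) hg one_pos t)]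
  refine intervalIntegral.integral_congr fun τ hτ => ?_
  rw [uIcc_of_le ht] at hτ
  simp only [sub_self, Real.rpow_zero, one_smul]
  exact hS.inner_subord_zero hα (sub_nonneg.2 hτ.2) _ _

theorem IsDiagonalSemigroup.inner_caputoSol (hS : IsDiagonalSemigroup φ lam S)
    (hα : α ∈ Ioo (0 : ℝ) 1) (hf : Continuous f) {t : ℝ} (ht : 0 ≤ t) (j : ℕ) :
    inner ℝ (caputoSol α S u₀ f t) (φ j) = relaxation α (lam j) t * inner ℝ u₀ (φ j) +
      conv (scalarP α (lam j)) (fun τ => inner ℝ (f τ) (φ j)) t := by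
  rw [caputoSol, inner_add_left, hS.inner_subord_zero hα ht, hS.inner_duhamelP hα hf ht]

theorem IsDiagonalSemigroup.subord_zero_zero (hS : IsDiagonalSemigroup φ lam S)
    (hα : α ∈ Ioo (0 : ℝ) 1) (v : H) : subord α 0 S ((0 : ℝ) ^ α) v = v := by
  refine hilbertBasis_ext φ fun j => ?_
  rw [hS.inner_subord_zero hα le_rfl, relaxation_zero hα, one_mul]

theorem IsDiagonalSemigroup.caputoSol_zero (hS : IsDiagonalSemigroup φ lam S)
    (hα : α ∈ Ioo (0 : ℝ) 1) : caputoSol α S u₀ f 0 = u₀ := by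
  rw [caputoSol, hS.subord_zero_zero hα, duhamelP, intervalIntegral.integral_same, add_zero]

/-- Here `W = L u` and `w₀ = L u₀`. The scalar identity with `λ` removed translates into `W =
E(t)(w₀ - f(0)) + f - E * f'`, visibly continuous in `L²`. -/
theorem IsDiagonalSemigroup.exists_caputoSol_energy (hS : IsDiagonalSemigroup φ lam S)
    (hα : α ∈ Ioo (0 : ℝ) 1) (hf : ∀ t, HasDerivAt f (f' t) t) (hf' : Continuous f')
    (hw : ∀ j, inner ℝ w₀ (φ j) = lam j * inner ℝ u₀ (φ j)) :
    ∃ W : ℝ → H, ContinuousOn W (Ioi 0) ∧ ∀ t, 0 < t → ∀ j,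
      inner ℝ (W t) (φ j) = lam j * inner ℝ (caputoSol α S u₀ f t) (φ j) := by
  have hfc : Continuous f := continuous_iff_continuousAt.2 fun t => (hf t).continuousAt
  refine ⟨fun t => subord α 0 S (t ^ α) (w₀ - f 0) + f t - duhamelE α S f' t, ?_, ?_⟩
  · exact ((hS.continuous_subord_rpow_const hα 0 _).add hfc).continuousOn.sub
      ((hS.continuousOn_duhamelE hα hf').mono Ioi_subset_Ici_self)
  · intro t ht j
    rw [hS.inner_caputoSol hα hfc ht.le, mul_relaxation_add_conv hα (hS.lam_pos j).le
      (hasDerivAt_inner_left hf (φ j)) (continuous_inner_left hf' _) ht, inner_sub_left,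
      inner_add_left, hS.inner_subord_zero hα ht.le, inner_sub_left, hw,
      hS.inner_duhamelE hα hf' ht.le]

theorem IsDiagonalSemigroup.exists_hasDerivAt_caputoSol (hS : IsDiagonalSemigroup φ lam S)
    (hα : α ∈ Ioo (0 : ℝ) 1) (hf : ∀ t, HasDerivAt f (f' t) t) (hf' : Continuous f')
    (hw : ∀ j, inner ℝ w₀ (φ j) = lam j * inner ℝ u₀ (φ j)) :
    ∃ V : ℝ → H, ContinuousOn V (Ioi 0) ∧
      ∀ t, 0 < t → HasDerivAt (caputoSol α S u₀ f) (V t) t := by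
  have hfc : Continuous f := continuous_iff_continuousAt.2 fun t => (hf t).continuousAt
  let V : ℝ → H := fun t =>
    -(t ^ (α - 1) • (α • subord α 1 S (t ^ α) (w₀ - f 0))) + duhamelP α S f' t
  have hV : ContinuousOn V (Ioi 0) := by
    refine ContinuousOn.add (ContinuousOn.neg (ContinuousOn.smul (fun t ht => ?_) ?_))
      ((hS.continuousOn_duhamelP hα hf').mono Ioi_subset_Ici_self)
    · exact (Real.continuousAt_rpow_const _ _ (Or.inl (ne_of_gt ht))).continuousWithinAt
    · exact ((hS.continuous_subord_rpow_const hα 1 _).const_smul α).continuousOn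
  refine ⟨V, hV, fun t ht => hasDerivAt_of_hasDerivAt_inner φ hV (fun j t ht => ?_) ht⟩
  refine ((hasDerivAt_relaxation_add_conv (c := inner ℝ u₀ (φ j)) hα (hS.lam_pos j).le
    (hasDerivAt_inner_left hf (φ j)) (continuous_inner_left hf' _)
    ht).congr_of_eventuallyEq ?_).congr_deriv ?_
  · filter_upwards [Ioi_mem_nhds ht] with r hr
    exact hS.inner_caputoSol hα hfc (le_of_lt hr) j
  · simp only [V]
    rw [inner_add_left, inner_neg_left, hS.inner_subord_one hα ht.le, inner_sub_left, hw,
      hS.inner_duhamelP hα hf' ht.le]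
    ring

theorem IsDiagonalSemigroup.inner_rlSol (hS : IsDiagonalSemigroup φ lam S)
    (hα : α ∈ Ioo (0 : ℝ) 1) (hf : Continuous f) {t : ℝ} (ht : 0 ≤ t) (j : ℕ) :
    inner ℝ (rlSol α S u₀ f t) (φ j) = scalarP α (lam j) t * inner ℝ u₀ (φ j) +
      conv (scalarP α (lam j)) (fun τ => inner ℝ (f τ) (φ j)) t := by
  rw [rlSol, inner_add_left, hS.inner_subord_one hα ht, hS.inner_duhamelP hα hf ht]

theorem IsDiagonalSemigroup.exists_rlSolScaled_energy (hS : IsDiagonalSemigroup φ lam S)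
    (hα : α ∈ Ioo (0 : ℝ) 1) (hf : ∀ t, HasDerivAt f (f' t) t) (hf' : Continuous f')
    (hw : ∀ j, inner ℝ w₀ (φ j) = lam j * inner ℝ u₀ (φ j)) :
    ∃ W : ℝ → H, ContinuousOn W (Ioi 0) ∧ ∀ t, 0 < t → ∀ j,
      inner ℝ (W t) (φ j) = lam j * inner ℝ (rlSolScaled α S u₀ f t) (φ j) := by
  have hfc : Continuous f := continuous_iff_continuousAt.2 fun t => (hf t).continuousAt
  refine ⟨fun t => α • subord α 1 S (t ^ α) w₀ +
    t ^ (1 - α) • (f t - subord α 0 S (t ^ α) (f 0) - duhamelE α S f' t), ?_, ?_⟩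
  · exact ((hS.continuous_subord_rpow_const hα 1 _).const_smul α).continuousOn.add
      ((Real.continuous_rpow_const (by linarith [hα.2])).continuousOn.smul
      ((hfc.sub (hS.continuous_subord_rpow_const hα 0 _)).continuousOn.sub
      ((hS.continuousOn_duhamelE hα hf').mono Ioi_subset_Ici_self)))
  · intro t ht j
    have h := mul_conv_scalarP_eq hα (hS.lam_pos j).le
      (hasDerivAt_inner_left hf (φ j)) (continuous_inner_left hf' _) ht
    have hr := Real.rpow_nonneg ht.le α
    rw [rlSolScaled, inner_add_left, inner_add_left, real_inner_smul_left, real_inner_smul_left,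
      real_inner_smul_left, real_inner_smul_left, hS.inner_subord hα 1 hr,
      hS.inner_subord hα 1 hr, hw, hS.inner_duhamelP hα hfc ht.le, inner_sub_left, inner_sub_left,
      hS.inner_subord_zero hα ht.le, hS.inner_duhamelE hα hf' ht.le, mul_add,
      mul_left_comm (lam j) (t ^ (1 - α)), h]
    ring

/-- In coordinates `t^(1-α) P(t) = α M₁(λ t^α)`, with `M_n` the function `mainardiMoment α n`. Its
derivative produces `-λ M₂`, and the factor `λ` is absorbed by passing from `u₀` to `w₀`. -/
theorem IsDiagonalSemigroup.exists_hasDerivAt_rlSolScaled (hS : IsDiagonalSemigroup φ lam S)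
    (hα : α ∈ Ioo (0 : ℝ) 1) (hf : ∀ t, HasDerivAt f (f' t) t) (hf' : Continuous f')
    (hw : ∀ j, inner ℝ w₀ (φ j) = lam j * inner ℝ u₀ (φ j)) :
    ∃ V : ℝ → H, ContinuousOn V (Ioi 0) ∧
      ∀ t, 0 < t → HasDerivAt (rlSolScaled α S u₀ f) (V t) t := by
  have hfc : Continuous f := continuous_iff_continuousAt.2 fun t => (hf t).continuousAt
  have hpow : ∀ p : ℝ, ContinuousOn (fun t : ℝ => t ^ p) (Ioi 0) := fun p t ht =>
    (Real.continuousAt_rpow_const _ _ (Or.inl (ne_of_gt ht))).continuousWithinAt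
  let V : ℝ → H := fun t =>
    -((α * (α * t ^ (α - 1))) • subord α 2 S (t ^ α) w₀) +
      (((1 - α) * t ^ ((1 - α) - 1)) • duhamelP α S f t +
      t ^ (1 - α) • (t ^ (α - 1) • (α • subord α 1 S (t ^ α) (f 0)) + duhamelP α S f' t))
  have hP : ∀ {g}, Continuous g → ContinuousOn (duhamelP α S g) (Ioi 0) := fun hg =>
    (hS.continuousOn_duhamelP hα hg).mono Ioi_subset_Ici_self
  have hV : ContinuousOn V (Ioi 0) := by
    refine ContinuousOn.add (ContinuousOn.neg (ContinuousOn.smul ?_ ?_))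
      (ContinuousOn.add (ContinuousOn.smul ?_ (hP hfc)) (ContinuousOn.smul (hpow _)
      (ContinuousOn.add (ContinuousOn.smul (hpow _) ?_) (hP hf'))))
    · exact continuousOn_const.mul (continuousOn_const.mul (hpow _))
    · exact (hS.continuous_subord_rpow_const hα 2 _).continuousOn
    · exact continuousOn_const.mul (hpow _)
    · exact ((hS.continuous_subord_rpow_const hα 1 _).const_smul α).continuousOn
  refine ⟨V, hV, fun t ht => hasDerivAt_of_hasDerivAt_inner φ hV (fun j t ht => ?_) ht⟩
  have h1 : HasDerivAt (fun t : ℝ => lam j * t ^ α) (lam j * (α * t ^ (α - 1))) t :=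
    (Real.hasDerivAt_rpow_const (Or.inl ht.ne')).const_mul _
  have h2 := (((hasDerivAt_mainardiMoment hα 1 (lam j * t ^ α)).comp t h1).const_mul α).mul_const
    (inner ℝ u₀ (φ j))
  have h3 := (Real.hasDerivAt_rpow_const (p := 1 - α) (Or.inl ht.ne')).mul
    (hasDerivAt_conv_scalarP hα (hS.lam_pos j).le (hasDerivAt_inner_left hf (φ j))
    (continuous_inner_left hf' _) ht)
  refine ((h2.add h3).congr_of_eventuallyEq ?_).congr_deriv ?_
  · filter_upwards [Ioi_mem_nhds ht] with r hr
    have hr : 0 < r := hr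
    rw [rlSolScaled, inner_add_left, real_inner_smul_left, real_inner_smul_left,
      hS.inner_subord hα 1 (Real.rpow_nonneg hr.le α), hS.inner_duhamelP hα hfc hr.le]
    simp only [Pi.add_apply, Pi.mul_apply, Function.comp]
    ring
  · simp only [V]
    rw [inner_add_left, inner_add_left, inner_neg_left, real_inner_smul_left, real_inner_smul_left,
      real_inner_smul_left, inner_add_left, hS.inner_subord hα 2 (Real.rpow_nonneg ht.le α),
      hS.inner_subord_one hα ht.le, hw, hS.inner_duhamelP hα hfc ht.le,
      hS.inner_duhamelP hα hf' ht.le]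
    ring

/-- The vector form of `k * (P c + P * h) = E c + E * h`. Its right side is continuous up to `t = 0`
with value `u₀`, which yields the initial condition. -/
theorem IsDiagonalSemigroup.rlIntegral_rlSol (hS : IsDiagonalSemigroup φ lam S)
    (hα : α ∈ Ioo (0 : ℝ) 1) (hf : Continuous f) {t : ℝ} (ht : 0 < t) :
    rlIntegral (1 - α) (rlSol α S u₀ f) t = subord α 0 S (t ^ α) u₀ + duhamelE α S f t := by
  have hi : IntervalIntegrable (fun ξ => (t - ξ) ^ ((1 - α) - 1) • rlSol α S u₀ f ξ) volume 0 t :=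
    intervalIntegrable_rpow_smul_of_scaled hα ht ((hS.continuousOn_rlSolScaled (u₀ := u₀) hα
      hf).mono Icc_subset_Ici_self) fun ξ hξ => rlSolScaled_eq hξ.1
  refine hilbertBasis_ext φ fun j => ?_
  rw [inner_add_left, hS.inner_subord_zero hα ht.le, hS.inner_duhamelE hα hf ht.le, rlIntegral,
    real_inner_smul_left, inner_intervalIntegral_left hi, mul_comm (relaxation _ _ _),
    ← rlIntegral_scalarP_add hα (hS.lam_pos j).le (continuous_inner_left hf _) ht, rlIntegral,
    smul_eq_mul]
  congr 1
  refine intervalIntegral.integral_congr fun ξ hξ => ?_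
  rw [uIcc_of_le ht.le] at hξ
  rw [real_inner_smul_left, hS.inner_rlSol hα hf hξ.1, smul_eq_mul, mul_comm (scalarP _ _ _)]

theorem IsDiagonalSemigroup.tendsto_rlIntegral_rlSol (hS : IsDiagonalSemigroup φ lam S)
    (hα : α ∈ Ioo (0 : ℝ) 1) (hf : Continuous f) :
    Tendsto (rlIntegral (1 - α) (rlSol α S u₀ f)) (𝓝[>] 0) (𝓝 u₀) := by
  have h := ((hS.continuous_subord_rpow_const hα 0 u₀).continuousOn.add
    (hS.continuousOn_duhamelE hα hf)) 0 self_mem_Ici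
  have h' := h.tendsto.mono_left (nhdsWithin_mono 0 Ioi_subset_Ici_self)
  rw [Pi.add_apply, hS.subord_zero_zero hα, duhamelE, intervalIntegral.integral_same,
    add_zero] at h'
  refine h'.congr' ?_
  filter_upwards [self_mem_nhdsWithin] with t ht
  exact (hS.rlIntegral_rlSol hα hf ht).symm

end Evolution


/-- The derivative is extended by its endpoint values outside `[0,T]` and integrated back. -/
theorem exists_hasDerivAt_extension {H : Type*} [NormedAddCommGroup H] [NormedSpace ℝ H]
    [CompleteSpace H] {T : ℝ} (hT : 0 < T) {f : ℝ → H} (hf : ContDiffOn ℝ 1 f (Icc 0 T)) :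
    ∃ F F' : ℝ → H, (∀ t, HasDerivAt F (F' t) t) ∧ Continuous F' ∧ ∀ t ∈ Icc 0 T, F t = f t := by
  obtain ⟨hd, hc⟩ := (contDiffOn_one_iff_derivWithin (uniqueDiffOn_Icc hT)).1 hf
  let F' : ℝ → H := fun t => derivWithin f (Icc 0 T) (projIcc 0 T hT.le t)
  have hF' : Continuous F' := hc.comp_continuous (by fun_prop) fun t => (projIcc 0 T hT.le t).2
  refine ⟨fun t => f 0 + ∫ x in (0 : ℝ)..t, F' x, F', fun t => ?_, hF', fun t ht => ?_⟩
  · exact (hF'.integral_hasStrictDerivAt 0 t).hasDerivAt.const_add _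
  · simp only
    rw [intervalIntegral.integral_eq_sub_of_hasDerivAt_of_le ht.1 (f := f)
      (hd.continuousOn.mono (Icc_subset_Icc_right ht.2)) (fun x hx => ?_)
      (hF'.intervalIntegrable _ _)]
    · abel
    · have hx' : x ∈ Icc 0 T := ⟨hx.1.le, hx.2.le.trans ht.2⟩
      have h := (hd x hx').hasDerivWithinAt.hasDerivAt (Icc_mem_nhds hx.1 (hx.2.trans_le ht.2))
      simpa only [F', projIcc_of_mem hT.le hx'] using h

/-! ### Solution class and uniqueness. -/

section Uniqueness

variable {d : ℕ} {Ω : Set (EuclideanSpace ℝ (Fin d))} {φ : HilbertBasis ℕ ℝ (L2 Ω)} {lam : ℕ → ℝ}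
  {α T : ℝ} {u₀ : L2 Ω} {f u v : ℝ → L2 Ω}

/-- Since `W` represents `L u`, the energy norm of `u t - u t₀` is the `L²` norm of `W t - W t₀`. -/
theorem memSolutionClass_of_hasDerivAt {W V : ℝ → L2 Ω} (hu : ContinuousOn u (Ici 0))
    (hW : ContinuousOn W (Ioi 0))
    (hWu : ∀ t, 0 < t → ∀ j, inner ℝ (W t) (φ j) = lam j * inner ℝ (u t) (φ j))
    (hV : ContinuousOn V (Ioi 0)) (hVu : ∀ t, 0 < t → HasDerivAt u (V t) t) :
    MemSolutionClass φ lam T u := by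
  refine ⟨hu.mono Icc_subset_Ici_self, ⟨fun t ht => ?_, fun t₀ ht₀ => ?_⟩, ?_⟩
  · refine (hasSum_inner_sq φ (W t)).summable.congr fun j => ?_
    rw [hWu t ht.1, mul_pow]
  · have e : ∀ t, 0 < t → energyNormSq φ lam (u t - u t₀) = ‖W t - W t₀‖ ^ 2 := by
      intro t ht
      rw [energyNormSq, ← (hasSum_inner_sq φ (W t - W t₀)).tsum_eq]
      congr 1
      ext j
      rw [inner_sub_left, inner_sub_left, hWu t ht, hWu t₀ ht₀.1, ← mul_sub, mul_pow]
    have h1 : Tendsto (fun t => ‖W t - W t₀‖ ^ 2) (𝓝[Ioc 0 T] t₀) (𝓝 0) := by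
      have h2 := (((hW t₀ ht₀.1).mono (Ioc_subset_Ioi_self : Ioc 0 T ⊆ _)).sub
        (continuousWithinAt_const (b := W t₀))).norm.pow 2
      simpa [ContinuousWithinAt, Pi.pow_def] using h2
    refine h1.congr' ?_
    filter_upwards [self_mem_nhdsWithin] with t ht using (e t ht.1).symm
  · refine ContDiffOn.mono (s := Ioi 0) ?_ Ioc_subset_Ioi_self
    rw [contDiffOn_one_iff_derivWithin (uniqueDiffOn_Ioi 0)]
    refine ⟨fun t ht => (hVu t ht).differentiableAt.differentiableWithinAt, hV.congr fun t ht => ?_⟩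
    rw [derivWithin_of_isOpen isOpen_Ioi ht, (hVu t ht).deriv]

/-- The scalar uniqueness lemma is applied to the difference `g` of the derivatives: the equal
initial values give `∫ g = y₁ - y₂`, so the Caputo equation is `k * g = -λ (1 * g)`. The endpoints
follow by continuity. -/
theorem IsCaputoSolution.eqOn (hα : α ∈ Ioo (0 : ℝ) 1) (hlam : ∀ j, 0 < lam j) (hT : 0 < T)
    (hu : IsCaputoSolution φ lam α T u₀ f u) (hv : IsCaputoSolution φ lam α T u₀ f v) :
    EqOn v u (Icc 0 T) := by
  have key : EqOn v u (Ioo 0 T) := by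
    have hdiff : ∀ w : ℝ → L2 Ω, IsCaputoSolution φ lam α T u₀ f w → ∀ j, ∀ t ∈ Ioo 0 T,
        DifferentiableAt ℝ (fun r => inner ℝ (w r) (φ j)) t := by
      intro w hw j t ht
      have h1 : DifferentiableAt ℝ w t :=
        (hw.mem_class.contDiff_L2.differentiableOn one_ne_zero t
          ⟨ht.1, ht.2.le⟩).differentiableAt (mem_of_superset (Ioo_mem_nhds ht.1 ht.2) Ioo_subset_Ioc_self)
      exact h1.inner ℝ (differentiableAt_const _)
    intro t ht
    refine hilbertBasis_ext φ fun j => ?_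
    let y₁ : ℝ → ℝ := fun r => inner ℝ (v r) (φ j)
    let y₂ : ℝ → ℝ := fun r => inner ℝ (u r) (φ j)
    have hi : ∀ t ∈ Ioo 0 T, IntervalIntegrable
        (fun τ => (t - τ) ^ ((1 - α) - 1) * (deriv y₁ τ - deriv y₂ τ)) volume 0 t := by
      intro t ht
      refine ((hv.equation j t ht).1.sub (hu.equation j t ht).1).congr fun τ _ => ?_
      simp only [smul_eq_mul, y₁, y₂]
      ring
    have hg : ∀ t ∈ Ioo 0 T, IntervalIntegrable (fun τ => deriv y₁ τ - deriv y₂ τ) volume 0 t := by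
      intro t ht
      -- The continuous factor `(t-τ)^α` cancels the singular weight, so the derivatives themselves
      -- are integrable up to `0`.
      have h1 := (hi t ht).continuousOn_mul (g := fun τ => (t - τ) ^ α)
        (((Real.continuous_rpow_const hα.1.le).comp
          (continuous_const.sub continuous_id)).continuousOn)
      rw [intervalIntegrable_iff_integrableOn_Ioo_of_le ht.1.le] at h1 ⊢
      refine h1.congr_fun (fun τ hτ => ?_) measurableSet_Ioo
      have h0 : 0 < t - τ := sub_pos.2 hτ.2
      simp only
      rw [← mul_assoc, ← Real.rpow_add h0, show α + (1 - α - 1) = 0 by ring, Real.rpow_zero,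
        one_mul]
    have hint : ∀ t ∈ Ioo 0 T, ∫ τ in (0 : ℝ)..t, (deriv y₁ τ - deriv y₂ τ) = y₁ t - y₂ t := by
      intro t ht
      have hsub : Icc 0 t ⊆ Icc 0 T := Icc_subset_Icc_right ht.2.le
      rw [intervalIntegral.integral_eq_sub_of_hasDerivAt_of_le ht.1.le
        (f := fun r => y₁ r - y₂ r) ?_ (fun r hr => ?_) (hg t ht)]
      · simp only [y₁, y₂, hv.initial, hu.initial, sub_self, sub_zero]
      · exact ((hv.mem_class.continuous_L2.mono hsub).inner continuousOn_const).sub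
          ((hu.mem_class.continuous_L2.mono hsub).inner continuousOn_const)
      · have hr' : r ∈ Ioo 0 T := ⟨hr.1, hr.2.trans ht.2⟩
        exact (hdiff v hv j r hr').hasDerivAt.sub (hdiff u hu j r hr').hasDerivAt
    have h0 := integral_eq_zero_of_rlIntegral_eq hα (hlam j).le hg (fun t ht => ?_) t ht
    · rw [hint t ht] at h0
      exact sub_eq_zero.1 h0
    · rw [hint t ht, rlIntegral]
      have e1 := (hv.equation j t ht).2
      have e2 := (hu.equation j t ht).2
      have e3 : (Real.Gamma (1 - α))⁻¹ • ∫ ξ in (0 : ℝ)..t,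
          (t - ξ) ^ ((1 - α) - 1) • (deriv y₁ ξ - deriv y₂ ξ) =
          caputoDeriv α y₁ t - caputoDeriv α y₂ t := by
        simp only [smul_sub]
        rw [intervalIntegral.integral_sub (hv.equation j t ht).1 (hu.equation j t ht).1, smul_sub]
        rfl
      rw [e3]
      simp only [y₁, y₂]
      linear_combination e1 - e2
  refine key.of_subset_closure hv.mem_class.continuous_L2 hu.mem_class.continuous_L2
    Ioo_subset_Icc_self ?_
  rw [closure_Ioo hT.ne]

/-- For `g = y₁ - y₂`, the function `k * g` has derivative `-λ g` and limit `0` at `0` by the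
initial condition. Integration gives the hypothesis of the scalar lemma, and differentiating `∫ g =
0` gives `g = 0`. -/
theorem IsRLSolution.eqOn (hα : α ∈ Ioo (0 : ℝ) 1) (hlam : ∀ j, 0 < lam j) (hT : 0 < T)
    (hu : IsRLSolution φ lam α T u₀ f u) (hv : IsRLSolution φ lam α T u₀ f v) :
    EqOn v u (Ioc 0 T) := by
  obtain ⟨wu, hwu, hwu'⟩ := hu.mem_class
  obtain ⟨wv, hwv, hwv'⟩ := hv.mem_class
  have hcont : ∀ {u w : ℝ → L2 Ω}, MemSolutionClass φ lam T w →
      (∀ t ∈ Ioc 0 T, w t = t ^ (1 - α) • u t) → ContinuousOn u (Ioo 0 T) := by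
    intro u w hw hwu
    have hp : ContinuousOn (fun t : ℝ => t ^ (α - 1)) (Ioo 0 T) := fun t ht =>
      (Real.continuousAt_rpow_const _ _ (Or.inl ht.1.ne')).continuousWithinAt
    have h1 := hp.smul (hw.continuous_L2.mono Ioo_subset_Icc_self)
    refine h1.congr fun t ht => ?_
    rw [Pi.smul_apply', hwu t ⟨ht.1, ht.2.le⟩, smul_smul, ← Real.rpow_add ht.1,
      show α - 1 + (1 - α) = 0 by ring, Real.rpow_zero, one_smul]
  have key : EqOn v u (Ioo 0 T) := by
    intro t ht
    refine hilbertBasis_ext φ fun j => ?_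
    let y₁ : ℝ → ℝ := fun r => inner ℝ (v r) (φ j)
    let y₂ : ℝ → ℝ := fun r => inner ℝ (u r) (φ j)
    have hcI : ∀ {u w : ℝ → L2 Ω}, MemSolutionClass φ lam T w →
        (∀ t ∈ Ioc 0 T, w t = t ^ (1 - α) • u t) → ∀ t ∈ Ioo 0 T,
        IntervalIntegrable u volume 0 t ∧
        IntervalIntegrable (fun ξ => (t - ξ) ^ ((1 - α) - 1) • u ξ) volume 0 t := by
      intro u w hw hwu t ht
      have h1 := hw.continuous_L2.mono (Icc_subset_Icc_right ht.2.le)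
      have h2 := fun ξ (hξ : ξ ∈ Ioc 0 t) => hwu ξ ⟨hξ.1, hξ.2.trans ht.2.le⟩
      exact ⟨intervalIntegrable_of_scaled hα ht.1 h1 h2,
        intervalIntegrable_rpow_smul_of_scaled hα ht.1 h1 h2⟩
    have hinner : ∀ {u : ℝ → L2 Ω} {t : ℝ}, IntervalIntegrable u volume 0 t →
        IntervalIntegrable (fun ξ => inner ℝ (u ξ) (φ j)) volume 0 t := by
      intro u t hu
      have h : IntervalIntegrable (fun ξ => innerSL ℝ (φ j) (u ξ)) volume 0 t :=
        ⟨(innerSL ℝ (φ j)).integrable_comp hu.1, (innerSL ℝ (φ j)).integrable_comp hu.2⟩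
      refine h.congr fun ξ _ => ?_
      simp only [innerSL_apply_apply]
      rw [real_inner_comm]
    have hrl : ∀ {u : ℝ → L2 Ω} {t : ℝ},
        IntervalIntegrable (fun ξ => (t - ξ) ^ ((1 - α) - 1) • u ξ) volume 0 t →
        IntervalIntegrable (fun ξ => (t - ξ) ^ ((1 - α) - 1) • inner ℝ (u ξ) (φ j)) volume 0 t ∧
        rlIntegral (1 - α) (fun r => inner ℝ (u r) (φ j)) t =
          inner ℝ (rlIntegral (1 - α) u t) (φ j) := by
      intro u t hu
      have h1 := hinner hu
      simp only [real_inner_smul_left] at h1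
      refine ⟨h1, ?_⟩
      rw [rlIntegral, rlIntegral, real_inner_smul_left, inner_intervalIntegral_left hu]
      simp only [real_inner_smul_left, smul_eq_mul]
    have hsub : ∀ t ∈ Ioo 0 T, rlIntegral (1 - α) (fun r => y₁ r - y₂ r) t =
        rlIntegral (1 - α) y₁ t - rlIntegral (1 - α) y₂ t := by
      intro t ht
      rw [rlIntegral, rlIntegral, rlIntegral, ← smul_sub, ← intervalIntegral.integral_sub
        (hrl (hcI hwv hwv' t ht).2).1 (hrl (hcI hwu hwu' t ht).2).1]
      simp only [smul_sub, y₁, y₂]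
    have hg : ∀ t ∈ Ioo 0 T, IntervalIntegrable (fun τ => y₁ τ - y₂ τ) volume 0 t := fun t ht =>
      (hinner (hcI hwv hwv' t ht).1).sub (hinner (hcI hwu hwu' t ht).1)
    have hZ : ∀ t ∈ Ioo 0 T, HasDerivAt (fun t => rlIntegral (1 - α) y₁ t - rlIntegral (1 - α) y₂ t)
        (-(lam j * (y₁ t - y₂ t))) t := by
      intro t ht
      have h1 := (hv.equation j t ht).1.hasDerivAt.sub (hu.equation j t ht).1.hasDerivAt
      refine h1.congr_deriv ?_
      have e1 := (hv.equation j t ht).2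
      have e2 := (hu.equation j t ht).2
      simp only [rlDeriv] at e1 e2
      simp only [y₁, y₂]
      linear_combination e1 - e2
    have hlim : Tendsto (fun t => rlIntegral (1 - α) y₁ t - rlIntegral (1 - α) y₂ t) (𝓝[>] 0)
        (𝓝 0) := by
      have h1 := (hv.initial.inner (𝕜 := ℝ) (tendsto_const_nhds (x := φ j))).sub
        (hu.initial.inner (𝕜 := ℝ) (tendsto_const_nhds (x := φ j)))
      rw [sub_self] at h1
      refine h1.congr' ?_
      filter_upwards [Ioo_mem_nhdsGT hT] with t ht
      rw [← (hrl (hcI hwv hwv' t ht).2).2, ← (hrl (hcI hwu hwu' t ht).2).2]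
    have hzero := integral_eq_zero_of_rlIntegral_eq hα (hlam j).le hg (fun t ht => by
      have h := intervalIntegral.integral_eq_sub_of_hasDerivAt_of_tendsto ht.1
        (fun r hr => hZ r ⟨hr.1, hr.2.trans ht.2⟩) ((hg t ht).const_mul (lam j)).neg hlim
        ((hZ t ht).continuousAt.tendsto.mono_left nhdsWithin_le_nhds)
      rw [hsub t ht, ← sub_zero (_ - _), ← h, intervalIntegral.integral_neg,
        intervalIntegral.integral_const_mul])
    have hcy : ContinuousOn (fun r => y₁ r - y₂ r) (Ioo 0 T) :=
      ((hcont hwv hwv').inner continuousOn_const).sub ((hcont hwu hwu').inner continuousOn_const)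
    have hd1 := intervalIntegral.integral_hasDerivAt_right (hg t ht)
      (hcy.stronglyMeasurableAtFilter isOpen_Ioo t ht)
      (hcy.continuousAt (Ioo_mem_nhds ht.1 ht.2))
    have hd2 : HasDerivAt (fun t => ∫ τ in (0 : ℝ)..t, (y₁ τ - y₂ τ)) 0 t := by
      refine (hasDerivAt_const t (0 : ℝ)).congr_of_eventuallyEq ?_
      filter_upwards [Ioo_mem_nhds ht.1 ht.2] with r hr using hzero r hr
    exact sub_eq_zero.1 (hd1.unique hd2)
  -- The equation is only known on the open interval; the endpoint `T` is reached through the scaled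
  -- functions, continuous on `[0,T]`.
  have hw : EqOn wv wu (Icc 0 T) := by
    refine EqOn.of_subset_closure (s := Ioo 0 T) (fun t ht => ?_) hwv.continuous_L2
      hwu.continuous_L2 Ioo_subset_Icc_self (by rw [closure_Ioo hT.ne])
    rw [hwv' t ⟨ht.1, ht.2.le⟩, hwu' t ⟨ht.1, ht.2.le⟩, key ht]
  intro t ht
  have h1 := hw ⟨ht.1.le, ht.2⟩
  rw [hwv' t ht, hwu' t ht] at h1
  exact smul_right_injective _ (Real.rpow_pos_of_pos ht.1 _).ne' h1

end Uniqueness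


/-! ### The heat kernel as an `L²`-valued function of `x`, and its positivity. -/

section HeatElement

variable {d : ℕ} {Ω : Set (EuclideanSpace ℝ (Fin d))}
  {φ : HilbertBasis ℕ ℝ (L2 Ω)} {lam : ℕ → ℝ} {S : ℝ → L2 Ω →L[ℝ] L2 Ω}

variable (φ lam) in
/-- The point `x` at which all the sums `∑_j e^(-2λ_j s) φ_j(x)²`, `s > 0`, converge. -/
def HeatSummableAt (x : EuclideanSpace ℝ (Fin d)) : Prop :=
  ∀ s : ℝ, 0 < s → Summable fun j => (Real.exp (-(lam j * s)) * φ j x) ^ 2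

/-- The inequality `e^(-λs) ≤ N! (λs)^(-N)` compares the sums with the pointwise Bessel bound, on a
null set independent of `s`. -/
theorem ae_heatSummableAt (hlam : ∀ j, 0 < lam j)
    (h : ∃ (N : ℕ) (C : ℝ), ∀ᵐ x ∂(volume.restrict Ω), ∀ F : Finset ℕ,
      ∑ j ∈ F, ((lam j)⁻¹ ^ N * φ j x) ^ 2 ≤ C) :
    ∀ᵐ x ∂(volume.restrict Ω), HeatSummableAt φ lam x := by
  obtain ⟨N, C, h⟩ := h
  filter_upwards [h] with x hx s hs
  have h1 : Summable fun j => ((lam j)⁻¹ ^ N * φ j x) ^ 2 :=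
    summable_of_sum_le (fun j => sq_nonneg _) hx
  refine Summable.of_nonneg_of_le (fun j => sq_nonneg _) (fun j => ?_)
    (h1.mul_left ((N.factorial / s ^ N) ^ 2))
  have h2 := Real.pow_div_factorial_le_exp (lam j * s) (mul_pos (hlam j) hs).le N
  have h3 : Real.exp (-(lam j * s)) ≤ N.factorial / s ^ N * (lam j)⁻¹ ^ N := by
    have hl := hlam j
    rw [Real.exp_neg, inv_le_comm₀ (Real.exp_pos _) (by positivity)]
    refine le_trans (le_of_eq ?_) h2
    rw [mul_pow, inv_pow]
    field_simp
  rw [← mul_pow, ← mul_assoc, mul_pow, mul_pow _ (φ j x)]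
  gcongr

variable (φ lam) in
/-- The element `∑_j e^(-λ_j s) φ_j(x) φ_j` of `L²(Ω)`. -/
noncomputable def heatElem (s : ℝ) (x : EuclideanSpace ℝ (Fin d)) : L2 Ω :=
  ∑' j, (Real.exp (-(lam j * s)) * φ j x) • φ j

theorem HeatSummableAt.hasSum {x : EuclideanSpace ℝ (Fin d)} (hx : HeatSummableAt φ lam x)
    {s : ℝ} (hs : 0 < s) :
    HasSum (fun j => (Real.exp (-(lam j * s)) * φ j x) • φ j) (heatElem φ lam s x) := by
  obtain ⟨w, hw⟩ := exists_of_summable_sq φ (hx s hs)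
  have h := hasSum_inner_smul φ w
  simp only [hw] at h
  exact h.summable.hasSum

theorem HeatSummableAt.inner_heatElem {x : EuclideanSpace ℝ (Fin d)}
    (hx : HeatSummableAt φ lam x) {s : ℝ} (hs : 0 < s) (j : ℕ) :
    inner ℝ (heatElem φ lam s x) (φ j) = Real.exp (-(lam j * s)) * φ j x := by
  obtain ⟨w, hw⟩ := exists_of_summable_sq φ (hx s hs)
  have h := hasSum_inner_smul φ w
  simp only [hw] at h
  rw [heatElem, h.tsum_eq, hw]

theorem HeatSummableAt.hasSum_inner {x : EuclideanSpace ℝ (Fin d)}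
    (hx : HeatSummableAt φ lam x) {s : ℝ} (hs : 0 < s) (v : L2 Ω) :
    HasSum (fun j => Real.exp (-(lam j * s)) * φ j x * inner ℝ v (φ j))
      (inner ℝ (heatElem φ lam s x) v) := by
  refine (φ.hasSum_inner_mul_inner (heatElem φ lam s x) v).congr_fun fun j => ?_
  rw [hx.inner_heatElem hs, real_inner_comm v (φ j)]

/-- The `L²` sum of a series agrees almost everywhere with its pointwise sum. -/
theorem coeFn_eq_tsum {a : ℕ → ℝ} {w : L2 Ω} (hw : HasSum (fun j => a j • φ j) w)
    (ha : ∀ᵐ x ∂(volume.restrict Ω), Summable fun j => a j * φ j x) :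
    ∀ᵐ x ∂(volume.restrict Ω), w x = ∑' j, a j * φ j x := by
  -- `L²` convergence gives almost everywhere convergence along a subsequence, whose limit must be
  -- the pointwise sum.
  obtain ⟨ns, hns, hlim⟩ := (tendstoInMeasure_of_tendsto_Lp hw.tendsto_sum_nat).exists_seq_tendsto_ae
  have hsum : ∀ᵐ x ∂(volume.restrict Ω), ∀ n : ℕ,
      (∑ j ∈ Finset.range n, a j • φ j : L2 Ω) x = ∑ j ∈ Finset.range n, a j * φ j x := by
    rw [ae_all_iff]
    intro n
    have h1 := coeFn_finset_sum (μ := volume.restrict Ω) (Finset.range n) fun j => a j • φ j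
    have h2 : ∀ᵐ x ∂(volume.restrict Ω), ∀ j, (a j • φ j : L2 Ω) x = a j * φ j x := by
      rw [ae_all_iff]
      intro j
      filter_upwards [Lp.coeFn_smul (a j) (φ j)] with x hx
      rw [hx, Pi.smul_apply, smul_eq_mul]
    filter_upwards [h1, h2] with x hx1 hx2
    rw [hx1]
    exact Finset.sum_congr rfl fun j _ => hx2 j
  filter_upwards [hlim, hsum, ha] with x hx1 hx2 hx3
  simp only [hx2] at hx1
  exact tendsto_nhds_unique hx1 (hx3.hasSum.tendsto_sum_nat.comp hns.tendsto_atTop)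

/-- Pointwise convergence comes from splitting `e^(-λs)` into two factors `e^(-λs/2)`, one for
`φ_j(x)` and one for `φ_j(y)`. -/
theorem heatKernel_ae_eq (hae : ∀ᵐ y ∂(volume.restrict Ω), HeatSummableAt φ lam y)
    {x : EuclideanSpace ℝ (Fin d)} (hx : HeatSummableAt φ lam x) {s : ℝ} (hs : 0 < s) :
    ∀ᵐ y ∂(volume.restrict Ω), heatElem φ lam s x y = heatKernel φ lam s x y := by
  have habs : ∀ a b : ℝ, |a * b| ≤ a ^ 2 + b ^ 2 := fun a b => abs_le.2
    ⟨by nlinarith [sq_nonneg (a + b)], by nlinarith [sq_nonneg (a - b)]⟩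
  have h := coeFn_eq_tsum (hx.hasSum hs) (by
    filter_upwards [hae] with y hy
    have h1 := (hx (s / 2) (half_pos hs)).add (hy (s / 2) (half_pos hs))
    refine Summable.of_norm_bounded h1 fun j => ?_
    have e : Real.exp (-(lam j * s)) =
        Real.exp (-(lam j * (s / 2))) * Real.exp (-(lam j * (s / 2))) := by
      rw [← Real.exp_add]; congr 1; ring
    rw [e, mul_assoc (_ * _), mul_mul_mul_comm, Real.norm_eq_abs]
    exact habs _ _)
  filter_upwards [h] with y hy
  rw [hy, heatKernel]
  simp only [mul_assoc]

theorem IsDiagonalSemigroup.apply_ae_eq (hS : IsDiagonalSemigroup φ lam S)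
    (hae : ∀ᵐ y ∂(volume.restrict Ω), HeatSummableAt φ lam y) {s : ℝ} (hs : 0 < s) (v : L2 Ω) :
    ∀ᵐ x ∂(volume.restrict Ω), S s v x = inner ℝ (heatElem φ lam s x) v := by
  have h := hasSum_inner_smul φ (S s v)
  have e : ∀ x j, inner ℝ (S s v) (φ j) * φ j x =
      Real.exp (-(lam j * s)) * φ j x * inner ℝ v (φ j) := fun x j => by
    rw [hS.inner_apply s hs.le]; ring
  have h1 := coeFn_eq_tsum h (by
    filter_upwards [hae] with x hx
    simp only [e]
    exact (hx.hasSum_inner hs v).summable)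
  filter_upwards [h1, hae] with x hx1 hx2
  rw [hx1, ← (hx2.hasSum_inner hs v).tsum_eq]
  simp only [e]

/-! ### Positivity -/

theorem inner_nonneg_of_nonneg {v w : L2 Ω} (hv : 0 ≤ᵐ[volume.restrict Ω] v)
    (hw : 0 ≤ᵐ[volume.restrict Ω] w) : 0 ≤ inner ℝ v w := by
  rw [L2.inner_def]
  refine integral_nonneg_of_ae ?_
  filter_upwards [hv, hw] with x h1 h2
  simp only [RCLike.inner_apply, conj_trivial]
  exact mul_nonneg h2 h1

theorem continuous_abs_L2 : Continuous fun v : L2 Ω => |v| := by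
  simp_rw [abs]; fun_prop

theorem abs_nonneg_ae (v : L2 Ω) : 0 ≤ᵐ[volume.restrict Ω] (|v| : L2 Ω) := by
  filter_upwards [Lp.coeFn_abs v] with x hx
  rw [hx]
  exact abs_nonneg _

theorem IsDiagonalSemigroup.inner_apply_comm (hS : IsDiagonalSemigroup φ lam S) {s : ℝ}
    (hs : 0 ≤ s) (v w : L2 Ω) : inner ℝ (S s v) w = inner ℝ v (S s w) := by
  refine (φ.hasSum_inner_mul_inner (S s v) w).unique
    ((φ.hasSum_inner_mul_inner v (S s w)).congr_fun fun j => ?_)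
  rw [hS.inner_apply s hs, real_inner_comm (S s w), hS.inner_apply s hs, real_inner_comm w]
  ring

variable [IsFiniteMeasure (volume.restrict Ω)]

theorem nonneg_of_forall_inner_indicator {w : L2 Ω}
    (h : ∀ (A : Set (EuclideanSpace ℝ (Fin d))) (hA : MeasurableSet A),
      0 ≤ inner ℝ (indicatorConstLp 2 hA (measure_ne_top (volume.restrict Ω) A) (1 : ℝ)) w) :
    0 ≤ᵐ[volume.restrict Ω] w := by
  refine ae_nonneg_of_forall_setIntegral_nonneg
    ((Lp.memLp w).integrable (by norm_num)) fun A hA _ => ?_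
  rw [← L2.inner_indicatorConstLp_one (𝕜 := ℝ) hA (measure_ne_top _ A)]
  exact h A hA

theorem indicator_nonneg_ae {A : Set (EuclideanSpace ℝ (Fin d))} (hA : MeasurableSet A) :
    ∀ᵐ x ∂(volume.restrict Ω),
      0 ≤ indicatorConstLp 2 hA (measure_ne_top (volume.restrict Ω) A) (1 : ℝ) x ∧
      indicatorConstLp 2 hA (measure_ne_top (volume.restrict Ω) A) (1 : ℝ) x ≤ 1 := by
  filter_upwards [indicatorConstLp_coeFn (p := 2) (hs := hA)
    (hμs := measure_ne_top (volume.restrict Ω) A) (c := (1 : ℝ))] with x hx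
  rw [hx]
  by_cases h : x ∈ A <;> simp [h]

/-- The submarkov property covers only bounded functions. Symmetry moves `S s` onto an indicator,
where it applies, and testing against all indicators suffices. -/
theorem IsDiagonalSemigroup.apply_nonneg (hS : IsDiagonalSemigroup φ lam S)
    (hsub : ∀ t : ℝ, 0 ≤ t → ∀ v : L2 Ω, (∀ᵐ x ∂(volume.restrict Ω), 0 ≤ v x ∧ v x ≤ 1) →
      ∀ᵐ x ∂(volume.restrict Ω), 0 ≤ (S t v) x ∧ (S t v) x ≤ 1) {s : ℝ} (hs : 0 ≤ s) {v : L2 Ω}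
    (hv : 0 ≤ᵐ[volume.restrict Ω] v) : 0 ≤ᵐ[volume.restrict Ω] S s v := by
  refine nonneg_of_forall_inner_indicator fun A hA => ?_
  rw [← hS.inner_apply_comm hs]
  exact inner_nonneg_of_nonneg ((hsub s hs _ (indicator_nonneg_ae hA)).mono fun x hx => hx.1) hv

/-- One null set must serve all `s`. It comes from countably many times `1/(n+1)` and a countable
dense family of test functions `|v|`. -/
theorem IsDiagonalSemigroup.ae_heatElem_nonneg (hS : IsDiagonalSemigroup φ lam S)
    (hae : ∀ᵐ y ∂(volume.restrict Ω), HeatSummableAt φ lam y)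
    (hpos : ∀ s : ℝ, 0 ≤ s → ∀ v : L2 Ω, 0 ≤ᵐ[volume.restrict Ω] v →
      0 ≤ᵐ[volume.restrict Ω] S s v) :
    ∀ᵐ x ∂(volume.restrict Ω), ∀ s : ℝ, 0 < s → 0 ≤ᵐ[volume.restrict Ω] heatElem φ lam s x := by
  have : Fact ((2 : ℝ≥0∞) ≠ ⊤) := ⟨by simp⟩
  have h1 : ∀ᵐ x ∂(volume.restrict Ω), ∀ n k : ℕ, 0 ≤ inner ℝ (heatElem φ lam (1 / (n + 1 : ℝ)) x)
      |TopologicalSpace.denseSeq (L2 Ω) k| := by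
    rw [ae_all_iff]; intro n
    rw [ae_all_iff]; intro k
    have hn : (0 : ℝ) < 1 / (n + 1 : ℝ) := by positivity
    filter_upwards [hS.apply_ae_eq hae hn |TopologicalSpace.denseSeq (L2 Ω) k|,
      hpos _ hn.le _ (abs_nonneg_ae (TopologicalSpace.denseSeq (L2 Ω) k))] with x hx1 hx2
    rw [← hx1]
    exact hx2
  filter_upwards [h1, hae] with x hx hxs s hs
  obtain ⟨n, hn⟩ := exists_nat_one_div_lt hs
  have hn0 : (0 : ℝ) < 1 / (n + 1 : ℝ) := by positivity
  have h2 : ∀ v : L2 Ω, 0 ≤ inner ℝ (heatElem φ lam (1 / (n + 1 : ℝ)) x) |v| := fun v =>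
    (TopologicalSpace.denseRange_denseSeq (L2 Ω)).induction_on v
      (isClosed_le continuous_const (continuous_const.inner continuous_abs_L2)) (hx n)
  have h3 : 0 ≤ᵐ[volume.restrict Ω] heatElem φ lam (1 / (n + 1 : ℝ)) x := by
    refine nonneg_of_forall_inner_indicator fun A hA => ?_
    have h := h2 (indicatorConstLp 2 hA (measure_ne_top (volume.restrict Ω) A) (1 : ℝ))
    rwa [abs_of_nonneg ((Lp.coeFn_nonneg _).1 ((indicator_nonneg_ae hA).mono fun x hx => hx.1)),
      real_inner_comm] at h
  -- Every later time is reached from a time `1/(n+1) < s` by the semigroup, which preserves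
  -- positivity.
  have e : heatElem φ lam s x = S (s - 1 / (n + 1 : ℝ)) (heatElem φ lam (1 / (n + 1 : ℝ)) x) := by
    refine hilbertBasis_ext φ fun j => ?_
    rw [hS.inner_apply _ (by linarith), hxs.inner_heatElem hs, hxs.inner_heatElem hn0, ← mul_assoc,
      ← Real.exp_add]
    congr 2
    ring
  rw [e]
  exact hpos _ (by linarith) _ h3

end HeatElement


/-! ### Subordinated operators as integral operators. -/

section KernelRepresentation

variable {d : ℕ} {Ω : Set (EuclideanSpace ℝ (Fin d))}
  {φ : HilbertBasis ℕ ℝ (L2 Ω)} {lam : ℕ → ℝ} {S : ℝ → L2 Ω →L[ℝ] L2 Ω} {α : ℝ}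

theorem inner_L2_eq (v w : L2 Ω) : inner ℝ v w = ∫ x in Ω, v x * w x := by
  rw [L2.inner_def]
  simp only [RCLike.inner_apply, conj_trivial, mul_comm]

theorem integrable_mul_L2 (v w : L2 Ω) : IntegrableOn (fun x => v x * w x) Ω := by
  have h := L2.integrable_inner (𝕜 := ℝ) v w
  simp only [RCLike.inner_apply, conj_trivial, mul_comm] at h
  exact h

theorem measurable_L2 (v : L2 Ω) : Measurable v := (Lp.stronglyMeasurable v).measurable

/-- Because the heat element is nonnegative, the absolute integral in `y` equals its pairing with
`|v|`. The hypothesis on `|v|` is therefore exactly joint integrability, and Fubini gives both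
claims. -/
theorem integrableOn_kernel_mul (hα : α ∈ Ioo (0 : ℝ) 1)
    (hae : ∀ᵐ y ∂(volume.restrict Ω), HeatSummableAt φ lam y)
    {x : EuclideanSpace ℝ (Fin d)} (hx : HeatSummableAt φ lam x)
    (hpos : ∀ s : ℝ, 0 < s → 0 ≤ᵐ[volume.restrict Ω] heatElem φ lam s x) {k : ℕ} {r : ℝ}
    (hr : 0 < r) {v : L2 Ω}
    (hi : IntegrableOn (fun σ => σ ^ k * mainardi α σ * inner ℝ (heatElem φ lam (σ * r) x) |v|)
      (Ioi 0)) :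
    IntegrableOn (fun y => (∫ σ in Ioi (0 : ℝ), σ ^ k * mainardi α σ *
      heatKernel φ lam (σ * r) x y) * v y) Ω ∧
    ∫ y in Ω, (∫ σ in Ioi (0 : ℝ), σ ^ k * mainardi α σ * heatKernel φ lam (σ * r) x y) * v y =
      ∫ σ in Ioi (0 : ℝ), σ ^ k * mainardi α σ * inner ℝ (heatElem φ lam (σ * r) x) v := by
  let F : ℝ → EuclideanSpace ℝ (Fin d) → ℝ := fun σ y =>
    σ ^ k * mainardi α σ * heatKernel φ lam (σ * r) x y * v y
  have hm : AEStronglyMeasurable (Function.uncurry F)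
      ((volume.restrict (Ioi 0)).prod (volume.restrict Ω)) := by
    refine ((integrableOn_pow_mul_mainardi' hα k).aestronglyMeasurable.comp_fst.mul
      (Measurable.aestronglyMeasurable ?_)).mul
      ((measurable_L2 v).comp measurable_snd).aestronglyMeasurable
    refine Measurable.tsum fun j => ?_
    have h1 : Measurable fun z : ℝ × EuclideanSpace ℝ (Fin d) => φ j z.2 :=
      (measurable_L2 (φ j)).comp measurable_snd
    exact Measurable.mul (by fun_prop) (h1.const_mul _)
  have hker : ∀ σ ∈ Ioi (0 : ℝ), ∀ᵐ y ∂(volume.restrict Ω),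
      F σ y = σ ^ k * mainardi α σ * (heatElem φ lam (σ * r) x y * v y) := by
    intro σ hσ
    filter_upwards [heatKernel_ae_eq hae hx (mul_pos hσ hr)] with y hy
    simp only [F]
    rw [hy, mul_assoc]
  have hF : Integrable (Function.uncurry F)
      ((volume.restrict (Ioi 0)).prod (volume.restrict Ω)) := by
    refine (integrable_prod_iff hm).2 ⟨?_, ?_⟩
    · filter_upwards [ae_restrict_mem measurableSet_Ioi] with σ hσ
      refine ((integrable_mul_L2 (heatElem φ lam (σ * r) x) v).const_mul
        (σ ^ k * mainardi α σ)).congr ?_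
      filter_upwards [hker σ hσ] with y hy using hy.symm
    · refine hi.norm.congr ?_
      filter_upwards [ae_restrict_mem measurableSet_Ioi] with σ hσ
      have h0 := hpos (σ * r) (mul_pos hσ hr)
      rw [norm_mul, Real.norm_of_nonneg (inner_nonneg_of_nonneg h0 (abs_nonneg_ae v)),
        inner_L2_eq, ← integral_const_mul]
      refine integral_congr_ae ?_
      filter_upwards [hker σ hσ, h0, Lp.coeFn_abs v] with y h1 h2 h3
      simp only [Function.uncurry]
      rw [h1, h3]
      simp only [norm_mul]
      rw [Real.norm_of_nonneg (show 0 ≤ heatElem φ lam (σ * r) x y from h2),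
        Real.norm_eq_abs (v y)]
  have e : ∀ y, (∫ σ in Ioi (0 : ℝ), σ ^ k * mainardi α σ * heatKernel φ lam (σ * r) x y) * v y =
      ∫ σ in Ioi (0 : ℝ), F σ y := fun y => (integral_mul_const _ _).symm
  simp only [e]
  refine ⟨hF.integral_prod_right, ?_⟩
  rw [← integral_integral_swap hF]
  refine setIntegral_congr_fun measurableSet_Ioi fun σ hσ => ?_
  rw [inner_L2_eq, ← integral_const_mul]
  exact integral_congr_ae (hker σ hσ)

theorem IsDiagonalSemigroup.integrable_duhamelP (hS : IsDiagonalSemigroup φ lam S)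
    (hα : α ∈ Ioo (0 : ℝ) 1) {g : ℝ → L2 Ω} (hg : Continuous g) {t : ℝ} (ht : 0 < t) :
    Integrable (fun z : ℝ × ℝ => ((t - z.1) ^ (α - 1) * (α * (z.2 ^ 1 * mainardi α z.2))) •
      S (z.2 * max ((t - z.1) ^ α) 0) (g z.1))
      ((volume.restrict (Ioo 0 t)).prod (volume.restrict (Ioi 0))) := by
  have hq : Integrable (fun z : ℝ × ℝ => (t - z.1) ^ (α - 1) * (α * (z.2 ^ 1 * mainardi α z.2)))
      ((volume.restrict (Ioo 0 t)).prod (volume.restrict (Ioi 0))) :=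
    ((intervalIntegrable_iff_integrableOn_Ioo_of_le ht.le).1
      (intervalIntegrable_rpow_sub hα.1 t)).integrable.mul_prod
      ((integrableOn_pow_mul_mainardi' hα 1).const_mul α)
  obtain ⟨M, hM⟩ := (isCompact_Icc (a := 0) (b := t)).exists_bound_of_continuousOn hg.continuousOn
  have hmem : ∀ᵐ z ∂((volume.restrict (Ioo 0 t)).prod (volume.restrict (Ioi (0 : ℝ)))),
      z ∈ Ioo 0 t ×ˢ Ioi (0 : ℝ) := by
    rw [Measure.prod_restrict]
    exact ae_restrict_mem (measurableSet_Ioo.prod measurableSet_Ioi)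
  refine (hq.norm.mul_const M).mono' (hq.1.smul ?_) ?_
  · have hc : Continuous fun z : ℝ × ℝ => S (max z.2 0 * max ((t - z.1) ^ α) 0) (g z.1) :=
      hS.continuous_mul_max continuous_snd ((Real.continuous_rpow_const hα.1.le).comp
        (continuous_const.sub continuous_fst)) (hg.comp continuous_fst)
    refine hc.aestronglyMeasurable.congr ?_
    filter_upwards [hmem] with z hz
    rw [max_eq_left (le_of_lt (mem_Ioi.1 hz.2))]
  · filter_upwards [hmem] with z hz
    rw [norm_smul]
    refine mul_le_mul_of_nonneg_left ?_ (norm_nonneg _)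
    exact (hS.norm_apply_le (mul_nonneg (le_of_lt (mem_Ioi.1 hz.2)) (le_max_right _ _)) _).trans
      (hM _ ⟨hz.1.1.le, hz.1.2.le⟩)

theorem IsDiagonalSemigroup.integral_prod_eq_duhamelP (hS : IsDiagonalSemigroup φ lam S)
    (hα : α ∈ Ioo (0 : ℝ) 1) {g : ℝ → L2 Ω} (hg : Continuous g) {t : ℝ} (ht : 0 < t) :
    ∫ z : ℝ × ℝ, ((t - z.1) ^ (α - 1) * (α * (z.2 ^ 1 * mainardi α z.2))) •
      S (z.2 * max ((t - z.1) ^ α) 0) (g z.1)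
      ∂((volume.restrict (Ioo 0 t)).prod (volume.restrict (Ioi 0))) = duhamelP α S g t := by
  rw [integral_prod _ (hS.integrable_duhamelP hα hg ht), duhamelP,
    intervalIntegral.integral_of_le ht.le, integral_Ioc_eq_integral_Ioo]
  refine setIntegral_congr_fun measurableSet_Ioo fun τ _ => ?_
  simp only [subord, mul_smul]
  rw [integral_smul, integral_smul]

variable [IsFiniteMeasure (volume.restrict Ω)]

/-- A Bochner integral in `L²(Ω)` is computed pointwise almost everywhere. -/
theorem ae_coeFn_integral_eq {Z : Type*} [MeasurableSpace Z] {ν : Measure Z} [SFinite ν]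
    {w : Z → L2 Ω} (hw : Integrable w ν) {F : Z → EuclideanSpace ℝ (Fin d) → ℝ}
    (hF : AEStronglyMeasurable (Function.uncurry F) (ν.prod (volume.restrict Ω)))
    (h : ∀ᵐ z ∂ν, ∀ᵐ x ∂(volume.restrict Ω), w z x = F z x) :
    Integrable (Function.uncurry F) (ν.prod (volume.restrict Ω)) ∧
    ∀ᵐ x ∂(volume.restrict Ω), (∫ z, w z ∂ν : L2 Ω) x = ∫ z, F z x ∂ν := by
  have hint : Integrable (Function.uncurry F) (ν.prod (volume.restrict Ω)) := by
    refine (integrable_prod_iff hF).2 ⟨?_, ?_⟩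
    · filter_upwards [h] with z hz
      exact ((Lp.memLp (w z)).integrable (by norm_num)).congr hz
    -- On a finite measure space `∫ |w z| = ⟨1, |w z|⟩ ≤ ‖1‖ ‖w z‖`, so Bochner integrability in
    -- `L²` gives joint integrability.
    · let one : L2 Ω := indicatorConstLp 2 MeasurableSet.univ
        (measure_ne_top (volume.restrict Ω) univ) (1 : ℝ)
      refine (hw.norm.const_mul ‖one‖).mono' hF.norm.integral_prod_right' ?_
      filter_upwards [h] with z hz
      rw [Real.norm_of_nonneg (integral_nonneg fun x => norm_nonneg _)]
      have e : ∫ x in Ω, ‖Function.uncurry F (z, x)‖ = inner ℝ one |w z| := by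
        rw [L2.inner_indicatorConstLp_one, setIntegral_univ]
        refine integral_congr_ae ?_
        filter_upwards [hz, Lp.coeFn_abs (w z)] with x h1 h2
        rw [h2, h1, Real.norm_eq_abs, Function.uncurry]
      rw [e, ← norm_abs_eq_norm (w z)]
      exact real_inner_le_norm _ _
  refine ⟨hint, ?_⟩
  refine Integrable.ae_eq_of_forall_setIntegral_eq _ _ ((Lp.memLp _).integrable (by norm_num))
    hint.integral_prod_right fun A hA _ => ?_
  have hintA : Integrable (Function.uncurry F) (ν.prod ((volume.restrict Ω).restrict A)) := by
    have h1 := hint.restrict (s := univ ×ˢ A)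
    rwa [← Measure.prod_restrict, Measure.restrict_univ] at h1
  rw [← L2.inner_indicatorConstLp_one (𝕜 := ℝ) hA (measure_ne_top _ A), ← integral_inner hw,
    ← integral_integral_swap hintA]
  refine integral_congr_ae ?_
  filter_upwards [h] with z hz
  rw [L2.inner_indicatorConstLp_one]
  exact integral_congr_ae (ae_restrict_of_ae hz)

theorem IsDiagonalSemigroup.ae_coeFn_integral_smul (hS : IsDiagonalSemigroup φ lam S)
    (hae : ∀ᵐ y ∂(volume.restrict Ω), HeatSummableAt φ lam y)
    {Z : Type*} [MeasurableSpace Z] {ν : Measure Z} [SFinite ν] {q s : Z → ℝ} {v : Z → L2 Ω}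
    (hq : AEStronglyMeasurable q ν) (hs : Measurable s) (hs0 : ∀ᵐ z ∂ν, 0 < s z)
    (hv : ∀ j, Measurable fun z => inner ℝ (v z) (φ j))
    (hw : Integrable (fun z => q z • S (s z) (v z)) ν) :
    ∀ᵐ x ∂(volume.restrict Ω),
      Integrable (fun z => q z * inner ℝ (heatElem φ lam (s z) x) (v z)) ν ∧
      (∫ z, q z • S (s z) (v z) ∂ν : L2 Ω) x =
        ∫ z, q z * inner ℝ (heatElem φ lam (s z) x) (v z) ∂ν := by
  -- The series replaces the inner product because it is visibly jointly measurable in `(z, x)`.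
  let F : Z → EuclideanSpace ℝ (Fin d) → ℝ := fun z x =>
    q z * ∑' j, Real.exp (-(lam j * s z)) * φ j x * inner ℝ (v z) (φ j)
  have hF : AEStronglyMeasurable (Function.uncurry F) (ν.prod (volume.restrict Ω)) := by
    refine hq.comp_fst.mul (Measurable.aestronglyMeasurable ?_)
    refine Measurable.tsum fun j => ?_
    refine Measurable.mul (Measurable.mul ?_ ((measurable_L2 (φ j)).comp measurable_snd))
      ((hv j).comp measurable_fst)
    exact Real.measurable_exp.comp (((hs.comp measurable_fst).const_mul _).neg)
  obtain ⟨h1, h2⟩ := ae_coeFn_integral_eq hw hF (by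
    filter_upwards [hs0] with z hz
    filter_upwards [hS.apply_ae_eq hae hz (v z), hae, Lp.coeFn_smul (q z) (S (s z) (v z))]
      with x hx1 hx2 hx3
    rw [hx3, Pi.smul_apply, hx1, ← (hx2.hasSum_inner hz (v z)).tsum_eq, smul_eq_mul])
  filter_upwards [h1.prod_left_ae, h2, hae] with x hx1 hx2 hx3
  have e : (fun z => F z x) =ᵐ[ν] fun z => q z * inner ℝ (heatElem φ lam (s z) x) (v z) := by
    filter_upwards [hs0] with z hz
    simp only [F]
    rw [(hx3.hasSum_inner hz (v z)).tsum_eq]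
  exact ⟨hx1.congr e, hx2.trans (integral_congr_ae e)⟩

/-- The points at which the heat kernel is well behaved. -/
def IsHeatPoint (φ : HilbertBasis ℕ ℝ (L2 Ω)) (lam : ℕ → ℝ) (x : EuclideanSpace ℝ (Fin d)) :
    Prop :=
  HeatSummableAt φ lam x ∧ ∀ s : ℝ, 0 < s → 0 ≤ᵐ[volume.restrict Ω] heatElem φ lam s x

theorem IsDiagonalSemigroup.ae_subord_eq_kernel (hS : IsDiagonalSemigroup φ lam S)
    (hα : α ∈ Ioo (0 : ℝ) 1) (hae : ∀ᵐ y ∂(volume.restrict Ω), IsHeatPoint φ lam y) (k : ℕ)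
    {r : ℝ} (hr : 0 < r) (v : L2 Ω) :
    ∀ᵐ x ∂(volume.restrict Ω),
      IntegrableOn (fun y => (∫ σ in Ioi (0 : ℝ), σ ^ k * mainardi α σ *
        heatKernel φ lam (σ * r) x y) * v y) Ω ∧
      ∫ y in Ω, (∫ σ in Ioi (0 : ℝ), σ ^ k * mainardi α σ * heatKernel φ lam (σ * r) x y) * v y =
        subord α k S r v x := by
  have hae' : ∀ᵐ y ∂(volume.restrict Ω), HeatSummableAt φ lam y := hae.mono fun y hy => hy.1
  have key := fun v : L2 Ω => hS.ae_coeFn_integral_smul (ν := volume.restrict (Ioi (0 : ℝ)))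
    (q := fun σ => σ ^ k * mainardi α σ) (s := fun σ => σ * max r 0) (v := fun _ => v) hae'
    (integrableOn_pow_mul_mainardi' hα k).aestronglyMeasurable (by fun_prop) (by
      filter_upwards [ae_restrict_mem measurableSet_Ioi] with σ hσ
      exact mul_pos hσ (lt_max_of_lt_left hr)) (fun j => measurable_const)
    (hS.integrable_subord hα k r v)
  simp only [max_eq_left hr.le] at key
  filter_upwards [hae, key |v|, key v] with x hx h1 h2
  obtain ⟨h3, h4⟩ := integrableOn_kernel_mul hα hae' hx.1 hx.2 hr h1.1
  refine ⟨h3, h4.trans ?_⟩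
  rw [← h2.2, subord, max_eq_left hr.le]

/-- The pointwise formula on the product of the time variables is used for `|g|`, giving the
absolute convergence needed to recognise `opP` at almost every `τ`, and for `g`, giving the value.
-/
theorem IsDiagonalSemigroup.ae_duhamelP_eq_kernel (hS : IsDiagonalSemigroup φ lam S)
    (hα : α ∈ Ioo (0 : ℝ) 1) (hae : ∀ᵐ y ∂(volume.restrict Ω), IsHeatPoint φ lam y)
    {g : ℝ → L2 Ω} (hg : Continuous g) {t : ℝ} (ht : 0 < t) :
    ∀ᵐ x ∂(volume.restrict Ω),
      IntervalIntegrable (fun τ => opP φ lam α (t - τ) (g τ) x) volume 0 t ∧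
      duhamelP α S g t x = ∫ τ in (0 : ℝ)..t, opP φ lam α (t - τ) (g τ) x := by
  have hae' : ∀ᵐ y ∂(volume.restrict Ω), HeatSummableAt φ lam y := hae.mono fun y hy => hy.1
  have hmem : ∀ᵐ z ∂((volume.restrict (Ioo 0 t)).prod (volume.restrict (Ioi (0 : ℝ)))),
      z ∈ Ioo 0 t ×ˢ Ioi (0 : ℝ) := by
    rw [Measure.prod_restrict]
    exact ae_restrict_mem (measurableSet_Ioo.prod measurableSet_Ioi)
  have key : ∀ g : ℝ → L2 Ω, Continuous g → _ := fun g hg => hS.ae_coeFn_integral_smul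
    (ν := (volume.restrict (Ioo 0 t)).prod (volume.restrict (Ioi (0 : ℝ))))
    (s := fun z => z.2 * max ((t - z.1) ^ α) 0) (v := fun z => g z.1) hae'
    (((intervalIntegrable_iff_integrableOn_Ioo_of_le ht.le).1
      (intervalIntegrable_rpow_sub hα.1 t)).integrable.mul_prod
      ((integrableOn_pow_mul_mainardi' hα 1).const_mul α)).1 (by fun_prop) (by
        filter_upwards [hmem] with z hz
        exact mul_pos hz.2 (lt_max_of_lt_left (Real.rpow_pos_of_pos (sub_pos.2 hz.1.2) _)))
    (fun j => ((continuous_inner_left hg (φ j)).comp continuous_fst).measurable)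
    (hS.integrable_duhamelP hα hg ht)
  filter_upwards [hae, key (fun τ => |g τ|) (continuous_abs_L2.comp hg), key g hg] with x hx h1 h2
  rw [hS.integral_prod_eq_duhamelP hα hg ht] at h2
  have hop : ∀ᵐ τ ∂(volume.restrict (Ioo 0 t)), ∫ σ in Ioi (0 : ℝ),
      (t - τ) ^ (α - 1) * (α * (σ ^ 1 * mainardi α σ)) *
        inner ℝ (heatElem φ lam (σ * max ((t - τ) ^ α) 0) x) (g τ) =
      opP φ lam α (t - τ) (g τ) x := by
    filter_upwards [h1.1.prod_right_ae, ae_restrict_mem measurableSet_Ioo] with τ h3 hτ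
    have h0 : 0 < t - τ := sub_pos.2 hτ.2
    have hr := Real.rpow_pos_of_pos h0 α
    have hc : (t - τ) ^ (α - 1) * α ≠ 0 := (mul_pos (Real.rpow_pos_of_pos h0 _) hα.1).ne'
    simp only [max_eq_left hr.le] at h3 ⊢
    have h4 : IntegrableOn (fun σ => σ ^ 1 * mainardi α σ *
        inner ℝ (heatElem φ lam (σ * (t - τ) ^ α) x) |g τ|) (Ioi 0) := by
      refine (h3.const_mul ((t - τ) ^ (α - 1) * α)⁻¹).congr (Eventually.of_forall fun σ => ?_)
      have hα0 := hα.1.ne'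
      field_simp
    have h5 := (integrableOn_kernel_mul hα hae' hx.1 hx.2 hr h4).2
    have e : ∀ σ w, (t - τ) ^ (α - 1) * (α * (σ ^ 1 * mainardi α σ)) * w =
        (α * (t - τ) ^ (α - 1)) * (σ ^ 1 * mainardi α σ * w) := fun σ w => by ring
    simp only [e]
    rw [integral_const_mul, ← h5, opP]
    simp only [kernelP, pow_one, mul_assoc, integral_const_mul]
  constructor
  · rw [intervalIntegrable_iff_integrableOn_Ioo_of_le ht.le]
    exact h2.1.integral_prod_left.congr hop
  · rw [h2.2, integral_prod _ h2.1, intervalIntegral.integral_of_le ht.le,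
      integral_Ioc_eq_integral_Ioo]
    exact integral_congr_ae hop

end KernelRepresentation


/-! ### Assembling the solutions and their representations. -/

section Solutions

variable {d : ℕ} {Ω : Set (EuclideanSpace ℝ (Fin d))}
  {φ : HilbertBasis ℕ ℝ (L2 Ω)} {lam : ℕ → ℝ} {S : ℝ → L2 Ω →L[ℝ] L2 Ω} {α T : ℝ}
  {u₀ w₀ : L2 Ω} {f F F' : ℝ → L2 Ω}

theorem IsDiagonalSemigroup.isCaputoSolution (hS : IsDiagonalSemigroup φ lam S)
    (hα : α ∈ Ioo (0 : ℝ) 1) (hw : ∀ j, inner ℝ w₀ (φ j) = lam j * inner ℝ u₀ (φ j))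
    (hF : ∀ t, HasDerivAt F (F' t) t) (hF' : Continuous F') (hFf : ∀ t ∈ Icc 0 T, F t = f t) :
    IsCaputoSolution φ lam α T u₀ f (caputoSol α S u₀ F) := by
  have hFc : Continuous F := continuous_iff_continuousAt.2 fun t => (hF t).continuousAt
  obtain ⟨W, hW, hWu⟩ := hS.exists_caputoSol_energy hα hF hF' hw
  obtain ⟨V, hV, hVu⟩ := hS.exists_hasDerivAt_caputoSol hα hF hF' hw
  refine ⟨memSolutionClass_of_hasDerivAt (hS.continuousOn_caputoSol hα hFc) hW hWu hV hVu,
    fun j t ht => ?_, hS.caputoSol_zero hα⟩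
  rw [← hFf t ⟨ht.1.le, ht.2.le⟩]
  exact caputo_relaxation_add_conv hα (hS.lam_pos j).le (hasDerivAt_inner_left hF (φ j))
    (continuous_inner_left hF' _) (fun t ht => hS.inner_caputoSol hα hFc ht j) ht.1

theorem IsDiagonalSemigroup.isRLSolution (hS : IsDiagonalSemigroup φ lam S)
    (hα : α ∈ Ioo (0 : ℝ) 1) (hw : ∀ j, inner ℝ w₀ (φ j) = lam j * inner ℝ u₀ (φ j))
    (hF : ∀ t, HasDerivAt F (F' t) t) (hF' : Continuous F') (hFf : ∀ t ∈ Icc 0 T, F t = f t) :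
    IsRLSolution φ lam α T u₀ f (rlSol α S u₀ F) := by
  have hFc : Continuous F := continuous_iff_continuousAt.2 fun t => (hF t).continuousAt
  obtain ⟨W, hW, hWu⟩ := hS.exists_rlSolScaled_energy hα hF hF' hw
  obtain ⟨V, hV, hVu⟩ := hS.exists_hasDerivAt_rlSolScaled hα hF hF' hw
  refine ⟨⟨rlSolScaled α S u₀ F, memSolutionClass_of_hasDerivAt
    (hS.continuousOn_rlSolScaled hα hFc) hW hWu hV hVu, fun t ht => rlSolScaled_eq ht.1⟩,
    fun j t ht => ?_, hS.tendsto_rlIntegral_rlSol hα hFc⟩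
  rw [← hFf t ⟨ht.1.le, ht.2.le⟩]
  refine rl_scalarP_add_conv (c := inner ℝ u₀ (φ j)) hα (hS.lam_pos j).le
    (continuous_inner_left hFc (φ j)) (fun t ht => ?_) ht.1
  rw [hS.inner_rlSol hα hFc ht.le, mul_comm (scalarP _ _ _)]

theorem conv_scalarP_eq_integral {t : ℝ} (ht : t ∈ Icc 0 T) (hFf : ∀ t ∈ Icc 0 T, F t = f t)
    (l : ℝ) (e : L2 Ω) :
    conv (scalarP α l) (fun τ => inner ℝ (F τ) e) t =
      ∫ τ in (0 : ℝ)..t, scalarP α l (t - τ) * inner ℝ (f τ) e := by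
  refine intervalIntegral.integral_congr fun τ hτ => ?_
  rw [uIcc_of_le ht.1] at hτ
  simp only [hFf τ ⟨hτ.1, hτ.2.trans ht.2⟩]

theorem IsDiagonalSemigroup.hasSum_coeffC (hS : IsDiagonalSemigroup φ lam S)
    (hα : α ∈ Ioo (0 : ℝ) 1) (hF : Continuous F) (hFf : ∀ t ∈ Icc 0 T, F t = f t) {t : ℝ}
    (ht : t ∈ Icc 0 T) :
    HasSum (fun j => coeffC φ lam α u₀ f t j • φ j) (caputoSol α S u₀ F t) := by
  refine (hasSum_inner_smul φ _).congr_fun fun j => ?_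
  rw [hS.inner_caputoSol hα hF ht.1, conv_scalarP_eq_integral ht hFf]
  rfl

theorem IsDiagonalSemigroup.hasSum_coeffR (hS : IsDiagonalSemigroup φ lam S)
    (hα : α ∈ Ioo (0 : ℝ) 1) (hF : Continuous F) (hFf : ∀ t ∈ Icc 0 T, F t = f t) {t : ℝ}
    (ht : t ∈ Icc 0 T) :
    HasSum (fun j => coeffR φ lam α u₀ f t j • φ j) (rlSol α S u₀ F t) := by
  refine (hasSum_inner_smul φ _).congr_fun fun j => ?_
  rw [hS.inner_rlSol hα hF ht.1, conv_scalarP_eq_integral ht hFf]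
  rfl

variable [IsFiniteMeasure (volume.restrict Ω)]

theorem IsDiagonalSemigroup.ae_duhamelP_eq (hS : IsDiagonalSemigroup φ lam S)
    (hα : α ∈ Ioo (0 : ℝ) 1) (hae : ∀ᵐ y ∂(volume.restrict Ω), IsHeatPoint φ lam y)
    (hF : Continuous F) (hFf : ∀ t ∈ Icc 0 T, F t = f t) {t : ℝ} (ht : t ∈ Ioc 0 T) :
    ∀ᵐ x ∂(volume.restrict Ω),
      IntervalIntegrable (fun τ => opP φ lam α (t - τ) (f τ) x) volume 0 t ∧
      duhamelP α S F t x = ∫ τ in (0 : ℝ)..t, opP φ lam α (t - τ) (f τ) x := by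
  filter_upwards [hS.ae_duhamelP_eq_kernel hα hae hF ht.1] with x hx
  refine ⟨hx.1.congr fun τ hτ => ?_, hx.2.trans (intervalIntegral.integral_congr fun τ hτ => ?_)⟩
  · rw [uIoc_of_le ht.1.le] at hτ
    simp only [hFf τ ⟨hτ.1.le, hτ.2.trans ht.2⟩]
  · rw [uIcc_of_le ht.1.le] at hτ
    simp only [hFf τ ⟨hτ.1, hτ.2.trans ht.2⟩]

theorem IsDiagonalSemigroup.caputoSol_eq_solC (hS : IsDiagonalSemigroup φ lam S)
    (hα : α ∈ Ioo (0 : ℝ) 1) (hae : ∀ᵐ y ∂(volume.restrict Ω), IsHeatPoint φ lam y)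
    (hF : Continuous F) (hFf : ∀ t ∈ Icc 0 T, F t = f t) {t : ℝ} (ht : t ∈ Ioc 0 T) :
    ∀ᵐ x ∂(volume.restrict Ω),
      IntegrableOn (fun y => kernelS φ lam α t x y * u₀ y) Ω ∧
      IntervalIntegrable (fun τ => opP φ lam α (t - τ) (f τ) x) volume 0 t ∧
      caputoSol α S u₀ F t x = solC φ lam α u₀ f t x := by
  filter_upwards [hS.ae_duhamelP_eq hα hae hF hFf ht,
    hS.ae_subord_eq_kernel hα hae 0 (Real.rpow_pos_of_pos ht.1 α) u₀,
    Lp.coeFn_add (subord α 0 S (t ^ α) u₀) (duhamelP α S F t)] with x h1 h2 h3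
  simp only [pow_zero, one_mul] at h2
  refine ⟨h2.1, h1.1, ?_⟩
  rw [caputoSol, h3, Pi.add_apply, h1.2, ← h2.2]
  rfl

theorem IsDiagonalSemigroup.rlSol_eq_solR (hS : IsDiagonalSemigroup φ lam S)
    (hα : α ∈ Ioo (0 : ℝ) 1) (hae : ∀ᵐ y ∂(volume.restrict Ω), IsHeatPoint φ lam y)
    (hF : Continuous F) (hFf : ∀ t ∈ Icc 0 T, F t = f t) {t : ℝ} (ht : t ∈ Ioc 0 T) :
    ∀ᵐ x ∂(volume.restrict Ω),
      IntegrableOn (fun y => kernelP φ lam α t x y * u₀ y) Ω ∧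
      IntervalIntegrable (fun τ => opP φ lam α (t - τ) (f τ) x) volume 0 t ∧
      rlSol α S u₀ F t x = solR φ lam α u₀ f t x := by
  filter_upwards [hS.ae_duhamelP_eq hα hae hF hFf ht,
    hS.ae_subord_eq_kernel hα hae 1 (Real.rpow_pos_of_pos ht.1 α) u₀,
    Lp.coeFn_add (t ^ (α - 1) • (α • subord α 1 S (t ^ α) u₀)) (duhamelP α S F t),
    Lp.coeFn_smul (t ^ (α - 1)) (α • subord α 1 S (t ^ α) u₀),
    Lp.coeFn_smul α (subord α 1 S (t ^ α) u₀)] with x h1 h2 h3 h4 h5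
  simp only [pow_one] at h2
  have e : (fun y => kernelP φ lam α t x y * u₀ y) = fun y => (α * t ^ (α - 1)) *
      ((∫ σ in Ioi (0 : ℝ), σ * mainardi α σ * heatKernel φ lam (σ * t ^ α) x y) * u₀ y) := by
    ext y
    rw [kernelP, mul_assoc]
  refine ⟨?_, h1.1, ?_⟩
  · rw [e]
    exact h2.1.const_mul _
  · rw [rlSol, h3, Pi.add_apply, h1.2, h4, Pi.smul_apply, h5, Pi.smul_apply, ← h2.2, solR, opP, e,
      integral_const_mul]
    simp only [smul_eq_mul]
    ring

end Solutions

end FracDiff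

theorem mainTheorem1 {d : ℕ} (hd : 1 ≤ d)
    (Ω : Set (EuclideanSpace ℝ (Fin d))) (hΩ : IsBoundedSmoothDomain Ω)
    (s γ : ℝ) (hs : s ∈ Ioc (0 : ℝ) 1) (hγ : γ ∈ Ioc (0 : ℝ) 1)
    (G : EuclideanSpace ℝ (Fin d) → EuclideanSpace ℝ (Fin d) → ℝ)
    (hGmeas : Measurable (Function.uncurry G))
    (hG1 : HypG1 Ω G s γ) (hG2 : HypG2 Ω G s γ) (hG3 : HypG3 Ω G γ) (hS1 : HypS1 Ω G)
    (α : ℝ) (hα : α ∈ Ioo (0 : ℝ) 1) (T : ℝ) (hT : 0 < T) :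
    (∃ (φ : HilbertBasis ℕ ℝ (L2 Ω)) (lam : ℕ → ℝ), IsEigenbasis Ω G φ lam) ∧
    ∀ (φ : HilbertBasis ℕ ℝ (L2 Ω)) (lam : ℕ → ℝ), IsEigenbasis Ω G φ lam →
    ∀ (u₀ : L2 Ω) (f : ℝ → L2 Ω), MemEnergy φ lam u₀ → ContDiffOn ℝ 1 f (Icc 0 T) →
      (∃ u : ℝ → L2 Ω, IsCaputoSolution φ lam α T u₀ f u ∧
        (∀ v : ℝ → L2 Ω, IsCaputoSolution φ lam α T u₀ f v → ∀ t ∈ Icc 0 T, v t = u t) ∧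
        (∀ t ∈ Icc 0 T, HasSum (fun j => coeffC φ lam α u₀ f t j • φ j) (u t)) ∧
        (∀ t ∈ Ioc 0 T, ∀ᵐ x ∂(volume.restrict Ω),
          IntegrableOn (fun y => kernelS φ lam α t x y * u₀ y) Ω ∧
          IntervalIntegrable (fun τ => opP φ lam α (t - τ) (f τ) x) volume 0 t ∧
          u t x = solC φ lam α u₀ f t x)) ∧
      (∃ u : ℝ → L2 Ω, IsRLSolution φ lam α T u₀ f u ∧
        (∀ v : ℝ → L2 Ω, IsRLSolution φ lam α T u₀ f v → ∀ t ∈ Ioc 0 T, v t = u t) ∧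
        (∀ t ∈ Ioc 0 T, HasSum (fun j => coeffR φ lam α u₀ f t j • φ j) (u t)) ∧
        (∀ t ∈ Ioc 0 T, ∀ᵐ x ∂(volume.restrict Ω),
          IntegrableOn (fun y => kernelP φ lam α t x y * u₀ y) Ω ∧
          IntervalIntegrable (fun τ => opP φ lam α (t - τ) (f τ) x) volume 0 t ∧
          u t x = solR φ lam α u₀ f t x)) := by
  have hfin := isFiniteMeasure_restrict hΩ
  refine ⟨exists_isEigenbasis hd hΩ hs.1 hγ.1.le hGmeas hG1 hS1, ?_⟩
  intro φ lam hφ u₀ f hu₀ hf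
  have hlam := hφ.lam_pos hΩ hS1
  obtain ⟨S, hheat, hsub⟩ := hS1
  have hS : IsDiagonalSemigroup φ lam S :=
    ⟨hlam, fun t ht v j => hheat.repr_apply hφ ht v j, hheat.continuous⟩
  have hsum : ∀ᵐ x ∂(volume.restrict Ω), HeatSummableAt φ lam x :=
    ae_heatSummableAt hlam (hφ.exists_ae_sum_sq_le hd hΩ hs.1 hγ.1.le hGmeas hG1)
  have hae : ∀ᵐ x ∂(volume.restrict Ω), IsHeatPoint φ lam x :=
    hsum.and (hS.ae_heatElem_nonneg hsum fun s hs v hv => hS.apply_nonneg hsub hs hv)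
  -- `w₀` plays the role of `L u₀`; it exists because `u₀` has finite energy.
  obtain ⟨w₀, hw₀⟩ := exists_of_summable_sq φ (c := fun j => lam j * inner ℝ u₀ (φ j))
    (hu₀.congr fun j => (mul_pow _ _ _).symm)
  -- The evolution lemmas require data on the whole line; only the values on `[0,T]` enter the
  -- conclusions.
  obtain ⟨F, F', hF, hF', hFf⟩ := exists_hasDerivAt_extension hT hf
  have hFc : Continuous F := continuous_iff_continuousAt.2 fun t => (hF t).continuousAt
  have hC := hS.isCaputoSolution hα hw₀ hF hF' hFf
  have hR := hS.isRLSolution hα hw₀ hF hF' hFf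
  exact ⟨⟨caputoSol α S u₀ F, hC, fun v hv => hC.eqOn hα hlam hT hv,
    fun t ht => hS.hasSum_coeffC hα hFc hFf ht,
    fun t ht => hS.caputoSol_eq_solC hα hae hFc hFf ht⟩,
    ⟨rlSol α S u₀ F, hR, fun v hv => hR.eqOn hα hlam hT hv,
    fun t ht => hS.hasSum_coeffR hα hFc hFf (Ioc_subset_Icc_self ht),
    fun t ht => hS.rlSol_eq_solR hα hae hFc hFf ht⟩⟩
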